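/- Let $S$ be a finite set of points in the plane in general position (no three collinear), and let $n=|S|$. A plane spanning caterpillar on $S$ is a tree with vertex set $S$ whose straight-line edges do not cross and whose non-leaf vertices form a path, called its spine (possibly a single vertex, or empty). A slide replaces an edge $ab$ of such a caterpillar by an edge $ac$, where $bc$ is an edge of both the old and the new caterpillar and the triangle $abc$ contains no further point of $S$. The slide graph $G$ of $S$ has the plane spanning caterpillars on $S$ as vertices, two of them being adjacent if one can be transformed into the other by a single slide. A plane spanning caterpillar with spine $v_1,\dots,v_k$ (for a suitable choice of the direction of the spine) is well-separated if for every $1\le i\le k$ the convex hull of $S_{1,i}$ contains no point of $S\setminus S_{1,i}$, where $S_{1,i}$ consists of $v_1,\dots,v_i$ and all leaves attached to them. Then any two well-separated caterpillars on $S$ are connected by a sequence of slides, i.e. by a path in $G$. Moreover, if $n\ge 7$, then $G$ has a connected component which contains all well-separated caterpillars and has at least $\frac{3^n-1}{2}$ vertices. -/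

import Mathlib

/-- The Euclidean plane. -/
abbrev Plane : Type := EuclideanSpace ℝ (Fin 2)

/-- A finite point set in the plane is in general position if no three of its points are
collinear. -/
def GeneralPosition (S : Finset Plane) : Prop :=
  ∀ a ∈ S, ∀ b ∈ S, ∀ c ∈ S, a ≠ b → a ≠ c → b ≠ c → ¬ Collinear ℝ {a, b, c}

/-- A graph on the point set `S`, drawn with straight line segments, is plane if any two different
edges meet at most in common endpoints. -/
def IsPlaneGraph {S : Finset Plane} (T : SimpleGraph S) : Prop :=
  ∀ a b c d : S, T.Adj a b → T.Adj c d → s(a, b) ≠ s(c, d) →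
    segment ℝ (a : Plane) (b : Plane) ∩ segment ℝ (c : Plane) (d : Plane) ⊆
      ({(a : Plane), (b : Plane)} : Set Plane) ∩ {(c : Plane), (d : Plane)}

/-- A leaf is a vertex with exactly one neighbour. -/
def IsLeaf {V : Type*} (T : SimpleGraph V) (v : V) : Prop :=
  ∃! w, T.Adj v w

/-- `l = [v₁, …, v_k]` is a spine of `T`: the non-leaf vertices of `T`, each listed once, in the
order in which they form a path of `T`. The list may be empty or consist of a single vertex.
A spine read backwards is a spine. -/
def IsSpine {V : Type*} (T : SimpleGraph V) (l : List V) : Prop :=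
  l.Nodup ∧ (∀ v, v ∈ l ↔ ¬ IsLeaf T v) ∧ l.IsChain T.Adj

/-- A caterpillar is a tree in which all non-leaf vertices form a path. -/
def IsCaterpillar {V : Type*} (T : SimpleGraph V) : Prop :=
  T.IsTree ∧ ∃ l : List V, IsSpine T l

/-- The plane spanning caterpillars on `S`. -/
abbrev PlaneCaterpillar (S : Finset Plane) : Type :=
  {T : SimpleGraph S // IsPlaneGraph T ∧ IsCaterpillar T}

/-- `T₂` arises from `T₁` by a slide: an edge `ab` is replaced by an edge `ac`, where `bc` is an
edge of both graphs and the triangle `abc` contains no further point of `S`. -/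
def IsSlide {S : Finset Plane} (T₁ T₂ : SimpleGraph S) : Prop :=
  ∃ a b c : S, T₁.Adj a b ∧
    T₂.edgeSet = (T₁.edgeSet \ {s(a, b)}) ∪ {s(a, c)} ∧
    T₁.Adj b c ∧ T₂.Adj b c ∧
    convexHull ℝ ({(a : Plane), (b : Plane), (c : Plane)} : Set Plane) ∩ (S : Set Plane) ⊆
      {(a : Plane), (b : Plane), (c : Plane)}

/-- The slide graph of the plane spanning caterpillars on `S`: two different caterpillars are
adjacent if one of them can be transformed into the other by a single slide. -/
def slideGraph (S : Finset Plane) : SimpleGraph (PlaneCaterpillar S) :=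
  SimpleGraph.fromRel fun C D => IsSlide C.1 D.1

/-- The points `S_{1,i}`: the first `i` vertices of the list `l` (a spine) together with all leaves
attached to them. -/
def initialPoints {S : Finset Plane} (T : SimpleGraph S) (l : List S) (i : ℕ) : Set Plane :=
  {x | ∃ v : S, (v : Plane) = x ∧
    (v ∈ l.take i ∨ (IsLeaf T v ∧ ∃ w ∈ l.take i, T.Adj w v))}

/-- A caterpillar on `S` is well-separated if its spine can be directed as `v₁, …, v_k` so that for
every `1 ≤ i ≤ k` the convex hull of `S_{1,i}` contains no point of the rest of `S`. -/
def IsWellSeparated {S : Finset Plane} (T : SimpleGraph S) : Prop :=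
  ∃ l : List S, IsSpine T l ∧ ∀ i : ℕ, 1 ≤ i → i ≤ l.length →
    Disjoint (convexHull ℝ (initialPoints T l i)) ((S : Set Plane) \ initialPoints T l i)

/-! Every well-separated caterpillar is slid into a star, all stars are connected to each other, and
then enough plane caterpillars connected to one fixed star are counted.

A caterpillar is encoded as `catG l π`: a spine `l` and a map `π` sending each point off the spine
to its neighbour. Slides across empty triangles insert a leaf into a spine edge, undo this, move a
leaf along the spine or exchange the last two spine vertices. Two larger moves are built from them
by a mutual induction on the number of points involved. `starSplit` gathers all leaves that `w` has
on one side of the edge `wp` at one of them, which enters the spine between `w` and `p`. `triInsert`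
puts a leaf of `w` into a spine edge even when the triangle contains other leaves of `w`. `Ctx`
makes these moves local: edges outside a part `Q` meet its hull only in prescribed points of `S`, so
changes inside `Q` cannot create crossings with them.

For well-separated caterpillars, the end of the spine is processed repeatedly. If the spine ends in
`w, x`, well-separatedness bounds the hull of the star at `x`, so that the points in the join of `w`
with it form a `Fan`. `Fan.conn_star` sweeps around `w` and turns all of them into leaves of `w`;
the spine loses its last vertex and the separation of the other blocks persists
(`conn_star_of_full`). Two stars are connected by moving the leaves across their common edge, one
side after the other (`conn_star_star`).

For the count, fix an extreme point `v`. A tree is `Good` if, at the end of any caterpillar, it can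
be folded into a star at its root; the arbitrary prefix is what lets good trees be nested. Let h(m)
and g(m) be lower bounds for the good trees on a root and m points, and for those in which an
angularly extreme point `p` has a neighbour besides the root. Hanging `p` on the root gives h(m) =
h(m-1) + g(m). For g(m), either the other extreme point hangs on the root, or the root is a leaf of
some `q`, with a good tree at `q` on one side of the line and plain leaves on the other. This gives
g(m) = g(m-1) + Σ (h(k) + h(m-1-k) - 1) over k < m, the star at `q` being counted once. The
recursion (`treeCount`) outgrows (3^n - 1)/2 from n = 8 on. For n = 7 it gives only 963 instead of
1093, and trees with two branches at `v` (`splits`) fill the gap. -/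

/-! ### Oriented areas. -/

/-- The doubled signed area of the triangle `abc`, scaled by `σ`; a negative scale reverses the
orientation of the plane. -/
def area (σ : ℝ) (a b c : Plane) : ℝ :=
  σ * ((b 0 - a 0) * (c 1 - a 1) - (b 1 - a 1) * (c 0 - a 0))

section area
variable (σ : ℝ) (a b c d e : Plane)

lemma area_swap_left : area σ b a c = -area σ a b c := by unfold area; ring
lemma area_swap_right : area σ a c b = -area σ a b c := by unfold area; ring
lemma area_rotate : area σ b c a = area σ a b c := by unfold area; ring
lemma area_neg : area (-σ) a b c = -area σ a b c := by unfold area; ring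
@[simp] lemma area_left_self : area σ a b a = 0 := by unfold area; ring
@[simp] lemma area_right_self : area σ a b b = 0 := by unfold area; ring
@[simp] lemma area_base_self : area σ a a b = 0 := by unfold area; ring

lemma area_combo {s t : ℝ} (h : s + t = 1) :
    area σ a b (s • c + t • d) = s * area σ a b c + t * area σ a b d := by
  obtain rfl : t = 1 - s := by linarith
  simp only [area, PiLp.add_apply, PiLp.smul_apply, smul_eq_mul]; ring

/-- The three-term Grassmann–Plücker relation. It compares signs of triangles with a common vertex
`a` and so replaces arguments about angles. -/
lemma area_pluecker :
    area σ a b d * area σ a c e = area σ a b c * area σ a d e + area σ a b e * area σ a c d := by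
  unfold area; ring

lemma area_add : area σ a b e + area σ b c e + area σ c a e = area σ a b c := by
  unfold area; ring

/-- The scaled area is a square. Choosing the scale in this way makes any given triangle positively
oriented. -/
lemma area_scale (h : area 1 a b c ≠ 0) : 0 < area (area 1 a b c) a b c := by
  have : area (area 1 a b c) a b c = area 1 a b c * area 1 a b c := by unfold area; ring
  rw [this]; exact mul_self_pos.2 h

end area

/-- The angular order around `w` is transitive inside the open half-plane beside the line `wr`: the
Plücker relation writes the product with `area σ w r b` as a sum of positive products. Without the
common half-plane this fails. -/
lemma area_trans {σ : ℝ} {w r a b c : Plane} (ha : 0 < area σ w r a) (hb : 0 < area σ w r b)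
    (hc : 0 < area σ w r c) (hab : 0 < area σ w a b) (hbc : 0 < area σ w b c) :
    0 < area σ w a c := by
  have h := area_pluecker σ w r a b c
  have : 0 < area σ w r b * area σ w a c := by rw [h]; positivity
  exact pos_of_mul_pos_right this hb.le

/-! ### Convex hulls of subsets of `S` and their separation by lines. -/

variable {S : Finset Plane}
/-- The convex hull of a set of points of `S`. -/
def hull (Q : Set S) : Set Plane := convexHull ℝ ((↑) '' Q)

lemma hull_mono {P Q : Set S} (h : P ⊆ Q) : hull P ⊆ hull Q :=
  convexHull_mono (Set.image_mono h)

lemma mem_hull {Q : Set S} {v : S} (h : v ∈ Q) : (v : Plane) ∈ hull Q :=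
  subset_convexHull _ _ ⟨v, h, rfl⟩

lemma hull_pair (a b : S) : hull {a, b} = segment ℝ (a : Plane) b := by
  rw [hull, Set.image_pair, convexHull_pair]

lemma hull_triple (a b c : S) :
    hull {a, b, c} = convexHull ℝ {(a : Plane), (b : Plane), (c : Plane)} := by
  rw [hull, Set.image_insert_eq, Set.image_pair]

lemma hull_le {P Q : Set S} (h : ∀ v ∈ P, (v : Plane) ∈ hull Q) : hull P ⊆ hull Q :=
  convexHull_min (by rintro _ ⟨v, hv, rfl⟩; exact h v hv) (convex_convexHull ..)

lemma convex_area_ge (σ c : ℝ) (a b : Plane) : Convex ℝ {x | c ≤ area σ a b x} := by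
  intro x hx y hy s t hs ht hst
  simp only [Set.mem_ofPred_eq] at *
  rw [area_combo _ _ _ _ _ hst]
  obtain rfl : t = 1 - s := by linarith
  nlinarith

lemma hull_area_ge {σ c : ℝ} {a b : Plane} {Q : Set S} (h : ∀ q ∈ Q, c ≤ area σ a b q)
    {x : Plane} (hx : x ∈ hull Q) : c ≤ area σ a b x :=
  convexHull_min (by rintro _ ⟨v, hv, rfl⟩; exact h v hv) (convex_area_ge σ c a b) hx

/-- If all points of `Q` but `u` lie strictly beyond a line, then `u` is the only point of the hull
which may lie on the line. -/
lemma hull_face {σ c : ℝ} {a b u : Plane} {Q : Set S} (hu : c ≤ area σ a b u)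
    (h : ∀ q ∈ Q, (q : Plane) ≠ u → c < area σ a b q) {x : Plane} (hx : x ∈ hull Q)
    (hc : area σ a b x ≤ c) : x = u := by
  -- An open half-plane stays convex when one point of its boundary line is added.
  have hconv : Convex ℝ {x : Plane | c < area σ a b x ∨ x = u} := by
    intro x hx y hy s t hs ht hst
    simp only [Set.mem_ofPred_eq] at *
    rw [area_combo _ _ _ _ _ hst]
    rcases hs.eq_or_lt with rfl | hs
    · obtain rfl : t = 1 := by linarith
      simpa using hy
    rcases ht.eq_or_lt with rfl | ht
    · obtain rfl : s = 1 := by linarith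
      simpa using hx
    rcases hx with hx | rfl
    · left
      have : c ≤ area σ a b y := by
        rcases hy with hy | rfl
        exacts [hy.le, hu]
      obtain rfl : t = 1 - s := by linarith
      nlinarith
    rcases hy with hy | rfl
    · left
      obtain rfl : t = 1 - s := by linarith
      nlinarith
    · right; rw [← add_smul, hst, one_smul]
  have := convexHull_min (s := (↑) '' Q) (t := {x : Plane | c < area σ a b x ∨ x = u})
    (by
      rintro _ ⟨v, hv, rfl⟩
      by_cases hvu : (v : Plane) = u
      exacts [Or.inr hvu, Or.inl (h v hv hvu)]) hconv hx
  rcases this with h | h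
  exacts [absurd hc (not_le.2 h), h]

lemma hull_area_gt {σ c : ℝ} {a b : Plane} {Q : Set S} (h : ∀ q ∈ Q, c < area σ a b q)
    {x : Plane} (hx : x ∈ hull Q) : c < area σ a b x := by
  have : Convex ℝ {x | c < area σ a b x} := by
    intro x hx y hy s t hs ht hst
    simp only [Set.mem_ofPred_eq] at *
    rw [area_combo _ _ _ _ _ hst]
    obtain rfl : t = 1 - s := by linarith
    rcases hs.eq_or_lt with rfl | hs
    · linarith
    · nlinarith
  exact convexHull_min (by rintro _ ⟨v, hv, rfl⟩; exact h v hv) this hx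

/-- Two hulls on different sides of a line meet at most in the only point of the first one which
may lie on the line. -/
lemma hull_inter_subset {σ c : ℝ} {a b : Plane} {u : S} {P Q : Set S} (hu : area σ a b u ≤ c)
    (hP : ∀ q ∈ P, q ≠ u → area σ a b q < c) (hQ : ∀ q ∈ Q, c ≤ area σ a b q) :
    hull P ∩ hull Q ⊆ {(u : Plane)} := by
  rintro x ⟨hxP, hxQ⟩
  refine hull_face (σ := -σ) (c := -c) (a := a) (b := b) (by rw [area_neg]; linarith) ?_ hxP ?_
  · intro q hq hne
    rw [area_neg]
    have := hP q hq (fun h => hne (by rw [h]))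
    linarith
  · rw [area_neg]
    have := hull_area_ge hQ hxQ
    linarith

lemma hull_disjoint {σ c : ℝ} {a b : Plane} {P Q : Set S}
    (hP : ∀ q ∈ P, area σ a b q < c) (hQ : ∀ q ∈ Q, c ≤ area σ a b q) {x : Plane}
    (hxP : x ∈ hull P) (hxQ : x ∈ hull Q) : False := by
  have h1 : -c < area (-σ) a b x :=
    hull_area_gt (fun q hq => by rw [area_neg]; have := hP q hq; linarith) hxP
  have h2 := hull_area_ge hQ hxQ
  rw [area_neg] at h1
  linarith

/-- A segment from `w` which leaves the join of `w` and a convex set has to meet the set. -/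
lemma segment_inter_join {w y : Plane} {K : Set Plane} (hK : Convex ℝ K) (hne : K.Nonempty)
    (hmiss : ∀ x ∈ segment ℝ w y, x ∉ K) (hy : y ∉ convexHull ℝ (insert w K)) :
    segment ℝ w y ∩ convexHull ℝ (insert w K) ⊆ {w} := by
  rintro t ⟨ht, htK⟩
  by_contra htw
  simp only [Set.mem_singleton_iff] at htw
  have hjoin := convexHull_insert (𝕜 := ℝ) (x := w) hne
  rw [hK.convexHull_eq] at hjoin
  rw [hjoin, convexJoin_singleton_left] at htK hy
  simp only [Set.mem_iUnion, exists_prop] at htK hy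
  obtain ⟨q, hq, htq⟩ := htK
  rw [segment_eq_image] at ht htq
  obtain ⟨s, ⟨hs0, hs1⟩, rfl⟩ := ht
  obtain ⟨l, ⟨hl0, hl1⟩, hl⟩ := htq
  have hs : 0 < s := by
    rcases hs0.eq_or_lt with rfl | h
    · simp at htw
    · exact h
  have hl' : 0 < l := by
    rcases hl0.eq_or_lt with rfl | h
    · exact absurd (by rw [← hl]; simp) htw
    · exact h
  have key : l • (q - w) = s • (y - w) := by
    have : (1 - l) • w + l • q - w = (1 - s) • w + s • y - w := by
      simpa using congrArg (· - w) hl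
    have e1 : (1 - l) • w + l • q - w = l • (q - w) := by module
    have e2 : (1 - s) • w + s • y - w = s • (y - w) := by module
    rwa [e1, e2] at this
  -- The common point shows that `y` and `q` lie on one ray from `w`. Either `q` comes first and
  -- lies on the segment, against `hmiss`, or `y` comes first and lies in the join, against `hy`.
  rcases le_total s l with hsl | hsl
  · refine hmiss q ?_ hq
    rw [segment_eq_image]
    refine ⟨s / l, ⟨by positivity, (div_le_one hl').2 hsl⟩, ?_⟩
    have : (1 - s / l) • w + (s / l) • y = w + (1 / l) • (s • (y - w)) := by
      rw [smul_smul]; module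
    simp only [this, ← key, smul_smul]
    rw [one_div_mul_cancel hl'.ne']; module
  · refine hy ⟨q, hq, ?_⟩
    rw [segment_eq_image]
    refine ⟨l / s, ⟨by positivity, (div_le_one hs).2 hsl⟩, ?_⟩
    have : (1 - l / s) • w + (l / s) • q = w + (1 / s) • (l • (q - w)) := by
      rw [smul_smul]; module
    simp only [this, key, smul_smul]
    rw [one_div_mul_cancel hs.ne']; module

lemma hull_insert (w : S) (Q : Set S) : hull (insert w Q) = convexHull ℝ (insert (w : Plane) (hull Q)) := by
  rw [hull, Set.image_insert_eq, hull]
  apply le_antisymm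
  · exact convexHull_mono (Set.insert_subset_insert (subset_convexHull _ _))
  · refine convexHull_min (Set.insert_subset ?_ ?_) (convex_convexHull ..)
    · exact subset_convexHull _ _ (Set.mem_insert ..)
    · exact convexHull_mono (Set.subset_insert ..)

/-- Controls an edge at `w` when no separating line through `w` is at hand: it suffices that the
edge misses the rest of the set and ends outside of the hull. -/
lemma segment_inter_hull {w y : S} {Q : Set S} (hne : Q.Nonempty)
    (hmiss : ∀ x ∈ hull {w, y}, x ∉ hull Q) (hy : (y : Plane) ∉ hull (insert w Q)) :
    hull {w, y} ∩ hull (insert w Q) ⊆ {(w : Plane)} := by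
  rw [hull_insert w Q] at hy ⊢
  rw [hull_pair] at *
  exact segment_inter_join (convex_convexHull ..) (hne.image _).convexHull hmiss hy

/-! ### General position and the angular order around a point. -/

section generalPosition

lemma area_ne_zero (hS : GeneralPosition S) {a b c : S} (hab : a ≠ b) (hac : a ≠ c) (hbc : b ≠ c)
    {σ : ℝ} (hσ : σ ≠ 0) : area σ a b c ≠ 0 := by
  have hcol := hS a a.2 b b.2 c c.2 (Subtype.coe_injective.ne hab) (Subtype.coe_injective.ne hac)
    (Subtype.coe_injective.ne hbc)
  intro h
  have h0 : ((b : Plane) 0 - (a : Plane) 0) * ((c : Plane) 1 - (a : Plane) 1) -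
      ((b : Plane) 1 - (a : Plane) 1) * ((c : Plane) 0 - (a : Plane) 0) = 0 := by
    simpa [area, hσ] using h
  apply hcol
  rw [collinear_iff_of_mem (p₀ := (a : Plane)) (by simp)]
  refine ⟨(b : Plane) - a, ?_⟩
  have hne : (b : Plane) 0 - (a : Plane) 0 ≠ 0 ∨ (b : Plane) 1 - (a : Plane) 1 ≠ 0 := by
    by_contra! hh
    apply hab
    apply Subtype.ext
    ext i
    fin_cases i
    · simpa using (sub_eq_zero.1 hh.1).symm
    · simpa using (sub_eq_zero.1 hh.2).symm
  intro p hp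
  simp only [Set.mem_insert_iff, Set.mem_singleton_iff] at hp
  rcases hp with rfl | rfl | rfl
  · exact ⟨0, by simp⟩
  · exact ⟨1, by simp⟩
  rcases hne with hne | hne
  · refine ⟨((c : Plane) 0 - (a : Plane) 0) / ((b : Plane) 0 - (a : Plane) 0), ?_⟩
    ext i
    fin_cases i
    · simp only [vadd_eq_add, PiLp.add_apply, PiLp.smul_apply, PiLp.sub_apply, smul_eq_mul,
        Fin.zero_eta]
      field_simp; ring
    · simp only [vadd_eq_add, PiLp.add_apply, PiLp.smul_apply, PiLp.sub_apply, smul_eq_mul,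
        Fin.mk_one]
      field_simp; linarith
  · refine ⟨((c : Plane) 1 - (a : Plane) 1) / ((b : Plane) 1 - (a : Plane) 1), ?_⟩
    ext i
    fin_cases i
    · simp only [vadd_eq_add, PiLp.add_apply, PiLp.smul_apply, PiLp.sub_apply, smul_eq_mul,
        Fin.zero_eta]
      field_simp; linarith
    · simp only [vadd_eq_add, PiLp.add_apply, PiLp.smul_apply, PiLp.sub_apply, smul_eq_mul,
        Fin.mk_one]
      field_simp; ring

lemma mem_hull_pair (hS : GeneralPosition S) {a b v : S} (h : (v : Plane) ∈ hull {a, b}) :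
    v = a ∨ v = b := by
  by_contra! hne
  rcases eq_or_ne a b with rfl | hab
  · rw [hull_pair, segment_same] at h
    exact hne.1 (Subtype.ext h)
  · have h1 : area 1 a b v ≠ 0 := area_ne_zero hS hab hne.1.symm hne.2.symm one_ne_zero
    have hz : ∀ q ∈ ({a, b} : Set S), area 1 a b q = 0 := by simp
    have h2 : 0 ≤ area 1 (a : Plane) b v := hull_area_ge (fun q hq => (hz q hq).ge) h
    have h3 : 0 ≤ area (-1) (a : Plane) b v :=
      hull_area_ge (fun q hq => by rw [area_neg, hz q hq]; simp) h
    rw [area_neg] at h3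
    exact h1 (by linarith)

lemma hull_pair_inter_pair (hS : GeneralPosition S) {a b c : S} (hab : a ≠ b) (hac : a ≠ c)
    (hbc : b ≠ c) : hull {a, b} ∩ hull {a, c} ⊆ {(a : Plane)} := by
  have h := area_scale _ _ _ (area_ne_zero hS hac hab hbc.symm one_ne_zero)
  rw [← neg_neg (area 1 _ _ _), area_neg] at h
  refine hull_inter_subset (σ := -area 1 a c b) (c := 0) (a := a) (b := c) (by simp) ?_ ?_
  · rintro q (rfl | rfl) hq
    · exact absurd rfl hq
    · linarith
  · rintro q (rfl | rfl) <;> simp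

/-- The first point of `Z` in the angular order around `w`. -/
lemma exists_first (hS : GeneralPosition S) {σ : ℝ} (hσ : σ ≠ 0) {w : S} {r : Plane}
    {Z : Finset S} (hZ : Z.Nonempty) (hr : ∀ z ∈ Z, 0 < area σ w r z) :
    ∃ a ∈ Z, ∀ z ∈ Z, z ≠ a → 0 < area σ w a z := by
  classical
  have hwZ : ∀ z ∈ Z, w ≠ z := by
    rintro z hz rfl
    simpa using hr _ hz
  induction hZ using Finset.Nonempty.cons_induction with
  | singleton a => exact ⟨a, by simp, by simp⟩
  | cons b s hb hs ih =>
    obtain ⟨a, ha, hmin⟩ := ih (fun z hz => hr z (by simp [hz])) (fun z hz => hwZ z (by simp [hz]))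
    have hab : a ≠ b := by rintro rfl; exact hb ha
    -- The new point `b` is compared with the first point `a` found so far. If `b` precedes `a`, it
    -- precedes all others by transitivity.
    rcases lt_or_gt_of_ne (area_ne_zero hS (hwZ a (by simp [ha])) (hwZ b (by simp)) hab hσ) with h | h
    · rw [area_swap_right, neg_lt_zero] at h
      refine ⟨b, by simp, fun z hz hzb => ?_⟩
      simp only [Finset.mem_cons] at hz
      rcases hz with rfl | hz
      · exact absurd rfl hzb
      rcases eq_or_ne z a with rfl | hza
      · exact h
      · exact area_trans (hr b (by simp)) (hr a (by simp [ha])) (hr z (by simp [hz])) h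
          (hmin z hz hza)
    · refine ⟨a, by simp [ha], fun z hz hza => ?_⟩
      simp only [Finset.mem_cons] at hz
      rcases hz with rfl | hz
      · exact h
      · exact hmin z hz hza

end generalPosition

/-! ### Caterpillars encoded by a spine and the neighbours of the leaves. -/

/-- `b` follows `a` immediately in the list. -/
def Consec {V : Type*} : List V → V → V → Prop
  | [], _, _ => False
  | [_], _, _ => False
  | x :: y :: t, a, b => (a = x ∧ b = y) ∨ Consec (y :: t) a b

section Consec
variable {V : Type*}

@[simp] lemma consec_nil (a b : V) : Consec [] a b ↔ False := Iff.rfl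
@[simp] lemma consec_singleton (x a b : V) : Consec [x] a b ↔ False := Iff.rfl
@[simp] lemma consec_cons_cons (x y : V) (t : List V) (a b : V) :
    Consec (x :: y :: t) a b ↔ (a = x ∧ b = y) ∨ Consec (y :: t) a b := Iff.rfl

lemma Consec.mem {l : List V} {a b : V} (h : Consec l a b) : a ∈ l ∧ b ∈ l := by
  induction l with
  | nil => exact h.elim
  | cons x t ih =>
    cases t with
    | nil => exact h.elim
    | cons y t =>
      rcases h with ⟨rfl, rfl⟩ | h
      · simp
      · exact ⟨List.mem_cons_of_mem _ (ih h).1, List.mem_cons_of_mem _ (ih h).2⟩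

lemma Consec.ne {l : List V} {a b : V} (hl : l.Nodup) (h : Consec l a b) : a ≠ b := by
  induction l with
  | nil => exact h.elim
  | cons x t ih =>
    cases t with
    | nil => exact h.elim
    | cons y t =>
      rcases h with ⟨rfl, rfl⟩ | h
      · rintro rfl; simp at hl
      · exact ih hl.of_cons h

lemma consec_append_cons (s t : List V) (x a b : V) :
    Consec (s ++ x :: t) a b ↔ Consec (s ++ [x]) a b ∨ Consec (x :: t) a b := by
  induction s with
  | nil => simp
  | cons y s ih =>
    cases s with
    | nil => simp
    | cons z s => simp only [List.cons_append, consec_cons_cons] at ih ⊢; rw [ih]; tauto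

lemma consec_reverse (l : List V) (a b : V) : Consec l.reverse a b ↔ Consec l b a := by
  induction l with
  | nil => simp
  | cons x t ih =>
    cases t with
    | nil => simp
    | cons y t =>
      rw [List.reverse_cons, List.reverse_cons, List.append_assoc, List.singleton_append,
        consec_append_cons, ← List.reverse_cons, ih]
      simp only [consec_cons_cons, consec_singleton, or_false]; tauto

lemma consec_iff_mem_zip (l : List V) (a b : V) : Consec l a b ↔ (a, b) ∈ l.zip l.tail := by
  induction l with
  | nil => simp
  | cons x t ih =>
    cases t with
    | nil => simp
    | cons y t => simp only [consec_cons_cons, ih]; simp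

lemma isChain_iff_consec {r : V → V → Prop} (l : List V) :
    l.IsChain r ↔ ∀ a b, Consec l a b → r a b := by
  induction l with
  | nil => simp
  | cons x t ih =>
    cases t with
    | nil => simp
    | cons y t =>
      rw [List.isChain_cons_cons, ih]
      simp only [consec_cons_cons]
      constructor
      · rintro ⟨h1, h2⟩ a b (⟨rfl, rfl⟩ | h)
        exacts [h1, h2 a b h]
      · intro h
        exact ⟨h _ _ (Or.inl ⟨rfl, rfl⟩), fun a b hab => h a b (Or.inr hab)⟩

lemma reachable_of_isChain {G : SimpleGraph V} {x : V} {t : List V} (h : (x :: t).IsChain G.Adj)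
    {b : V} (hb : b ∈ x :: t) : G.Reachable x b := by
  induction t generalizing x with
  | nil => simp only [List.mem_singleton] at hb; subst hb; rfl
  | cons y t ih =>
    rw [List.isChain_cons_cons] at h
    rcases List.mem_cons.1 hb with rfl | hb
    · rfl
    · exact h.1.reachable.trans (ih h.2 hb)

/-- The caterpillar with spine `l` in which each point `v` off the spine is a leaf attached
to `π v`. The ends of the spine may be leaves as well. -/
def catG (l : List V) (π : V → V) : SimpleGraph V :=
  SimpleGraph.fromRel fun u v => Consec l u v ∨ (u ∉ l ∧ v = π u)

lemma catG_adj {l : List V} {π : V → V} {u v : V} : (catG l π).Adj u v ↔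
    u ≠ v ∧ ((Consec l u v ∨ (u ∉ l ∧ v = π u)) ∨ (Consec l v u ∨ (v ∉ l ∧ u = π v))) :=
  SimpleGraph.fromRel_adj ..

lemma catG_reverse (l : List V) (π : V → V) : catG l.reverse π = catG l π := by
  ext u v
  simp only [catG_adj, consec_reverse, List.mem_reverse]
  tauto

/-- The values of `π` on the spine are irrelevant. Hence `π` may be defined uniformly on a set which
also contains spine vertices. -/
lemma catG_congr {l : List V} {π π' : V → V} (h : ∀ v, v ∉ l → π v = π' v) :
    catG l π = catG l π' := by
  ext u v
  simp only [catG_adj]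
  grind

/-- A leaf attached to the last vertex of the spine can be appended to the spine. -/
lemma catG_append {l : List V} {x y : V} {π : V → V} (hy : y ∉ l ++ [x]) (hπ : π y = x) :
    catG (l ++ [x, y]) π = catG (l ++ [x]) π := by
  ext u v
  have : ∀ u v, Consec (l ++ [x, y]) u v ↔ Consec (l ++ [x]) u v ∨ (u = x ∧ v = y) := by
    intro u v; rw [consec_append_cons]; simp
  simp only [catG_adj, this]
  simp only [List.mem_append, List.mem_cons, List.not_mem_nil, or_false] at hy ⊢
  grind

/-- The conditions under which `catG l π` is a caterpillar. -/
structure IsCode (l : List V) (π : V → V) : Prop where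
  ne_nil : l ≠ []
  nodup : l.Nodup
  mem : ∀ v, v ∉ l → π v ∈ l

lemma IsCode.reverse {l : List V} {π : V → V} (h : IsCode l π) : IsCode l.reverse π :=
  ⟨by simpa using h.ne_nil, List.nodup_reverse.2 h.nodup, by simpa using h.mem⟩

lemma IsCode.adj_of_consec {l : List V} {π : V → V} (h : IsCode l π) {u v : V}
    (huv : Consec l u v) : (catG l π).Adj u v :=
  catG_adj.2 ⟨huv.ne h.nodup, Or.inl (Or.inl huv)⟩

lemma IsCode.adj_leaf {l : List V} {π : V → V} (h : IsCode l π) {v : V} (hv : v ∉ l) :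
    (catG l π).Adj v (π v) :=
  catG_adj.2 ⟨fun e => hv (e ▸ h.mem v hv), Or.inl (Or.inr ⟨hv, rfl⟩)⟩

lemma IsCode.connected {l : List V} {π : V → V} (h : IsCode l π) : (catG l π).Connected := by
  obtain ⟨x, t, rfl⟩ := List.exists_cons_of_ne_nil h.ne_nil
  have hch : (x :: t).IsChain (catG (x :: t) π).Adj :=
    (isChain_iff_consec _).2 fun a b => h.adj_of_consec
  have hx : ∀ v, (catG (x :: t) π).Reachable x v := by
    intro v
    by_cases hv : v ∈ x :: t
    · exact reachable_of_isChain hch hv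
    · exact (reachable_of_isChain hch (h.mem v hv)).trans (h.adj_leaf hv).reachable.symm
  exact { preconnected := fun u v => (hx u).symm.trans (hx v), nonempty := ⟨x⟩ }

/-- A connected graph on n vertices with at most n - 1 edges is a tree. A spine with k vertices
gives at most k - 1 edges, the leaves at most n - k. -/
lemma IsCode.isTree [Finite V] {l : List V} {π : V → V} (h : IsCode l π) : (catG l π).IsTree := by
  classical
  have := Fintype.ofFinite V
  rw [SimpleGraph.isTree_iff_connected_and_card]
  refine ⟨h.connected, le_antisymm ?_ h.connected.card_vert_le_card_edgeSet_add_one⟩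
  have hsub : (catG l π).edgeSet ⊆ (((l.zip l.tail).map fun p => s(p.1, p.2)).toFinset ∪
      (Finset.univ \ l.toFinset).image fun v => s(v, π v) : Finset (Sym2 V)) := by
    intro e
    induction e using Sym2.ind with | _ u v => ?_
    rw [SimpleGraph.mem_edgeSet, catG_adj]
    simp only [consec_iff_mem_zip, Finset.coe_union, Set.mem_union, Finset.mem_coe,
      List.mem_toFinset, List.mem_map, Finset.mem_image, Finset.mem_sdiff, Finset.mem_univ,
      true_and]
    rintro ⟨-, (h | ⟨h, rfl⟩) | (h | ⟨h, rfl⟩)⟩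
    · exact Or.inl ⟨_, h, rfl⟩
    · exact Or.inr ⟨_, h, rfl⟩
    · exact Or.inl ⟨_, h, Sym2.eq_swap⟩
    · exact Or.inr ⟨_, h, Sym2.eq_swap⟩
  have h1 : Nat.card (catG l π).edgeSet ≤ (l.length - 1) + (Fintype.card V - l.length) := by
    refine (Nat.card_mono (Finset.finite_toSet _) hsub).trans ?_
    rw [Nat.card_coe_set_eq, Set.ncard_coe_finset]
    refine (Finset.card_union_le _ _).trans (add_le_add ?_ ?_)
    · refine (List.toFinset_card_le _).trans ?_
      simp
    · refine Finset.card_image_le.trans ?_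
      rw [Finset.card_sdiff_of_subset (Finset.subset_univ _), List.toFinset_card_of_nodup h.nodup,
        Finset.card_univ]
  have h2 : l.length ≤ Fintype.card V := h.nodup.length_le_card
  have h3 : 0 < l.length := List.length_pos_iff.2 h.ne_nil
  rw [Nat.card_eq_fintype_card (α := V)]
  omega

lemma IsCode.isLeaf {l : List V} {π : V → V} (h : IsCode l π) {v : V} (hv : v ∉ l) :
    IsLeaf (catG l π) v := by
  refine ⟨π v, h.adj_leaf hv, fun w hw => ?_⟩
  replace hw := catG_adj.1 hw
  rcases hw with ⟨hne, (hw | hw) | (hw | hw)⟩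
  · exact absurd hw.mem.1 hv
  · exact hw.2
  · exact absurd hw.mem.2 hv
  · exact absurd (hw.2 ▸ h.mem w hw.1) hv

lemma IsCode.not_isLeaf {l : List V} {π : V → V} (h : IsCode l π) {s t : List V} {x y z : V}
    (hl : l = s ++ x :: y :: z :: t) : ¬ IsLeaf (catG l π) y := by
  rintro ⟨w, -, hw⟩
  have hn := h.nodup
  have h1 : Consec l x y := by rw [hl, consec_append_cons]; simp
  have h2 : Consec l y z := by rw [hl, consec_append_cons]; simp
  have e1 := hw x (h.adj_of_consec h1).symm
  have e2 := hw z (h.adj_of_consec h2)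
  rw [hl, List.nodup_append] at hn
  have := hn.2.1
  simp_all

/-- Only the two ends of `l` can be leaves, so filtering out the leaves leaves a contiguous part of
the list, which is still a path. -/
lemma IsCode.isCaterpillar [Finite V] {l : List V} {π : V → V} (h : IsCode l π) :
    IsCaterpillar (catG l π) := by
  classical
  refine ⟨h.isTree, l.filter (fun v => ¬ IsLeaf (catG l π) v), h.nodup.filter _, fun v => ?_, ?_⟩
  · simp only [List.mem_filter, decide_eq_true_eq, and_iff_right_iff_imp]
    intro hv
    by_contra hvl
    exact hv (h.isLeaf hvl)
  · have hch : l.IsChain (catG l π).Adj := (isChain_iff_consec _).2 fun a b => h.adj_of_consec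
    obtain ⟨x, t, rfl⟩ := List.exists_cons_of_ne_nil h.ne_nil
    rcases List.eq_nil_or_concat t with rfl | ⟨m, y, rfl⟩
    · by_cases hx : IsLeaf (catG [x] π) x <;> simp [hx]
    · generalize hG : catG (x :: m.concat y) π = G at *
      have hm : ∀ v ∈ m, ¬ IsLeaf G v := by
        intro v hv
        obtain ⟨s, t, rfl⟩ := List.append_of_mem hv
        rw [← hG]
        rcases List.eq_nil_or_concat s with rfl | ⟨s, z, rfl⟩
        · cases t with
          | nil => exact h.not_isLeaf (s := []) (t := []) (x := x) (z := y) (by simp)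
          | cons z t => exact h.not_isLeaf (s := []) (t := t ++ [y]) (x := x) (z := z) (by simp)
        · cases t with
          | nil => exact h.not_isLeaf (s := x :: s) (t := []) (x := z) (z := y) (by simp)
          | cons a t => exact h.not_isLeaf (s := x :: s) (t := t ++ [y]) (x := z) (z := a) (by simp)
      have hfm : m.filter (fun v => ¬ IsLeaf G v) = m := by
        rw [List.filter_eq_self]; simpa using hm
      apply hch.infix
      rw [List.concat_eq_append, List.filter_cons, List.filter_append, hfm]
      by_cases hx : IsLeaf G x <;> by_cases hy : IsLeaf G y <;> simp [hx, hy]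
      · exact ⟨[x], [y], by simp⟩
      · exact ⟨[x], [], by simp⟩
      · exact ⟨[], [y], by simp⟩

end Consec

/-! ### The basic slides. -/

/-- The propositional core of `conn_insert`: `A` and `B` stand for consecutive pairs up to `w` and
from `x` on, and `L` for membership in the old spine. The lists are abstracted away, so only a
finite case analysis remains. -/
lemma insert_aux {V : Type*} {A B : V → V → Prop} {L : V → Prop} {π : V → V} {w x y : V}
    (u v : V) (hπ : π y = w) (hy : ¬ L y) (hw : L w) (hx : L x) (hwx : w ≠ x)
    (a1 : A u v → u ≠ x ∧ v ≠ x ∧ u ≠ y ∧ v ≠ y) (a2 : A v u → v ≠ x ∧ u ≠ x ∧ v ≠ y ∧ u ≠ y)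
    (a3 : B u v → u ≠ w ∧ v ≠ w ∧ u ≠ y ∧ v ≠ y) (a4 : B v u → v ≠ w ∧ u ≠ w ∧ v ≠ y ∧ u ≠ y)
    (a5 : ¬ L u → L (π u)) (a6 : ¬ L v → L (π v)) :
    (u ≠ v ∧ (((A u v ∨ (u = w ∧ v = y) ∨ (u = y ∧ v = x) ∨ B u v) ∨
      (¬ (u = y ∨ L u) ∧ v = π u)) ∨ ((A v u ∨ (v = w ∧ u = y) ∨ (v = y ∧ u = x) ∨ B v u) ∨
      (¬ (v = y ∨ L v) ∧ u = π v)))) ↔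
    ((u ≠ v ∧ (((A u v ∨ (u = w ∧ v = x) ∨ B u v) ∨ (¬ L u ∧ v = π u)) ∨
      ((A v u ∨ (v = w ∧ u = x) ∨ B v u) ∨ (¬ L v ∧ u = π v)))) ∧
      ¬ (u = x ∧ v = w ∨ u = w ∧ v = x)) ∨ (u = x ∧ v = y ∨ u = y ∧ v = x) := by
  have e1 : w ≠ y := by rintro rfl; exact hy hw
  have e2 : x ≠ y := by rintro rfl; exact hy hx
  by_cases u1 : u = y
  · subst u1
    by_cases v1 : v = w <;> by_cases v2 : v = x <;> grind
  by_cases v1 : v = y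
  · subst v1
    by_cases v1 : u = w <;> by_cases v2 : u = x <;> grind
  by_cases u2 : u = x
  · subst u2; grind
  by_cases v2 : v = x
  · subst v2; grind
  grind

lemma remove_aux {V : Type*} {A B : V → V → Prop} {L : V → Prop} {π : V → V} {w x y : V}
    (u v : V) (hπ : π y = w) (hy : ¬ L y) (hw : L w) (hx : L x) (hwx : w ≠ x)
    (a1 : A u v → u ≠ x ∧ v ≠ x ∧ u ≠ y ∧ v ≠ y) (a2 : A v u → v ≠ x ∧ u ≠ x ∧ v ≠ y ∧ u ≠ y)
    (a3 : B u v → u ≠ w ∧ v ≠ w ∧ u ≠ y ∧ v ≠ y) (a4 : B v u → v ≠ w ∧ u ≠ w ∧ v ≠ y ∧ u ≠ y)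
    (a5 : ¬ L u → L (π u)) (a6 : ¬ L v → L (π v)) :
    (u ≠ v ∧ (((A u v ∨ (u = w ∧ v = x) ∨ B u v) ∨ (¬ L u ∧ v = π u)) ∨
      ((A v u ∨ (v = w ∧ u = x) ∨ B v u) ∨ (¬ L v ∧ u = π v)))) ↔
    (u ≠ v ∧ (((A u v ∨ (u = w ∧ v = y) ∨ (u = y ∧ v = x) ∨ B u v) ∨
      (¬ (u = y ∨ L u) ∧ v = π u)) ∨ ((A v u ∨ (v = w ∧ u = y) ∨ (v = y ∧ u = x) ∨ B v u) ∨
      (¬ (v = y ∨ L v) ∧ u = π v)))) ∧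
      ¬ (u = x ∧ v = y ∨ u = y ∧ v = x) ∨ (u = x ∧ v = w ∨ u = w ∧ v = x) := by
  have e1 : w ≠ y := by rintro rfl; exact hy hw
  have e2 : x ≠ y := by rintro rfl; exact hy hx
  by_cases u1 : u = y
  · subst u1
    by_cases v1 : v = w <;> by_cases v2 : v = x <;> grind
  by_cases v1 : v = y
  · subst v1
    by_cases v1 : u = w <;> by_cases v2 : u = x <;> grind
  by_cases u2 : u = x
  · subst u2; grind
  by_cases v2 : v = x
  · subst v2; grind
  grind

lemma swap_aux {V : Type*} {A : V → V → Prop} {L : V → Prop} {π : V → V} {y x a : V}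
    (u v : V) (hy : L y) (hx : L x) (hyx : y ≠ x) (hxa : x ≠ a) (hya : y ≠ a)
    (a1 : A u v → u ≠ x ∧ v ≠ x ∧ u ≠ a ∧ v ≠ a) (a2 : A v u → v ≠ x ∧ u ≠ x ∧ v ≠ a ∧ u ≠ a) :
    (u ≠ v ∧ (((A u v ∨ (u = y ∧ v = a) ∨ (u = a ∧ v = x)) ∨ (¬ L u ∧ v = π u)) ∨
      ((A v u ∨ (v = y ∧ u = a) ∨ (v = a ∧ u = x)) ∨ (¬ L v ∧ u = π v)))) ↔
    (u ≠ v ∧ (((A u v ∨ (u = y ∧ v = x) ∨ (u = x ∧ v = a)) ∨ (¬ L u ∧ v = π u)) ∨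
      ((A v u ∨ (v = y ∧ u = x) ∨ (v = x ∧ u = a)) ∨ (¬ L v ∧ u = π v)))) ∧
      ¬ (u = y ∧ v = x ∨ u = x ∧ v = y) ∨ (u = y ∧ v = a ∨ u = a ∧ v = y) := by
  by_cases u1 : u = x
  · subst u1; grind
  by_cases v1 : v = x
  · subst v1; grind
  grind

section
variable {V : Type*} {pre post : List V} {w x y a : V} {u v : V}

lemma consec_left_aux (hnd : (pre ++ w :: x :: post).Nodup) (hy : y ∉ pre ++ w :: x :: post)
    (h : Consec (pre ++ [w]) u v) : u ≠ x ∧ v ≠ x ∧ u ≠ y ∧ v ≠ y := by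
  have h1 := h.mem
  rw [List.nodup_append] at hnd
  simp at h1 hnd hy
  grind

lemma consec_right_aux (hnd : (pre ++ w :: x :: post).Nodup) (hy : y ∉ pre ++ w :: x :: post)
    (h : Consec (x :: post) u v) : u ≠ w ∧ v ≠ w ∧ u ≠ y ∧ v ≠ y := by
  have h1 := h.mem
  rw [List.nodup_append] at hnd
  simp at h1 hnd hy
  grind

lemma consec_swap_aux (hnd : (pre ++ [y, x, a]).Nodup)
    (h : Consec (pre ++ [y]) u v) : u ≠ x ∧ v ≠ x ∧ u ≠ a ∧ v ≠ a := by
  have h1 := h.mem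
  rw [List.nodup_append] at hnd
  simp at h1 hnd
  grind

end

lemma plane_iff (G : SimpleGraph S) : IsPlaneGraph G ↔ ∀ a b c d : S, G.Adj a b → G.Adj c d →
    s(a, b) ≠ s(c, d) → ∀ x ∈ hull {a, b}, x ∈ hull {c, d} →
      (x = a ∨ x = b) ∧ (x = c ∨ x = d) := by
  simp only [hull_pair]
  exact forall₄_congr fun a b c d => forall₃_congr fun _ _ _ =>
    ⟨fun h x h1 h2 => by simpa using h ⟨h1, h2⟩, fun h x hx => by simpa using h x hx.1 hx.2⟩

/-- `G` and `H` are plane spanning caterpillars which are connected by slides. -/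
def Conn (G H : SimpleGraph S) : Prop :=
  ∃ (hG : IsPlaneGraph G ∧ IsCaterpillar G) (hH : IsPlaneGraph H ∧ IsCaterpillar H),
    (slideGraph S).Reachable ⟨G, hG⟩ ⟨H, hH⟩

lemma Conn.refl {G : SimpleGraph S} (h1 : IsPlaneGraph G) (h2 : IsCaterpillar G) : Conn G G :=
  ⟨⟨h1, h2⟩, ⟨h1, h2⟩, SimpleGraph.Reachable.refl _⟩

lemma Conn.symm {G H : SimpleGraph S} : Conn G H → Conn H G :=
  fun ⟨hG, hH, h⟩ => ⟨hH, hG, h.symm⟩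

lemma Conn.trans {G H K : SimpleGraph S} : Conn G H → Conn H K → Conn G K :=
  fun ⟨hG, _, h⟩ ⟨_, hK, h'⟩ => ⟨hG, hK, h.trans h'⟩

lemma Conn.plane_left {G H : SimpleGraph S} (h : Conn G H) : IsPlaneGraph G := h.1.1
lemma Conn.plane_right {G H : SimpleGraph S} (h : Conn G H) : IsPlaneGraph H := h.2.1.1

/-- The convex hull of `Q` contains no further points. -/
def Full (Q : Set S) : Prop := ∀ v : S, (v : Plane) ∈ hull Q → v ∈ Q

/-- The edges of `G` which do not join two points of `Q` meet the hull of `Q` only in `O`. -/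
def Clean (G : SimpleGraph S) (Q O : Set S) : Prop :=
  ∀ u v, G.Adj u v → ¬ (u ∈ Q ∧ v ∈ Q) → ∀ x ∈ hull {u, v}, x ∈ hull Q → ∃ o ∈ O, x = (o : Plane)

/-- The new edge `ac` lies in the triangle. Of the old edges that remain, only `bc` joins two of its
vertices, and it meets `ac` only in `c` by general position. Any other edge meets the triangle only
in its vertices, and a point of `S` on an edge is an end of it. -/
lemma conn_of_slide (hS : GeneralPosition S) {G H : SimpleGraph S} (hG : IsPlaneGraph G)
    (hGc : IsCaterpillar G) (hHc : IsCaterpillar H) {a b c : S} (hab : G.Adj a b)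
    (hbc : G.Adj b c) (hac : a ≠ c)
    (hH : ∀ u v, H.Adj u v ↔ (G.Adj u v ∧ s(u, v) ≠ s(a, b)) ∨ s(u, v) = s(a, c))
    {T : Set S} (hT : ∀ v, v ∈ T ↔ v = a ∨ v = b ∨ v = c) (hfull : Full T) (hcl : Clean G T T) :
    Conn G H := by
  have hTe : T = {a, b, c} := by ext v; simp [hT]
  have key : ∀ d e, G.Adj d e → s(d, e) ≠ s(a, b) → s(d, e) ≠ s(a, c) → ∀ x ∈ hull {a, c},
      x ∈ hull {d, e} → (x = a ∨ x = c) ∧ (x = d ∨ x = e) := by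
    intro d e hde h1 h2 x hx hx'
    by_cases hin : d ∈ T ∧ e ∈ T
    · have hne := hde.ne
      have hbc' : s(d, e) = s(b, c) := by
        rw [hT, hT] at hin
        rcases hin with ⟨rfl | rfl | rfl, rfl | rfl | rfl⟩ <;> simp_all [Sym2.eq_swap]
      have hpair : ({d, e} : Set S) = {c, b} := by
        rcases Sym2.eq_iff.1 hbc' with ⟨rfl, rfl⟩ | ⟨rfl, rfl⟩
        · exact Set.pair_comm ..
        · rfl
      rw [hpair] at hx'
      rw [Set.pair_comm] at hx
      have hxc := hull_pair_inter_pair hS hac.symm hbc.ne.symm hab.ne ⟨hx, hx'⟩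
      simp only [Set.mem_singleton_iff] at hxc
      subst hxc
      refine ⟨Or.inr rfl, ?_⟩
      rcases Sym2.eq_iff.1 hbc' with ⟨rfl, rfl⟩ | ⟨rfl, rfl⟩ <;> simp
    · obtain ⟨o, ho, rfl⟩ := hcl d e hde hin x hx' (hull_mono (by rw [hTe]; grind) hx)
      have ho1 := mem_hull_pair hS hx
      have ho2 := mem_hull_pair hS hx'
      constructor
      · rcases ho1 with rfl | rfl <;> simp
      · rcases ho2 with rfl | rfl <;> simp
  have hpl : IsPlaneGraph H := by
    rw [plane_iff] at hG ⊢
    intro u v u' v' huv huv' hne x hx hx'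
    rw [hH] at huv huv'
    rcases huv with ⟨h1, h2⟩ | h1
    · rcases huv' with ⟨h3, h4⟩ | h3
      · exact hG u v u' v' h1 h3 hne x hx hx'
      · have hp : ({u', v'} : Set S) = {a, c} := by
          rcases Sym2.eq_iff.1 h3 with ⟨rfl, rfl⟩ | ⟨rfl, rfl⟩
          exacts [rfl, Set.pair_comm ..]
        rw [hp] at hx'
        have := key u v h1 h2 (h3 ▸ hne) x hx' hx
        refine ⟨this.2, ?_⟩
        rcases Sym2.eq_iff.1 h3 with ⟨rfl, rfl⟩ | ⟨rfl, rfl⟩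
        exacts [this.1, this.1.symm]
    · have hp : ({u, v} : Set S) = {a, c} := by
        rcases Sym2.eq_iff.1 h1 with ⟨rfl, rfl⟩ | ⟨rfl, rfl⟩
        exacts [rfl, Set.pair_comm ..]
      rw [hp] at hx
      rcases huv' with ⟨h3, h4⟩ | h3
      · have := key u' v' h3 h4 (by rw [← h1]; exact hne.symm) x hx hx'
        refine ⟨?_, this.2⟩
        rcases Sym2.eq_iff.1 h1 with ⟨rfl, rfl⟩ | ⟨rfl, rfl⟩
        exacts [this.1, this.1.symm]
      · exact absurd (h1.trans h3.symm) hne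
  refine ⟨⟨hG, hGc⟩, ⟨hpl, hHc⟩, ?_⟩
  -- `SimpleGraph.fromRel` has no loops, so equal graphs are treated apart.
  by_cases hGH : G = H
  · subst hGH; rfl
  apply SimpleGraph.Adj.reachable
  rw [slideGraph, SimpleGraph.fromRel_adj]
  refine ⟨fun h => hGH (congrArg Subtype.val h), Or.inl ⟨a, b, c, hab, ?_, hbc, ?_, ?_⟩⟩
  · ext e
    induction e using Sym2.ind with | _ u v => ?_
    simp only [SimpleGraph.mem_edgeSet, Set.mem_union, Set.mem_sdiff, Set.mem_singleton_iff]
    exact hH u v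
  · refine (hH b c).2 (Or.inl ⟨hbc, fun h => ?_⟩)
    rcases Sym2.eq_iff.1 h with ⟨h1, h2⟩ | ⟨h1, h2⟩
    exacts [hab.ne h1.symm, hac h2.symm]
  · rintro x ⟨hx, hxS⟩
    rw [← hull_triple, ← hTe] at hx
    have := hfull ⟨x, hxS⟩ hx
    rw [hT] at this
    rcases this with h | h | h <;> simp [← h]

/-- A leaf `y` at `w` is inserted into the spine edge `wx`, if the triangle `wxy` is empty. -/
lemma conn_insert (hS : GeneralPosition S) {pre post : List S} {w x y : S} {π : S → S}
    (hc : IsCode (pre ++ w :: x :: post) π) (hy : y ∉ pre ++ w :: x :: post) (hπ : π y = w)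
    (hG : IsPlaneGraph (catG (pre ++ w :: x :: post) π))
    (hfull : Full ({w, x, y} : Set S)) (hcl : Clean (catG (pre ++ w :: x :: post) π) {w, x, y} {w, x, y}) :
    Conn (catG (pre ++ w :: x :: post) π) (catG (pre ++ w :: y :: x :: post) π) := by
  have hnd := hc.nodup
  have hc' : IsCode (pre ++ w :: y :: x :: post) π := by
    refine ⟨by simp, ?_, fun v hv => ?_⟩
    · have hp : (pre ++ w :: y :: x :: post).Perm (y :: (pre ++ w :: x :: post)) := by
        have := (List.perm_middle (a := y) (l₁ := pre ++ [w]) (l₂ := x :: post))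
        simpa using this
      rw [hp.nodup_iff, List.nodup_cons]; exact ⟨hy, hnd⟩
    · have := hc.mem v (by simp at hv ⊢; tauto)
      simp at this ⊢; tauto
  have e1 : ∀ u v, Consec (pre ++ w :: x :: post) u v ↔
      Consec (pre ++ [w]) u v ∨ (u = w ∧ v = x) ∨ Consec (x :: post) u v := by
    intro u v; rw [consec_append_cons, consec_cons_cons]
  have e2 : ∀ u v, Consec (pre ++ w :: y :: x :: post) u v ↔ Consec (pre ++ [w]) u v ∨
      (u = w ∧ v = y) ∨ (u = y ∧ v = x) ∨ Consec (x :: post) u v := by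
    intro u v; rw [consec_append_cons, consec_cons_cons, consec_cons_cons]
  have hwx : (catG (pre ++ w :: x :: post) π).Adj x w :=
    (hc.adj_of_consec ((e1 w x).2 (by simp))).symm
  have hwy : (catG (pre ++ w :: x :: post) π).Adj w y := by
    have := hc.adj_leaf hy
    rw [hπ] at this; exact this.symm
  -- The spine edge `xw` slides along the leaf edge `wy` and becomes `xy`.
  refine conn_of_slide hS hG hc.isCaterpillar hc'.isCaterpillar (a := x) (b := w) (c := y)
    (T := {w, x, y}) hwx hwy (by rintro rfl; simp at hy) ?_ (by intro v; simp; tauto) hfull hcl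
  intro u v
  have m1 : ∀ u v, Consec (pre ++ [w]) u v → u ≠ x ∧ v ≠ x ∧ u ≠ y ∧ v ≠ y := fun u v h =>
    consec_left_aux hnd hy h
  have m2 : ∀ u v, Consec (x :: post) u v → u ≠ w ∧ v ≠ w ∧ u ≠ y ∧ v ≠ y := fun u v h =>
    consec_right_aux hnd hy h
  have hw : w ≠ x ∧ w ≠ y ∧ x ≠ y := ⟨hwx.ne.symm, hwy.ne, by rintro rfl; simp at hy⟩
  have hm : ∀ v, v ∈ pre ++ w :: y :: x :: post ↔ v = y ∨ v ∈ pre ++ w :: x :: post := by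
    intro v; simp; tauto
  have hwl : w ∈ pre ++ w :: x :: post := by simp
  have hxl : x ∈ pre ++ w :: x :: post := by simp
  have hml := hc.mem
  simp only [catG_adj, e1, e2, hm, ne_eq, Sym2.eq_iff]
  exact insert_aux (L := (· ∈ pre ++ w :: x :: post)) u v hπ hy hwl hxl hw.1 (m1 u v) (m1 v u) (m2 u v)
    (m2 v u) (hml u) (hml v)

/-- The inverse of `conn_insert`. -/
lemma conn_remove (hS : GeneralPosition S) {pre post : List S} {w x y : S} {π : S → S}
    (hc : IsCode (pre ++ w :: y :: x :: post) π) (hπ : π y = w)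
    (hout : ∀ v, v ∉ pre ++ w :: y :: x :: post → π v ≠ y)
    (hG : IsPlaneGraph (catG (pre ++ w :: y :: x :: post) π))
    (hfull : Full ({w, x, y} : Set S))
    (hcl : Clean (catG (pre ++ w :: y :: x :: post) π) {w, x, y} {w, x, y}) :
    Conn (catG (pre ++ w :: y :: x :: post) π) (catG (pre ++ w :: x :: post) π) := by
  have hnd := hc.nodup
  have hp : (pre ++ w :: y :: x :: post).Perm (y :: (pre ++ w :: x :: post)) := by
    have := (List.perm_middle (a := y) (l₁ := pre ++ [w]) (l₂ := x :: post))
    simpa using this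
  rw [hp.nodup_iff, List.nodup_cons] at hnd
  obtain ⟨hy, hnd⟩ := hnd
  have hm : ∀ v, v ∈ pre ++ w :: y :: x :: post ↔ v = y ∨ v ∈ pre ++ w :: x :: post := by
    intro v; simp; tauto
  have hwl : w ∈ pre ++ w :: x :: post := by simp
  have hxl : x ∈ pre ++ w :: x :: post := by simp
  have hc' : IsCode (pre ++ w :: x :: post) π := by
    refine ⟨by simp, hnd, fun v hv => ?_⟩
    by_cases hvy : v = y
    · rw [hvy, hπ]; exact hwl
    · have hv' : v ∉ pre ++ w :: y :: x :: post := by rw [hm]; tauto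
      exact ((hm _).1 (hc.mem v hv')).resolve_left (hout v hv')
  have e1 : ∀ u v, Consec (pre ++ w :: x :: post) u v ↔
      Consec (pre ++ [w]) u v ∨ (u = w ∧ v = x) ∨ Consec (x :: post) u v := by
    intro u v; rw [consec_append_cons, consec_cons_cons]
  have e2 : ∀ u v, Consec (pre ++ w :: y :: x :: post) u v ↔ Consec (pre ++ [w]) u v ∨
      (u = w ∧ v = y) ∨ (u = y ∧ v = x) ∨ Consec (x :: post) u v := by
    intro u v; rw [consec_append_cons, consec_cons_cons, consec_cons_cons]
  have hyx : (catG (pre ++ w :: y :: x :: post) π).Adj x y :=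
    (hc.adj_of_consec ((e2 y x).2 (by simp))).symm
  have hwy : (catG (pre ++ w :: y :: x :: post) π).Adj y w :=
    (hc.adj_of_consec ((e2 w y).2 (by simp))).symm
  have hw : w ≠ x ∧ w ≠ y ∧ x ≠ y := by
    refine ⟨?_, hwy.ne.symm, hyx.ne⟩
    rintro rfl
    rw [List.nodup_append] at hnd
    simp at hnd
  -- The edge `xy` slides along `yw` and becomes `xw`. By `hout` no leaf hangs on `y`, so `y` itself
  -- becomes a leaf.
  refine conn_of_slide hS hG hc.isCaterpillar hc'.isCaterpillar (a := x) (b := y) (c := w)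
    (T := {w, x, y}) hyx hwy hw.1.symm ?_ (by intro v; simp; tauto) hfull hcl
  intro u v
  have m1 : ∀ u v, Consec (pre ++ [w]) u v → u ≠ x ∧ v ≠ x ∧ u ≠ y ∧ v ≠ y := fun u v h =>
    consec_left_aux hnd hy h
  have m2 : ∀ u v, Consec (x :: post) u v → u ≠ w ∧ v ≠ w ∧ u ≠ y ∧ v ≠ y := fun u v h =>
    consec_right_aux hnd hy h
  have hml := hc'.mem
  simp only [catG_adj, e1, e2, hm, ne_eq, Sym2.eq_iff]
  exact remove_aux (L := (· ∈ pre ++ w :: x :: post)) u v hπ hy hwl hxl hw.1 (m1 u v) (m1 v u) (m2 u v)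
    (m2 v u) (hml u) (hml v)

/-- The last two vertices of the spine are exchanged, if they form an empty triangle with their
predecessor. -/
lemma conn_swap (hS : GeneralPosition S) {pre : List S} {y x a : S} {π : S → S}
    (hc : IsCode (pre ++ [y, x, a]) π)
    (hG : IsPlaneGraph (catG (pre ++ [y, x, a]) π)) (hfull : Full ({y, x, a} : Set S))
    (hcl : Clean (catG (pre ++ [y, x, a]) π) {y, x, a} {y, x, a}) :
    Conn (catG (pre ++ [y, x, a]) π) (catG (pre ++ [y, a, x]) π) := by
  have hnd := hc.nodup
  have hm : ∀ v, v ∈ pre ++ [y, a, x] ↔ v ∈ pre ++ [y, x, a] := by intro v; simp; tauto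
  have hc' : IsCode (pre ++ [y, a, x]) π := by
    refine ⟨by simp, ?_, fun v hv => (hm _).2 (hc.mem v (fun h => hv ((hm v).2 h)))⟩
    exact ((((List.Perm.swap a x []).cons y).append_left pre).nodup_iff).1 hnd
  have e1 : ∀ x a u v, Consec (pre ++ [y, x, a]) u v ↔
      Consec (pre ++ [y]) u v ∨ (u = y ∧ v = x) ∨ (u = x ∧ v = a) := by
    intro x a u v; rw [consec_append_cons]; simp
  have hyx : (catG (pre ++ [y, x, a]) π).Adj y x := hc.adj_of_consec (by simp [e1])
  have hxa : (catG (pre ++ [y, x, a]) π).Adj x a := hc.adj_of_consec (by simp [e1])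
  have hya : y ≠ a := by
    rw [List.nodup_append] at hnd
    simp at hnd
    tauto
  -- The edge `yx` slides along `xa` and becomes `ya`. Both `x` and `a` stay on the spine, so their
  -- leaves need not move.
  refine conn_of_slide hS hG hc.isCaterpillar hc'.isCaterpillar (a := y) (b := x) (c := a)
    (T := {y, x, a}) hyx hxa hya ?_ (by intro v; simp) hfull hcl
  intro u v
  have m1 : ∀ u v, Consec (pre ++ [y]) u v → u ≠ x ∧ v ≠ x ∧ u ≠ a ∧ v ≠ a := fun u v h =>
    consec_swap_aux hnd h
  have hml := hc.mem
  have hy : y ∈ pre ++ [y, x, a] := by simp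
  have hx : x ∈ pre ++ [y, x, a] := by simp
  have ha : a ∈ pre ++ [y, x, a] := by simp
  have hne := hyx.ne
  have hne' := hxa.ne
  simp only [catG_adj, e1, hm, ne_eq, Sym2.eq_iff]
  exact swap_aux (L := (· ∈ pre ++ [y, x, a])) u v hy hx hne hne' hya (m1 u v) (m1 v u)

/-! ### Local parts of a caterpillar. -/

section
variable {V : Type*}

/-- The edges of a caterpillar with spine `pre ++ w :: (mid ++ tail)` which do not join two points
of `Q`, when `mid` and the first vertex of `tail` belong to `Q`. -/
def OuterEdge (Q : Set V) (pre : List V) (w : V) (tail : List V) (π : V → V) (u v : V) : Prop :=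
  Consec (pre ++ [w]) u v ∨ Consec tail u v ∨ (u ∉ Q ∧ u ∉ pre ∧ u ∉ tail ∧ v = π u)

/-- The edges of a caterpillar with spine `pre ++ w :: (mid ++ tail)` which join two points
of `Q`. -/
def InnerEdge (Q : Set V) (w : V) (mid tail : List V) (π : V → V) (u v : V) : Prop :=
  Consec (w :: (mid ++ tail.take 1)) u v ∨ (u ∈ Q ∧ u ∉ w :: (mid ++ tail.take 1) ∧ v = π u)

/-- The part inside `Q` of a caterpillar with spine `pre ++ w :: (mid ++ tail)` is a caterpillar. -/
structure LocalSpine (Q : Set V) (w : V) (mid tail : List V) (π : V → V) : Prop where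
  mid_mem : ∀ v ∈ mid, v ∈ Q
  nodup : (w :: (mid ++ tail.take 1)).Nodup
  mem : ∀ v ∈ Q, v ∉ w :: (mid ++ tail.take 1) → π v ∈ w :: (mid ++ tail.take 1)

lemma consec_spine {pre mid tail : List V} {w u v : V} :
    Consec (pre ++ w :: (mid ++ tail)) u v ↔ Consec (pre ++ [w]) u v ∨
      Consec (w :: (mid ++ tail.take 1)) u v ∨ Consec tail u v := by
  rw [consec_append_cons]
  cases tail with
  | nil => simp
  | cons p t =>
    rw [← List.cons_append, consec_append_cons (w :: mid)]
    simp

lemma edge_cases {Q : Set V} {pre mid tail : List V} {w : V} {π : V → V} {u v : V}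
    (h : (catG (pre ++ w :: (mid ++ tail)) π).Adj u v) :
    (OuterEdge Q pre w tail π u v ∨ OuterEdge Q pre w tail π v u) ∨
      (InnerEdge Q w mid tail π u v ∨ InnerEdge Q w mid tail π v u) := by
  have key : ∀ u v, (Consec (pre ++ w :: (mid ++ tail)) u v ∨
      (u ∉ pre ++ w :: (mid ++ tail) ∧ v = π u)) → OuterEdge Q pre w tail π u v ∨
        InnerEdge Q w mid tail π u v := by
    rintro u v (h | ⟨h, rfl⟩)
    · rw [consec_spine] at h
      rcases h with h | h | h
      exacts [Or.inl (Or.inl h), Or.inr (Or.inl h), Or.inl (Or.inr (Or.inl h))]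
    · simp only [List.mem_append, List.mem_cons, not_or] at h
      by_cases hu : u ∈ Q
      · refine Or.inr (Or.inr ⟨hu, ?_, rfl⟩)
        simp only [List.mem_cons, List.mem_append, not_or]
        exact ⟨h.2.1, h.2.2.1, fun h' => h.2.2.2 (List.mem_of_mem_take h')⟩
      · exact Or.inl (Or.inr (Or.inr ⟨hu, h.1, h.2.2.2, rfl⟩))
  rcases (catG_adj.1 h).2 with h | h
  · rcases key _ _ h with h | h <;> simp [h]
  · rcases key _ _ h with h | h <;> simp [h]

lemma nodup_spine {pre mid tail : List V} {w : V} (h : (pre ++ w :: tail).Nodup)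
    (hm : (w :: (mid ++ tail.take 1)).Nodup) (h1 : ∀ v ∈ mid, v ∉ pre)
    (h2 : ∀ v ∈ mid, v ∉ tail.drop 1) : (pre ++ w :: (mid ++ tail)).Nodup := by
  have ht : ∀ v, v ∈ tail ↔ v ∈ tail.take 1 ∨ v ∈ tail.drop 1 := fun v => by
    rw [← List.mem_append, List.take_append_drop]
  simp only [List.nodup_append, List.nodup_cons, List.mem_cons, List.mem_append, ht] at *
  grind

end

/-- A local part `Q` of a plane caterpillar with spine `pre ++ w :: (mid ++ tail)`, where `mid` is
variable: the edges outside of `Q` do not cross each other and meet the hull of `Q` only in the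
points of `O`. -/
structure Ctx (O Q : Set S) (pre : List S) (w : S) (tail : List S) (π : S → S) : Prop where
  nodup : (pre ++ w :: tail).Nodup
  mem : w ∈ Q
  head : ∀ v ∈ tail.take 1, v ∈ Q
  disj_pre : ∀ v ∈ Q, v ∉ pre
  disj_tail : ∀ v ∈ Q, v ∉ tail.drop 1
  out : ∀ v, v ∉ Q → v ∉ pre → v ∉ tail → π v ∈ pre ++ w :: tail
  full : Full Q
  clean : ∀ u v, OuterEdge Q pre w tail π u v → ∀ x ∈ hull {u, v}, x ∈ hull Q →
    ∃ o ∈ O, x = (o : Plane)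
  plane : ∀ a b c d : S, OuterEdge Q pre w tail π a b → OuterEdge Q pre w tail π c d →
    s(a, b) ≠ s(c, d) → ∀ x ∈ hull {a, b}, x ∈ hull {c, d} → (x = a ∨ x = b) ∧ (x = c ∨ x = d)

namespace Ctx
variable {O Q : Set S} {pre : List S} {w : S} {tail : List S} {π π' : S → S} {mid : List S}

lemma congr (h : Ctx O Q pre w tail π) (hπ : ∀ v, v ∉ Q → v ∉ pre → v ∉ tail → π' v = π v) :
    Ctx O Q pre w tail π' := by
  have e : ∀ u v, OuterEdge Q pre w tail π' u v → OuterEdge Q pre w tail π u v := by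
    rintro u v (h | h | ⟨h1, h2, h3, rfl⟩)
    exacts [Or.inl h, Or.inr (Or.inl h), Or.inr (Or.inr ⟨h1, h2, h3, hπ u h1 h2 h3⟩)]
  exact { h with
    out := fun v h1 h2 h3 => hπ v h1 h2 h3 ▸ h.out v h1 h2 h3
    clean := fun u v huv => h.clean u v (e u v huv)
    plane := fun a b c d h1 h2 => h.plane a b c d (e _ _ h1) (e _ _ h2) }

lemma isCode (h : Ctx O Q pre w tail π) (hi : LocalSpine Q w mid tail π) :
    IsCode (pre ++ w :: (mid ++ tail)) π := by
  refine ⟨by simp, nodup_spine h.nodup hi.nodup (fun v hv => h.disj_pre v (hi.mid_mem v hv))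
    (fun v hv => h.disj_tail v (hi.mid_mem v hv)), fun v hv => ?_⟩
  simp only [List.mem_append, List.mem_cons, not_or] at hv ⊢
  by_cases hQ : v ∈ Q
  · have := hi.mem v hQ (by
      simp only [List.mem_append, List.mem_cons, not_or]
      exact ⟨hv.2.1, hv.2.2.1, fun h' => hv.2.2.2 (List.mem_of_mem_take h')⟩)
    simp only [List.mem_append, List.mem_cons] at this
    rcases this with h | h | h
    exacts [Or.inr (Or.inl h), Or.inr (Or.inr (Or.inl h)),
      Or.inr (Or.inr (Or.inr (List.mem_of_mem_take h)))]
  · have := h.out v hQ hv.1 hv.2.2.2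
    simp only [List.mem_append, List.mem_cons] at this
    tauto

lemma inner_mem (h : Ctx O Q pre w tail π) (hi : LocalSpine Q w mid tail π) {u v : S}
    (hu : InnerEdge Q w mid tail π u v) : u ∈ Q ∧ v ∈ Q := by
  have hm : ∀ v ∈ w :: (mid ++ tail.take 1), v ∈ Q := by
    intro v hv
    simp only [List.mem_cons, List.mem_append] at hv
    rcases hv with rfl | hv | hv
    exacts [h.mem, hi.mid_mem v hv, h.head v hv]
  rcases hu with hu | ⟨h1, h2, rfl⟩
  · exact ⟨hm _ hu.mem.1, hm _ hu.mem.2⟩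
  · exact ⟨h1, hm _ (hi.mem u h1 h2)⟩

/-- An outer and an inner edge can meet only inside the hull of `Q`, hence in a point of `O`. This
point belongs to `S`, so by general position it is an end of both edges. Only pairs of inner edges
remain to be checked. -/
lemma planar (hS : GeneralPosition S) (h : Ctx O Q pre w tail π) (hi : LocalSpine Q w mid tail π)
    (hloc : ∀ a b c d : S, InnerEdge Q w mid tail π a b → InnerEdge Q w mid tail π c d →
      a ≠ b → c ≠ d → s(a, b) ≠ s(c, d) → ∀ x ∈ hull {a, b}, x ∈ hull {c, d} →
        (x = a ∨ x = b) ∧ (x = c ∨ x = d)) :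
    IsPlaneGraph (catG (pre ++ w :: (mid ++ tail)) π) := by
  rw [plane_iff]
  have mixed : ∀ a b c d : S, OuterEdge Q pre w tail π a b → InnerEdge Q w mid tail π c d →
      ∀ x ∈ hull {a, b}, x ∈ hull {c, d} → (x = a ∨ x = b) ∧ (x = c ∨ x = d) := by
    intro a b c d h1 h2 x hx hx'
    have hcd := h.inner_mem hi h2
    obtain ⟨o, -, rfl⟩ := h.clean a b h1 x hx (hull_mono (by
      rintro v (rfl | rfl)
      exacts [hcd.1, hcd.2]) hx')
    rw [Subtype.coe_inj, Subtype.coe_inj, Subtype.coe_inj, Subtype.coe_inj]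
    exact ⟨mem_hull_pair hS hx, mem_hull_pair hS hx'⟩
  have key : ∀ a b c d : S, (OuterEdge Q pre w tail π a b ∨ InnerEdge Q w mid tail π a b) →
      (OuterEdge Q pre w tail π c d ∨ InnerEdge Q w mid tail π c d) → a ≠ b → c ≠ d →
      s(a, b) ≠ s(c, d) → ∀ x ∈ hull {a, b}, x ∈ hull {c, d} →
        (x = a ∨ x = b) ∧ (x = c ∨ x = d) := by
    rintro a b c d (h1 | h1) (h2 | h2) hab hcd hne x hx hx'
    exacts [h.plane a b c d h1 h2 hne x hx hx', mixed a b c d h1 h2 x hx hx',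
      (mixed c d a b h2 h1 x hx' hx).symm, hloc a b c d h1 h2 hab hcd hne x hx hx']
  intro a b c d hab hcd hne x hx hx'
  have h1 : (OuterEdge Q pre w tail π a b ∨ InnerEdge Q w mid tail π a b) ∨
      (OuterEdge Q pre w tail π b a ∨ InnerEdge Q w mid tail π b a) := by
    have := edge_cases (Q := Q) hab; tauto
  have h2 : (OuterEdge Q pre w tail π c d ∨ InnerEdge Q w mid tail π c d) ∨
      (OuterEdge Q pre w tail π d c ∨ InnerEdge Q w mid tail π d c) := by
    have := edge_cases (Q := Q) hcd; tauto
  rcases h1 with h1 | h1 <;> rcases h2 with h2 | h2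
  · exact key a b c d h1 h2 hab.ne hcd.ne hne x hx hx'
  · rw [Set.pair_comm c d] at hx'
    rw [Sym2.eq_swap (a := c)] at hne
    have := key a b d c h1 h2 hab.ne hcd.ne.symm hne x hx hx'; tauto
  · rw [Set.pair_comm a b] at hx
    rw [Sym2.eq_swap (a := a)] at hne
    have := key b a c d h1 h2 hab.ne.symm hcd.ne hne x hx hx'; tauto
  · rw [Set.pair_comm a b] at hx
    rw [Set.pair_comm c d] at hx'
    rw [Sym2.eq_swap (a := a), Sym2.eq_swap (a := c)] at hne
    have := key b a d c h1 h2 hab.ne.symm hcd.ne.symm hne x hx hx'; tauto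

lemma inner_star (h : Ctx O Q pre w tail π) (hπ : ∀ v ∈ Q, v ≠ w → v ∉ tail → π v = w) :
    LocalSpine Q w [] tail π := by
  have hnd : (w :: tail.take 1).Nodup :=
    (h.nodup.of_append_right).sublist ((List.take_sublist 1 tail).cons_cons w)
  refine ⟨by simp, hnd, fun v hv hv' => ?_⟩
  simp only [List.nil_append, List.mem_cons, not_or] at hv' ⊢
  refine Or.inl (hπ v hv hv'.1 fun ht => ?_)
  rw [← List.take_append_drop 1 tail, List.mem_append] at ht
  exact ht.elim hv'.2 (h.disj_tail v hv)

lemma isCode_star (h : Ctx O Q pre w tail π) (hπ : ∀ v ∈ Q, v ≠ w → v ∉ tail → π v = w) :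
    IsCode (pre ++ w :: tail) π := h.isCode (h.inner_star hπ)

/-- With an empty `mid` all inner edges share the end `w`, so no two of them cross. -/
lemma plane_star (hS : GeneralPosition S) (h : Ctx O Q pre w tail π)
    (hπ : ∀ v ∈ Q, v ≠ w → v ∉ tail → π v = w) : IsPlaneGraph (catG (pre ++ w :: tail) π) := by
  refine h.planar hS (h.inner_star hπ) ?_
  have star : ∀ a b, InnerEdge Q w [] tail π a b → ∃ c, ({a, b} : Set S) = {w, c} := by
    rintro a b (h1 | ⟨h1, h2, rfl⟩)
    · cases tail with
      | nil => exact h1.elim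
      | cons p t =>
        simp only [List.take, List.nil_append, consec_cons_cons, consec_singleton, or_false] at h1
        exact ⟨p, by rw [h1.1, h1.2]⟩
    · simp only [List.nil_append, List.mem_cons, not_or] at h2
      rw [hπ a h1 h2.1 fun ht => ?_]
      · exact ⟨a, Set.pair_comm ..⟩
      rw [← List.take_append_drop 1 tail, List.mem_append] at ht
      exact ht.elim h2.2 (h.disj_tail a h1)
  intro a b c d h1 h2 hab hcd hne x hx hx'
  obtain ⟨e, he⟩ := star a b h1
  obtain ⟨f, hf⟩ := star c d h2
  have hwe : w ≠ e := by
    rintro rfl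
    have ha : a ∈ ({w, w} : Set S) := he ▸ by simp
    have hb : b ∈ ({w, w} : Set S) := he ▸ by simp
    simp at ha hb
    exact hab (ha.trans hb.symm)
  have hwf : w ≠ f := by
    rintro rfl
    have ha : c ∈ ({w, w} : Set S) := hf ▸ by simp
    have hb : d ∈ ({w, w} : Set S) := hf ▸ by simp
    simp at ha hb
    exact hcd (ha.trans hb.symm)
  have hef : e ≠ f := by
    rintro rfl
    apply hne
    have ha : a ∈ ({c, d} : Set S) := hf ▸ he ▸ (by simp)
    have hb : b ∈ ({c, d} : Set S) := hf ▸ he ▸ (by simp)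
    rw [Sym2.eq_iff]
    simp only [Set.mem_insert_iff, Set.mem_singleton_iff] at ha hb
    rcases ha with rfl | rfl <;> rcases hb with rfl | rfl <;> simp_all
  rw [he] at hx
  rw [hf] at hx'
  have hxw := hull_pair_inter_pair hS hwe hwf hef ⟨hx, hx'⟩
  simp only [Set.mem_singleton_iff] at hxw
  subst hxw
  simp only [Subtype.coe_inj]
  have m1 : w ∈ ({a, b} : Set S) := by rw [he]; simp
  have m2 : w ∈ ({c, d} : Set S) := by rw [hf]; simp
  simpa using And.intro m1 m2

/-- The edges which do not lie in a smaller local part are controlled. -/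
lemma clean_sub (h : Ctx O Q pre w tail π) {Q' O' : Set S} (hQ : Q' ⊆ Q)
    (hO : ∀ o ∈ O, (o : Plane) ∈ hull Q' → o ∈ O')
    (hloc : ∀ u v, InnerEdge Q w mid tail π u v → ¬ (u ∈ Q' ∧ v ∈ Q') → ∀ x ∈ hull {u, v},
      x ∈ hull Q' → ∃ o ∈ O', x = (o : Plane)) :
    Clean (catG (pre ++ w :: (mid ++ tail)) π) Q' O' := by
  have key : ∀ u v, OuterEdge Q pre w tail π u v → ∀ x ∈ hull {u, v}, x ∈ hull Q' →
      ∃ o ∈ O', x = (o : Plane) := by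
    intro u v huv x hx hx'
    obtain ⟨o, ho, rfl⟩ := h.clean u v huv x hx (hull_mono hQ hx')
    exact ⟨o, hO o ho hx', rfl⟩
  intro u v huv hne x hx hx'
  rcases edge_cases (Q := Q) huv with (h | h) | (h | h)
  · exact key u v h x hx hx'
  · exact key v u h x (by rwa [Set.pair_comm]) hx'
  · exact hloc u v h hne x hx hx'
  · exact hloc v u h (fun h => hne h.symm) x (by rwa [Set.pair_comm]) hx'

/-- The entrance to the local calculus: the outer edges are edges of a caterpillar already known to
be plane, so their part of the planarity is inherited. `hout` ensures that no outer leaf hangs on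
`mid`, which may then be replaced. -/
lemma of_clean (hc : IsCode (pre ++ w :: (mid ++ tail)) π)
    (hpl : IsPlaneGraph (catG (pre ++ w :: (mid ++ tail)) π))
    (hcl : Clean (catG (pre ++ w :: (mid ++ tail)) π) Q O) (hfull : Full Q) (hw : w ∈ Q)
    (hhead : ∀ v ∈ tail.take 1, v ∈ Q) (hpre : ∀ v ∈ Q, v ∉ pre) (htail : ∀ v ∈ Q, v ∉ tail.drop 1)
    (hmid : ∀ v ∈ mid, v ∈ Q) (hout : ∀ v, v ∉ Q → v ∉ pre → v ∉ tail → π v ∉ mid) : Ctx O Q pre w tail π := by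
  have hadj : ∀ u v, OuterEdge Q pre w tail π u v → (catG (pre ++ w :: (mid ++ tail)) π).Adj u v := by
    rintro u v (h | h | ⟨h1, h2, h3, rfl⟩)
    · exact hc.adj_of_consec (consec_spine.2 (Or.inl h))
    · exact hc.adj_of_consec (consec_spine.2 (Or.inr (Or.inr h)))
    · refine hc.adj_leaf ?_
      simp only [List.mem_append, List.mem_cons, not_or]
      exact ⟨h2, fun e => h1 (e ▸ hw), fun hm => h1 (hmid u hm), h3⟩
  refine ⟨hc.nodup.sublist ?_, hw, hhead, hpre, htail, ?_, hfull, ?_, ?_⟩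
  · exact List.Sublist.append_left ((List.sublist_append_right mid tail).cons_cons w) pre
  · intro v h1 h2 h3
    have := hc.mem v (by
      simp only [List.mem_append, List.mem_cons, not_or]
      exact ⟨h2, fun e => h1 (e ▸ hw), fun hm => h1 (hmid v hm), h3⟩)
    simp only [List.mem_append, List.mem_cons] at this ⊢
    have := hout v h1 h2 h3
    tauto
  · intro u v huv x hx hx'
    refine hcl u v (hadj u v huv) ?_ x hx hx'
    rintro ⟨h1, h2⟩
    have hnd := hc.nodup
    rcases huv with h | h | h
    · have := h.mem.1
      have hne := h.ne ((List.Nodup.sublist (List.Sublist.append_left (by simp) pre)) hnd)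
      simp only [List.mem_append, List.mem_singleton] at this
      have h3 := this.resolve_left (hpre u h1)
      have := h.mem.2
      simp only [List.mem_append, List.mem_singleton] at this
      exact hne (h3.trans (this.resolve_left (hpre v h2)).symm)
    · have hne := h.ne (hnd.of_append_right.of_cons.of_append_right)
      cases tail with
      | nil => exact h
      | cons p t =>
        have m1 := h.mem.1
        have m2 := h.mem.2
        simp only [List.mem_cons, List.drop_one, List.tail_cons] at m1 m2 htail
        exact hne ((m1.resolve_right (htail u h1)).trans (m2.resolve_right (htail v h2)).symm)
    · exact h.1 h1
  · intro a b c d h1 h2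
    exact (plane_iff _).1 hpl a b c d (hadj a b h1) (hadj c d h2)

/-- Reading the spine backwards exchanges the exits `w` and `p` of the local part. Statements about
leaves of `w` thereby also serve leaves of `p`. -/
lemma reverse {p : S} {post : List S} (h : Ctx O Q pre w (p :: post) π) :
    Ctx O Q post.reverse p (w :: pre.reverse) π := by
  have e : ∀ u v, OuterEdge Q post.reverse p (w :: pre.reverse) π u v →
      OuterEdge Q pre w (p :: post) π u v ∨ OuterEdge Q pre w (p :: post) π v u := by
    have hp : p ∈ Q := h.head p (by simp)
    rintro u v (h1 | h1 | ⟨h1, h2, h3, rfl⟩)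
    · rw [← List.reverse_cons, consec_reverse] at h1
      exact Or.inr (Or.inr (Or.inl h1))
    · rw [show w :: pre.reverse = (pre ++ [w]).reverse by simp, consec_reverse] at h1
      exact Or.inr (Or.inl h1)
    · refine Or.inl (Or.inr (Or.inr ⟨h1, ?_, ?_, rfl⟩))
      · simp at h3; exact h3.2
      · simp at h2 ⊢
        exact ⟨fun e => h1 (e ▸ hp), h2⟩
  refine ⟨?_, h.head p (by simp), by simpa using h.mem, ?_, ?_, ?_, h.full, ?_, ?_⟩
  · have := List.nodup_reverse.2 h.nodup
    simpa using this
  · simpa using h.disj_tail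
  · simpa using h.disj_pre
  · intro v h1 h2 h3
    simp only [List.mem_reverse, List.mem_cons, not_or] at h2 h3
    have := h.out v h1 h3.2 (by
      simp only [List.mem_cons, not_or]
      exact ⟨fun e => h1 (e ▸ h.head p (by simp)), h2⟩)
    simp only [List.mem_append, List.mem_cons, List.mem_reverse] at this ⊢
    tauto
  · intro u v huv x hx hx'
    rcases e u v huv with h1 | h1
    · exact h.clean u v h1 x hx hx'
    · exact h.clean v u h1 x (by rwa [Set.pair_comm]) hx'
  · intro a b c d h1 h2 hne x hx hx'
    rcases e a b h1 with h1 | h1 <;> rcases e c d h2 with h2 | h2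
    · exact h.plane a b c d h1 h2 hne x hx hx'
    · rw [Set.pair_comm c d] at hx'
      rw [Sym2.eq_swap (a := c)] at hne
      have := h.plane a b d c h1 h2 hne x hx hx'; tauto
    · rw [Set.pair_comm a b] at hx
      rw [Sym2.eq_swap (a := a)] at hne
      have := h.plane b a c d h1 h2 hne x hx hx'; tauto
    · rw [Set.pair_comm a b] at hx
      rw [Set.pair_comm c d] at hx'
      rw [Sym2.eq_swap (a := a), Sym2.eq_swap (a := c)] at hne
      have := h.plane b a d c h1 h2 hne x hx hx'; tauto

end Ctx

lemma Full.sub {Q Q' : Set S} (h : Full Q) (hQ : Q' ⊆ Q)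
    (hq : ∀ q ∈ Q, (q : Plane) ∈ hull Q' → q ∈ Q') : Full Q' :=
  fun v hv => hq v (h v (hull_mono hQ hv)) hv

lemma leaf_move_aux {V : Type*} {C : V → V → Prop} {L : V → Prop} {π π' : V → V} {w x y : V}
    (u v : V) (hπ : π y = w) (hπ' : π' y = x) (hne : ∀ v, v ≠ y → π' v = π v) (hy : ¬ L y)
    (hw : L w) (hx : L x) (hwx : w ≠ x) (a1 : C u v → L u ∧ L v) (a2 : C v u → L u ∧ L v)
    (a5 : ¬ L u → L (π u)) (a6 : ¬ L v → L (π v)) :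
    (u ≠ v ∧ ((C u v ∨ (¬ L u ∧ v = π' u)) ∨ (C v u ∨ (¬ L v ∧ u = π' v)))) ↔
    ((u ≠ v ∧ ((C u v ∨ (¬ L u ∧ v = π u)) ∨ (C v u ∨ (¬ L v ∧ u = π v)))) ∧
      ¬ (u = y ∧ v = w ∨ u = w ∧ v = y)) ∨ (u = y ∧ v = x ∨ u = x ∧ v = y) := by
  have e1 : w ≠ y := by rintro rfl; exact hy hw
  have e2 : x ≠ y := by rintro rfl; exact hy hx
  have h1 := hne u
  have h2 := hne v
  clear hne
  by_cases u1 : u = y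
  · subst u1
    by_cases v1 : v = w <;> by_cases v2 : v = x <;> grind
  by_cases v1 : v = y
  · subst v1
    by_cases v1 : u = w <;> by_cases v2 : u = x <;> grind
  rw [h1 u1, h2 v1]
  grind

/-- A leaf moves to a neighbour on the spine, if the triangle is empty. -/
lemma conn_leaf_move (hS : GeneralPosition S) {l : List S} {w x y : S} {π π' : S → S}
    (hc : IsCode l π) (hwx : (catG l π).Adj w x) (hw : w ∈ l) (hx : x ∈ l) (hy : y ∉ l)
    (hπ : π y = w) (hπ' : π' y = x) (hne : ∀ v, v ≠ y → π' v = π v)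
    (hG : IsPlaneGraph (catG l π)) (hfull : Full ({w, x, y} : Set S))
    (hcl : Clean (catG l π) {w, x, y} {w, x, y}) : Conn (catG l π) (catG l π') := by
  have hc' : IsCode l π' := by
    refine ⟨hc.ne_nil, hc.nodup, fun v hv => ?_⟩
    by_cases h : v = y
    · rw [h, hπ']; exact hx
    · rw [hne v h]; exact hc.mem v hv
  refine conn_of_slide hS hG hc.isCaterpillar hc'.isCaterpillar (a := y) (b := w) (c := x)
    (T := {w, x, y}) ?_ hwx (by rintro rfl; exact hy hx) (fun u v => ?_)
    (by intro v; simp; tauto) hfull hcl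
  · have := hc.adj_leaf hy
    rwa [hπ] at this
  · simp only [catG_adj, ne_eq, Sym2.eq_iff]
    exact leaf_move_aux (L := (· ∈ l)) u v hπ hπ' hne hy hw hx hwx.ne
      (fun h => h.mem) (fun h => h.mem.symm) (hc.mem u) (hc.mem v)

/-- The barycentric coordinates of `x` are the three partial areas divided by the total area `t`. -/
lemma mem_hull_triple {σ : ℝ} {a b c : S} {x : Plane} (h : 0 < area σ a b c)
    (h1 : 0 ≤ area σ a b x) (h2 : 0 ≤ area σ b c x) (h3 : 0 ≤ area σ c a x) :
    x ∈ hull {a, b, c} := by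
  set t := area σ a b c with ht
  have hsum := area_add σ (a : Plane) b c x
  have hx : x = (area σ b c x / t) • (a : Plane) + (area σ c a x / t) • (b : Plane) +
      (area σ a b x / t) • (c : Plane) := by
    have : t • x = area σ b c x • (a : Plane) + area σ c a x • (b : Plane) +
        area σ a b x • (c : Plane) := by
      rw [ht]
      ext i
      fin_cases i <;>
      · simp only [area, PiLp.add_apply, PiLp.smul_apply, smul_eq_mul, Fin.zero_eta, Fin.mk_one]
        ring
    have h' : x = t⁻¹ • (t • x) := by rw [smul_smul, inv_mul_cancel₀ h.ne', one_smul]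
    rw [this] at h'
    refine h'.trans ?_
    simp only [div_eq_inv_mul, smul_add, smul_smul]
  rw [hull_triple]
  have := (convex_convexHull ℝ {(a : Plane), (b : Plane), (c : Plane)}).sum_mem
    (t := Finset.univ) (w := ![area σ b c x / t, area σ c a x / t, area σ a b x / t])
    (z := ![(a : Plane), (b : Plane), (c : Plane)])
    (by intro i _; fin_cases i <;> simp <;> positivity)
    (by
      simp [Fin.sum_univ_three]
      field_simp
      linarith)
    (by intro i _; fin_cases i <;> exact subset_convexHull _ _ (by simp))
  rw [hx]
  simpa [Fin.sum_univ_three] using this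

lemma area_pos_of_mem_hull_triple (hS : GeneralPosition S) {σ : ℝ} {a b c z : S}
    (h : 0 < area σ a b c) (hz : (z : Plane) ∈ hull {a, b, c}) (ha : z ≠ a) (hb : z ≠ b)
    (hc : z ≠ c) : 0 < area σ a b z ∧ 0 < area σ b c z ∧ 0 < area σ c a z := by
  have hσ : σ ≠ 0 := by rintro rfl; simp [area] at h
  have hab : a ≠ b := by rintro rfl; simp at h
  have hac : a ≠ c := by rintro rfl; simp at h
  have hbc : b ≠ c := by rintro rfl; simp at h
  have r1 := area_rotate σ (a : Plane) b c
  have r2 := area_rotate σ (c : Plane) a b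
  refine ⟨lt_of_le_of_ne ?_ (area_ne_zero hS hab ha.symm hb.symm hσ).symm,
    lt_of_le_of_ne ?_ (area_ne_zero hS hbc hb.symm hc.symm hσ).symm,
    lt_of_le_of_ne ?_ (area_ne_zero hS hac.symm hc.symm ha.symm hσ).symm⟩
  all_goals
    refine hull_area_ge ?_ hz
    rintro q (rfl | rfl | rfl) <;> try simp only [area_left_self, area_right_self, le_refl]
    linarith

lemma hull_area_le {σ c : ℝ} {a b : Plane} {Q : Set S} (h : ∀ q ∈ Q, area σ a b q ≤ c)
    {x : Plane} (hx : x ∈ hull Q) : area σ a b x ≤ c := by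
  have := hull_area_ge (σ := -σ) (c := -c) (a := a) (b := b)
    (fun q hq => by rw [area_neg]; linarith [h q hq]) hx
  rw [area_neg] at this
  linarith

/-- The usual certificate for `Clean`: a line which weakly separates the edge from `Q` and leaves
`v` strictly on its own side. -/
lemma segment_meet_of_ge {σ c : ℝ} {a b x : Plane} {u v : S} {Q : Set S} (hu : area σ a b u ≤ c)
    (hv : area σ a b v < c) (hQ : ∀ q ∈ Q, c ≤ area σ a b q) (hx : x ∈ hull {u, v})
    (hx' : x ∈ hull Q) : x = u := by
  refine hull_inter_subset hu ?_ hQ ⟨hx, hx'⟩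
  rintro q (rfl | rfl) hq
  exacts [absurd rfl hq, hv]

lemma segment_meet_of_le {σ c : ℝ} {a b x : Plane} {u v : S} {Q : Set S} (hu : c ≤ area σ a b u)
    (hv : c < area σ a b v) (hQ : ∀ q ∈ Q, area σ a b q ≤ c) (hx : x ∈ hull {u, v})
    (hx' : x ∈ hull Q) : x = u := by
  refine segment_meet_of_ge (σ := -σ) (c := -c) (a := a) (b := b) ?_ ?_ ?_ hx hx'
  · rw [area_neg]; linarith
  · rw [area_neg]; linarith
  · intro q hq; rw [area_neg]; linarith [hQ q hq]

/-! ### Moving leaves across a spine edge. -/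

/-- The points of `S` in a triangle. -/
def tri (a b c : S) : Set S := {v | (v : Plane) ∈ hull {a, b, c}}

lemma left_mem_tri (a b c : S) : a ∈ tri a b c := mem_hull (by simp)
lemma mid_mem_tri (a b c : S) : b ∈ tri a b c := mem_hull (by simp)
lemma right_mem_tri (a b c : S) : c ∈ tri a b c := mem_hull (by simp)

lemma triple_subset {a b c : S} {Q : Set S} (ha : a ∈ Q) (hb : b ∈ Q) (hc : c ∈ Q) :
    ({a, b, c} : Set S) ⊆ Q := by
  rintro v (rfl | rfl | rfl)
  exacts [ha, hb, hc]

lemma hull_tri (a b c : S) : hull (tri a b c) = hull {a, b, c} := by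
  refine Set.Subset.antisymm (hull_le (P := tri a b c) fun v hv => hv)
    (hull_mono (P := {a, b, c}) (Q := tri a b c) ?_)
  exact triple_subset (left_mem_tri a b c) (mid_mem_tri a b c) (right_mem_tri a b c)

lemma full_tri (a b c : S) : Full (tri a b c) := fun v hv => by rwa [hull_tri] at hv

lemma tri_swap (a b c : S) : tri a c b = tri a b c := by
  unfold tri
  rw [show ({a, c, b} : Set S) = {a, b, c} by ext; simp; tauto]

lemma tri_subset {a b c : S} {Q : Set S} (hQ : Full Q) (ha : a ∈ Q) (hb : b ∈ Q) (hc : c ∈ Q) :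
    tri a b c ⊆ Q := fun v hv => hQ v (hull_mono (triple_subset ha hb hc) hv)

/-- All points of `Z`, attached to `w`, can be moved to one of them, which enters the spine between
`w` and `p`. -/
def StarSplit (Z : Set S) : Prop :=
  ∀ (σ : ℝ) (pre : List S) (w p : S) (post : List S) (π π' : S → S) (z₀ : S), σ ≠ 0 →
    (∀ z ∈ Z, 0 < area σ w p z) → Ctx {w, p} ({w, p} ∪ Z) pre w (p :: post) π →
    (∀ z ∈ Z, π z = w) → z₀ ∈ Z →
    (∀ v, v ∉ ({w, p} : Set S) ∪ Z → v ∉ pre → v ∉ p :: post → π' v = π v) →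
    (∀ z ∈ Z, z ≠ z₀ → π' z = z₀) →
    Conn (catG (pre ++ w :: p :: post) π) (catG (pre ++ w :: z₀ :: p :: post) π')

/-- All points of `Z`, attached to `w`, can be moved to `p`. -/
def StarShift (Z : Set S) : Prop :=
  ∀ (σ : ℝ) (pre : List S) (w p : S) (post : List S) (π π' : S → S), σ ≠ 0 →
    (∀ z ∈ Z, 0 < area σ w p z) → Ctx {w, p} ({w, p} ∪ Z) pre w (p :: post) π →
    (∀ z ∈ Z, π z = w) →
    (∀ v, v ∉ ({w, p} : Set S) ∪ Z → v ∉ pre → v ∉ p :: post → π' v = π v) →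
    (∀ z ∈ Z, π' z = p) →
    Conn (catG (pre ++ w :: p :: post) π) (catG (pre ++ w :: p :: post) π')

/-- A leaf `y` of `w` is inserted in the spine, while the other points of the triangle `wxy` remain
leaves of `w`. -/
def TriInsert (w x y : S) : Prop :=
  ∀ (pre post : List S) (π : S → S), w ≠ y → x ≠ y →
    Ctx {w, x} (tri w x y) pre w (x :: post) π → (∀ v ∈ tri w x y, v ≠ w → v ≠ x → π v = w) →
    Conn (catG (pre ++ w :: x :: post) π) (catG (pre ++ w :: y :: x :: post) π)

/-- Both caterpillars can be split to the same one, with a point `z₀` of `Z` between `w` and `p` and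
the rest of `Z` attached to `z₀`. For the leaves of `p` the split is applied to the reversed spine
with the opposite orientation. -/
lemma starShift_of_starSplit (hS : GeneralPosition S) {Z : Set S} (h : StarSplit Z) :
    StarShift Z := by
  classical
  intro σ pre w p post π π' hσ hside hctx hπ hagree hπ'
  have hw : w ∉ Z := fun hw => by simpa using hside w hw
  have hp : p ∉ Z := fun hp => by simpa using hside p hp
  have hstar : ∀ v ∈ ({w, p} : Set S) ∪ Z, v ≠ w → v ∉ p :: post → π v = w := by
    rintro v ((rfl | rfl) | hv) h1 h2
    · exact absurd rfl h1
    · simp at h2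
    · exact hπ v hv
  have hctx' := hctx.congr hagree
  rcases Z.eq_empty_or_nonempty with rfl | ⟨z₀, hz₀⟩
  · have : catG (pre ++ w :: p :: post) π = catG (pre ++ w :: p :: post) π' := by
      refine catG_congr fun v hv => (hagree v ?_ ?_ ?_).symm
      · simp at hv ⊢; tauto
      · simp at hv ⊢; tauto
      · simp at hv ⊢; tauto
    rw [← this]
    exact .refl (hctx.plane_star hS hstar) (hctx.isCode_star hstar).isCaterpillar
  · set π₁ : S → S := fun v => if v ∈ Z then z₀ else π v with hπ₁
    have h1 := h σ pre w p post π π₁ z₀ hσ hside hctx hπ hz₀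
      (fun v hv _ _ => by simp only [hπ₁]; rw [if_neg fun h => hv (Or.inr h)])
      (fun z hz _ => by simp only [hπ₁]; rw [if_pos hz])
    have hctxr := hctx'.reverse
    rw [Set.pair_comm w p] at hctxr
    have h2 := h (-σ) post.reverse p w pre.reverse π' π₁ z₀ (neg_ne_zero.2 hσ)
      (fun z hz => by rw [area_neg, ← area_swap_left]; exact hside z hz) hctxr hπ' hz₀
      (fun v hv h1 h2 => by
        simp only [hπ₁]
        rw [if_neg fun h => hv (Or.inr h)]
        rw [Set.pair_comm p w] at hv
        refine (hagree v hv ?_ ?_).symm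
        · simp at h2; exact h2.2
        · simp at h1 hv ⊢; tauto)
      (fun z hz _ => by simp only [hπ₁]; rw [if_pos hz])
    have e1 : post.reverse ++ p :: w :: pre.reverse = (pre ++ w :: p :: post).reverse := by simp
    have e2 : post.reverse ++ p :: z₀ :: w :: pre.reverse =
      (pre ++ w :: z₀ :: p :: post).reverse := by simp
    rw [e1, e2, catG_reverse, catG_reverse] at h2
    exact h1.trans h2.symm

/-- Let `z₁` be the point of `Z` next to `p` in the angular order around `w`. The triangle `w p z₁`
is empty, so `z₁` can enter the spine, and the other points form a smaller instance beside the edge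
`wz₁`. If `z₀ = z₁`, they are shifted to `z₁`. Otherwise they are split at `z₀`, which gives the
spine `w, z₀, z₁, p`, and `z₁` is taken out again by reversing `TriInsert z₀ p z₁`. -/
lemma starSplit_of_lt (hS : GeneralPosition S) {Z : Set S}
    (ih : ∀ Z' : Set S, Z'.ncard < Z.ncard → StarSplit Z')
    (ihF : ∀ w x y : S, (tri w x y).ncard ≤ Z.ncard + 1 → TriInsert w x y) : StarSplit Z := by
  classical
  intro σ pre w p post π π' z₀ hσ hside h hπ hz₀ hagree hπ'
  have hw : w ∉ Z := fun hw => by simpa using hside w hw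
  have hp : p ∉ Z := fun hp => by simpa using hside p hp
  have hwp : w ≠ p := by rintro rfl; simpa using hside z₀ hz₀
  have hstar : ∀ v ∈ ({w, p} : Set S) ∪ Z, v ≠ w → v ∉ p :: post → π v = w := by
    rintro v ((rfl | rfl) | hv) h1 h2
    · exact absurd rfl h1
    · simp at h2
    · exact hπ v hv
  obtain ⟨z₁, hz₁, hfirst⟩ := exists_first hS hσ (w := w) (r := p) (Z := Z.toFinite.toFinset)
    ⟨z₀, by simpa using hz₀⟩ (fun z hz => hside z (by simpa using hz))
  simp only [Set.Finite.mem_toFinset] at hz₁ hfirst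
  have hp1 : area σ w z₁ p < 0 := by rw [area_swap_right]; linarith [hside z₁ hz₁]
  have hz₁w : z₁ ≠ w := fun e => hw (e ▸ hz₁)
  have hz₁p : z₁ ≠ p := fun e => hp (e ▸ hz₁)
  have hz₁post : z₁ ∉ post := h.disj_tail z₁ (Or.inr hz₁)
  have hz₁pre : z₁ ∉ pre := h.disj_pre z₁ (Or.inr hz₁)
  -- insert the first point
  have conn1 : Conn (catG (pre ++ w :: p :: post) π) (catG (pre ++ w :: z₁ :: p :: post) π) := by
    have hle : ∀ q ∈ ({w, p, z₁} : Set S), area σ w z₁ q ≤ 0 := by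
      rintro q (rfl | rfl | rfl)
      exacts [by simp, hp1.le, by simp]
    refine conn_insert hS (h.isCode_star hstar) ?_ (hπ z₁ hz₁) (h.plane_star hS hstar) ?_ ?_
    · simp only [List.mem_append, List.mem_cons, not_or]
      exact ⟨hz₁pre, hz₁w, hz₁p, hz₁post⟩
    · refine h.full.sub ?_ ?_
      · rintro q (rfl | rfl | rfl)
        exacts [Or.inl (by simp), Or.inl (by simp), Or.inr hz₁]
      · rintro q ((rfl | rfl) | hq) hq'
        · simp
        · simp
        · by_contra hne
          have hne1 : q ≠ z₁ := by rintro rfl; simp at hne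
          linarith [hfirst q hq hne1, hull_area_le hle hq']
    · refine h.clean_sub (mid := []) ?_ ?_ ?_
      · rintro q (rfl | rfl | rfl)
        exacts [Or.inl (by simp), Or.inl (by simp), Or.inr hz₁]
      · rintro o (rfl | rfl) - <;> simp
      · rintro u v (huv | ⟨hu, hu', rfl⟩) hne x hx hx'
        · simp at huv
          exact absurd (by rw [huv.1, huv.2]; simp) hne
        · simp only [List.nil_append, List.take, List.mem_cons, List.not_mem_nil, or_false,
            not_or] at hu'
          have huZ : u ∈ Z := by
            rcases hu with (rfl | rfl) | hu
            exacts [absurd rfl hu'.1, absurd rfl hu'.2, hu]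
          rw [hπ u huZ] at hx hne
          have hne1 : u ≠ z₁ := by rintro rfl; simp at hne
          refine ⟨w, by simp, ?_⟩
          rw [Set.pair_comm] at hx
          exact segment_meet_of_le (σ := σ) (c := 0) (a := w) (b := z₁) (by simp)
            (hfirst u huZ hne1) hle hx hx'
  -- the remaining points
  have hge : ∀ q ∈ ({w, z₁} : Set S) ∪ (Z \ {z₁}), 0 ≤ area σ w z₁ q := by
    rintro q ((rfl | rfl) | ⟨hq, hq'⟩)
    exacts [by simp, by simp, (hfirst q hq hq').le]
  have hsub1 : ({w, z₁} : Set S) ∪ (Z \ {z₁}) ⊆ {w, p} ∪ Z := by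
    rintro q ((rfl | rfl) | ⟨hq, hq'⟩)
    exacts [Or.inl (by simp), Or.inr hz₁, Or.inr hq]
  -- The line `wz₁` separates `p` from the smaller part, so the edge `z₁p` becomes an outer edge
  -- touching it only in `z₁`.
  have hp2 : (p : Plane) ∉ hull (({w, z₁} : Set S) ∪ (Z \ {z₁})) := fun hp' => by
    linarith [hull_area_ge hge hp']
  have hloc1 : LocalSpine ({w, p} ∪ Z) w [z₁] (p :: post) π := by
    refine ⟨by simpa using Or.inr hz₁, ?_, ?_⟩
    · simp [hwp, hz₁w.symm, hz₁p]
    · intro v hv hv'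
      simp at hv' ⊢
      rcases hv with (rfl | rfl) | hv
      · simp at hv'
      · simp at hv'
      · exact Or.inl (hπ v hv)
  have h1 : Ctx {w, z₁} ({w, z₁} ∪ (Z \ {z₁})) pre w (z₁ :: p :: post) π := by
    refine Ctx.of_clean (mid := []) (h.isCode hloc1) conn1.plane_right ?_ ?_ (by simp) (by simp)
      (fun v hv => h.disj_pre v (hsub1 hv)) ?_ (by simp) (by simp)
    · refine h.clean_sub (mid := [z₁]) hsub1 ?_ ?_
      · rintro o (rfl | rfl) ho
        exacts [by simp, absurd ho hp2]
      · rintro u v (huv | ⟨hu, hu', rfl⟩) hne x hx hx'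
        · simp at huv
          rcases huv with ⟨rfl, rfl⟩ | ⟨rfl, rfl⟩
          · exact absurd (by simp) hne
          · exact ⟨u, by simp, segment_meet_of_ge (by simp) hp1 hge hx hx'⟩
        · simp at hu'
          rcases hu with (rfl | rfl) | hu
          · simp at hu'
          · simp at hu'
          · rw [hπ u hu] at hne
            exact absurd ⟨Or.inr ⟨hu, hu'.2.1⟩, by simp⟩ hne
    · refine h.full.sub hsub1 ?_
      rintro q ((rfl | rfl) | hq) hq'
      · simp
      · exact absurd hq' hp2
      · by_cases e : q = z₁
        · simp [e]
        · exact Or.inr ⟨hq, e⟩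
    · intro v hv
      simp only [List.drop_succ_cons, List.drop_zero, List.mem_cons, not_or]
      refine ⟨?_, h.disj_tail v (hsub1 hv)⟩
      rintro rfl
      exact hp2 (mem_hull hv)
  have hcard : (Z \ {z₁}).ncard < Z.ncard := Set.ncard_sdiff_singleton_lt_of_mem hz₁
  have hside1 : ∀ z ∈ Z \ {z₁}, 0 < area σ w z₁ z := fun z hz => hfirst z hz.1 hz.2
  rcases eq_or_ne z₀ z₁ with rfl | hz
  · refine conn1.trans (starShift_of_starSplit hS (ih _ hcard) σ pre w z₀ (p :: post) π π' hσ hside1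
      h1 (fun z hz => hπ z hz.1) (fun v hv h2 h3 => hagree v ?_ h2 fun h4 => h3 (by simp at h4 ⊢; tauto))
      fun z hz => hπ' z hz.1 hz.2)
    rintro ((rfl | rfl) | hv')
    · exact hv (by simp)
    · exact h3 (by simp)
    · refine hv ?_
      by_cases e : v = z₀
      · simp [e]
      · exact Or.inr ⟨hv', e⟩
  · set π₃ : S → S := fun v => if v ∈ Z then z₀ else π v with hπ₃
    have hπ₃Z : ∀ z ∈ Z, π₃ z = z₀ := fun z hz => by simp only [hπ₃]; rw [if_pos hz]
    have hπ₃' : ∀ z, z ∉ Z → π₃ z = π z := fun z hz => by simp only [hπ₃]; rw [if_neg hz]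
    have conn2 := ih _ hcard σ pre w z₁ (p :: post) π π₃ z₀ hσ hside1 h1 (fun z hz => hπ z hz.1)
      ⟨hz₀, hz⟩ (fun v hv _ h3 => hπ₃' v fun hv' => hv (by
        by_cases e : v = z₁
        · simp [e]
        · exact Or.inr ⟨hv', e⟩)) (fun z hz _ => hπ₃Z z hz.1)
    have hctx3 : Ctx {w, p} ({w, p} ∪ Z) pre w (p :: post) π₃ :=
      h.congr fun v hv _ _ => hπ₃' v fun h => hv (Or.inr h)
    have hz₀w : z₀ ≠ w := fun e => hw (e ▸ hz₀)
    have hz₀p : z₀ ≠ p := fun e => hp (e ▸ hz₀)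
    have hz₀area := hfirst z₀ hz₀ hz
    have hloc3 : LocalSpine ({w, p} ∪ Z) w [z₀, z₁] (p :: post) π₃ := by
      refine ⟨by rintro v hv; simp at hv; rcases hv with rfl | rfl <;> right <;> assumption, ?_, ?_⟩
      · simp [hwp, hz₁w.symm, hz₁p, hz₀w.symm, hz₀p, hz]
      · intro v hv hv'
        simp at hv' ⊢
        rcases hv with (rfl | rfl) | hv
        · simp at hv'
        · simp at hv'
        · exact Or.inr (Or.inl (hπ₃Z v hv))
    have hsub3 : tri z₀ p z₁ ⊆ {w, p} ∪ Z :=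
      tri_subset h.full (Or.inr hz₀) (Or.inl (by simp)) (Or.inr hz₁)
    have hw3 : (w : Plane) ∉ hull {z₀, p, z₁} := fun hw' => by
      have := hull_face (σ := σ) (c := 0) (a := w) (b := p) (u := p) (by simp) ?_ hw' (by simp)
      · exact hwp (Subtype.ext this)
      · rintro q (rfl | rfl | rfl) hne
        exacts [hside _ hz₀, absurd rfl hne, hside _ hz₁]
    have h3 : Ctx {z₀, p} (tri z₀ p z₁) (pre ++ [w]) z₀ (p :: post) π₃ := by
      have e : (pre ++ [w]) ++ z₀ :: ([z₁] ++ p :: post) = pre ++ w :: ([z₀, z₁] ++ p :: post) := by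
        simp
      refine Ctx.of_clean (mid := [z₁]) (e ▸ hctx3.isCode hloc3) (e ▸ conn2.plane_right) ?_
        (full_tri _ _ _) (left_mem_tri _ _ _) (by simpa using mid_mem_tri _ _ _) ?_ ?_
        (by simpa using right_mem_tri _ _ _) ?_
      · rw [e]
        refine hctx3.clean_sub hsub3 ?_ ?_
        · rintro o (rfl | rfl) ho
          · rw [hull_tri] at ho
            exact absurd ho hw3
          · simp
        · rintro u v (huv | ⟨hu, hu', rfl⟩) hne x hx hx'
          · simp at huv
            rcases huv with ⟨rfl, rfl⟩ | ⟨rfl, rfl⟩ | ⟨rfl, rfl⟩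
            · refine ⟨v, by simp, ?_⟩
              have hu1 : area σ u v p < 0 := by
                rw [area_swap_right]; linarith [hside v hz₀]
              have hu2 : area σ u v z₁ < 0 := by
                rw [area_swap_right]; linarith
              rw [hull_tri] at hx'
              refine hull_inter_subset (σ := σ) (c := 0) (a := u) (b := v) (u := v)
                (P := {v, p, z₁}) (by simp) ?_ ?_ ⟨hx', hx⟩
              · rintro q (rfl | rfl | rfl) hq
                exacts [absurd rfl hq, hu1, hu2]
              · rintro q (rfl | rfl) <;> simp
            · exact absurd ⟨left_mem_tri _ _ _, right_mem_tri _ _ _⟩ hne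
            · exact absurd ⟨right_mem_tri _ _ _, mid_mem_tri _ _ _⟩ hne
          · simp at hu'
            have huZ : u ∈ Z := by
              rcases hu with (rfl | rfl) | hu
              · simp at hu'
              · simp at hu'
              · exact hu
            rw [hπ₃Z u huZ] at hx hne
            refine ⟨z₀, by simp, ?_⟩
            rw [hull_tri] at hx'
            -- The line `wz₁` has `z₀` and `u` strictly on one side and `p`, `z₁` not on that side,
            -- so the edge `z₀u` misses `pz₁`. Its end `u` lies outside of the triangle.
            refine segment_inter_hull (y := u) (by simp) ?_ ?_ ⟨by rwa [Set.pair_comm], hx'⟩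
            · intro y hy hy'
              refine hull_disjoint (σ := σ) (c := 0) (a := z₁) (b := w) (P := {z₀, u}) ?_ ?_ hy hy'
              · rintro q (rfl | rfl)
                · rw [area_swap_left]; linarith
                · rw [area_swap_left]; linarith [hfirst q huZ hu'.2.2.1]
              · rintro q (rfl | rfl)
                · rw [area_swap_left]; linarith
                · simp
            · exact fun h => hne ⟨h, left_mem_tri _ _ _⟩
      · intro v hv
        simp only [List.mem_append, List.mem_singleton, not_or]
        refine ⟨h.disj_pre v (hsub3 hv), ?_⟩
        rintro rfl
        exact hw3 hv
      · exact fun v hv => h.disj_tail v (hsub3 hv)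
      · intro v _ h2 h3 hv
        simp only [List.mem_append, List.mem_singleton, not_or] at h2 hv
        by_cases hvZ : v ∈ Z
        · rw [hπ₃Z v hvZ] at hv
          exact hz hv
        · rw [hπ₃' v hvZ] at hv
          have := h.out v (by
            rintro ((rfl | rfl) | h)
            exacts [h2.2 rfl, h3 (by simp), hvZ h]) h2.1 h3
          rw [hv] at this
          simp [hz₁pre, hz₁w, hz₁p, hz₁post] at this
    -- The triangle avoids `w`, so it contains at most `p` and the points of `Z`. This bound makes
    -- the mutual induction close.
    have hcard3 : (tri z₀ p z₁).ncard ≤ Z.ncard + 1 := by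
      have : tri z₀ p z₁ ⊆ insert p Z := by
        intro v hv
        rcases hsub3 hv with (rfl | rfl) | hv'
        · exact absurd hv hw3
        · simp
        · exact Or.inr hv'
      exact (Set.ncard_le_ncard this).trans (Set.ncard_insert_le _ _)
    have conn3 := ihF z₀ p z₁ hcard3 (pre ++ [w]) post π₃ hz hz₁p.symm h3 (fun v hv h1 h2 => by
      rcases hsub3 hv with (rfl | rfl) | hv'
      · exact absurd hv hw3
      · exact absurd rfl h2
      · exact hπ₃Z v hv')
    simp only [List.append_assoc, List.singleton_append] at conn3
    have e : catG (pre ++ w :: z₀ :: p :: post) π₃ = catG (pre ++ w :: z₀ :: p :: post) π' := by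
      refine catG_congr fun v hv => ?_
      simp only [List.mem_append, List.mem_cons, not_or] at hv
      by_cases hvZ : v ∈ Z
      · rw [hπ₃Z v hvZ, hπ' v hvZ hv.2.2.1]
      · rw [hπ₃' v hvZ, hagree v _ hv.1 (by simp [hv])]
        rintro ((rfl | rfl) | h)
        exacts [hv.2.1 rfl, hv.2.2.2.1 rfl, hvZ h]
    rw [← e]
    exact conn1.trans (conn2.trans conn3.symm)

/-- An empty triangle needs one slide. Otherwise let `u` be the inner point next to `y` in the
angular order around `w`. The inner points are gathered at `u`, which enters the spine; `y` moves
from `w` to `u` across the empty triangle `wuy`; `y` enters between `u` and `x` by induction; the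
other inner points return to `w`; and `u` leaves the spine, again across `wuy`. -/
lemma triInsert_of_lt (hS : GeneralPosition S) {w x y : S}
    (ih : ∀ Z : Set S, Z.ncard + 2 ≤ (tri w x y).ncard → StarSplit Z)
    (ihF : ∀ w' x' y' : S, (tri w' x' y').ncard < (tri w x y).ncard → TriInsert w' x' y') :
    TriInsert w x y := by
  classical
  intro pre post π hwy hxy h hπ
  have hstar : ∀ v ∈ tri w x y, v ≠ w → v ∉ x :: post → π v = w := fun v hv h1 h2 =>
    hπ v hv h1 fun e => h2 (by simp [e])
  have hwx : w ≠ x := fun e => by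
    have := h.nodup.of_append_right
    simp [e] at this
  have hwpre := h.disj_pre w (left_mem_tri _ _ _)
  have hwpost := h.disj_tail w (left_mem_tri _ _ _)
  have hxpre := h.disj_pre x (mid_mem_tri _ _ _)
  have hxpost := h.disj_tail x (mid_mem_tri _ _ _)
  have hypre := h.disj_pre y (right_mem_tri _ _ _)
  have hypost := h.disj_tail y (right_mem_tri _ _ _)
  simp only [List.drop_succ_cons, List.drop_zero] at hwpost hxpost hypost
  have hyl : y ∉ pre ++ w :: x :: post := by
    simp only [List.mem_append, List.mem_cons, not_or]
    exact ⟨hypre, hwy.symm, hxy.symm, hypost⟩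
  have hπy := hπ y (right_mem_tri _ _ _) hwy.symm hxy.symm
  set Z : Set S := tri w x y \ {w, x, y} with hZ
  have memZ : ∀ v, v ∈ Z ↔ v ∈ tri w x y ∧ v ≠ w ∧ v ≠ x ∧ v ≠ y := by
    intro v; simp [hZ]
  have casesT : ∀ v ∈ tri w x y, v = w ∨ v = x ∨ v = y ∨ v ∈ Z := by
    intro v hv; rw [memZ]; tauto
  have hsubT : ({w, x, y} : Set S) ⊆ tri w x y :=
    triple_subset (left_mem_tri _ _ _) (mid_mem_tri _ _ _) (right_mem_tri _ _ _)
  have hcardZ : Z.ncard + 2 ≤ (tri w x y).ncard := by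
    rw [← Set.ncard_pair hwx, ← Set.ncard_union_eq]
    · refine Set.ncard_le_ncard (Set.union_subset Set.sdiff_subset ?_)
      rintro v (rfl | rfl)
      exacts [left_mem_tri _ _ _, mid_mem_tri _ _ _]
    · refine Set.disjoint_left.2 fun v hv => ?_
      rw [memZ] at hv
      simp [hv]
  rcases Z.eq_empty_or_nonempty with hZe | ⟨z₀, hz₀⟩
  · have hT : tri w x y = {w, x, y} := by
      refine Set.Subset.antisymm (fun v hv => ?_) hsubT
      rcases casesT v hv with rfl | rfl | rfl | hv
      · simp
      · simp
      · simp
      · rw [hZe] at hv; exact hv.elim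
    rw [hT] at h
    refine conn_insert hS (h.isCode_star (by rwa [hT] at hstar)) hyl hπy
      (h.plane_star hS (by rwa [hT] at hstar)) h.full ?_
    refine h.clean_sub (mid := []) subset_rfl ?_ ?_
    · rintro o (rfl | rfl) - <;> simp
    · rintro u v (huv | ⟨hu, hu', rfl⟩) hne a ha ha'
      · simp at huv
        exact absurd (by rw [huv.1, huv.2]; simp) hne
      · simp at hu'
        rcases hu with rfl | rfl | rfl
        · simp at hu'
        · simp at hu'
        · rw [hπy] at hne
          simp at hne
  -- orientation
  obtain ⟨σ, hσ, ht⟩ : ∃ σ : ℝ, σ ≠ 0 ∧ 0 < area σ w x y := by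
    have := area_ne_zero hS hwx hwy hxy one_ne_zero
    exact ⟨area 1 w x y, this, area_scale _ _ _ this⟩
  have hpos : ∀ z ∈ Z, 0 < area σ w x z ∧ 0 < area σ x y z ∧ 0 < area σ y w z := by
    intro z hz
    rw [memZ] at hz
    exact area_pos_of_mem_hull_triple hS ht hz.1 hz.2.1 hz.2.2.1 hz.2.2.2
  obtain ⟨u, hu, hlast⟩ := exists_first hS (neg_ne_zero.2 hσ) (w := w) (r := y)
    (Z := Z.toFinite.toFinset) ⟨z₀, by simpa using hz₀⟩ (fun z hz => by
      rw [area_neg, ← area_swap_left]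
      exact (hpos z (by simpa using hz)).2.2)
  simp only [Set.Finite.mem_toFinset] at hu hlast
  have hlast' : ∀ z ∈ Z, z ≠ u → area σ w u z < 0 := fun z hz hne => by
    have := hlast z hz hne
    rw [area_neg] at this; linarith
  have huT : u ∈ tri w x y := ((memZ u).1 hu).1
  have huw : u ≠ w := ((memZ u).1 hu).2.1
  have hux : u ≠ x := ((memZ u).1 hu).2.2.1
  have huy : u ≠ y := ((memZ u).1 hu).2.2.2
  have hupre := h.disj_pre u huT
  have hupost : u ∉ post := h.disj_tail u huT
  have wuy : 0 < area σ w u y := by rw [area_rotate σ y w u]; exact (hpos u hu).2.2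
  have wux : area σ w u x < 0 := by rw [area_swap_right]; linarith [(hpos u hu).1]
  have xyw : area σ x y w = area σ w x y := area_rotate ..
  have xyu : area σ x y u < area σ x y w := by
    have := area_add σ (w : Plane) x y u
    linarith [hpos u hu]
  have xyu' := (hpos u hu).2.1
  have hZT : ∀ v ∈ Z, v ∈ tri w x y := fun v hv => ((memZ v).1 hv).1
  -- move all points but `y` to `u`
  set π₁ : S → S := fun v => if v ∈ Z then u else π v with hπ₁
  have hπ₁Z : ∀ z ∈ Z, π₁ z = u := fun z hz => by simp only [hπ₁]; rw [if_pos hz]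
  have hπ₁' : ∀ z, z ∉ Z → π₁ z = π z := fun z hz => by simp only [hπ₁]; rw [if_neg hz]
  have hyZ : y ∉ Z := by simp [memZ]
  have hctx1 : Ctx {w, x} (tri w x y) pre w (x :: post) π₁ :=
    h.congr fun v hv _ _ => hπ₁' v fun h => hv (hZT v h)
  have hleA : ∀ q ∈ ({w, x} : Set S) ∪ Z, area σ w u q ≤ 0 := by
    rintro q ((rfl | rfl) | hq)
    · simp
    · exact wux.le
    · rcases eq_or_ne q u with rfl | hne
      exacts [by simp, (hlast' q hq hne).le]
  have hsubA : ({w, x} : Set S) ∪ Z ⊆ tri w x y := by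
    rintro q ((rfl | rfl) | hq)
    exacts [left_mem_tri _ _ _, mid_mem_tri _ _ _, hZT q hq]
  have connA : Conn (catG (pre ++ w :: x :: post) π) (catG (pre ++ w :: u :: x :: post) π₁) := by
    refine ih Z hcardZ σ pre w x post π π₁ u hσ (fun z hz => (hpos z hz).1) ?_
      (fun z hz => hπ z (hZT z hz) ((memZ z).1 hz).2.1 ((memZ z).1 hz).2.2.1) hu
      (fun v hv _ _ => hπ₁' v fun h => hv (Or.inr h)) (fun z hz _ => hπ₁Z z hz)
    refine Ctx.of_clean (mid := []) (h.isCode_star hstar) (h.plane_star hS hstar) ?_ ?_ (by simp)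
      (by simp) (fun v hv => h.disj_pre v (hsubA hv)) (fun v hv => h.disj_tail v (hsubA hv))
      (by simp) (by simp)
    · refine h.clean_sub (mid := []) hsubA (fun o ho _ => ho) ?_
      rintro a b (hab | ⟨ha, ha', rfl⟩) hne c hc hc'
      · simp at hab
        exact absurd (by rw [hab.1, hab.2]; simp) hne
      · simp at ha'
        rcases casesT a ha with rfl | rfl | rfl | haZ
        · simp at ha'
        · simp at ha'
        · rw [hπy, Set.pair_comm] at hc
          exact ⟨w, by simp, segment_meet_of_le (σ := σ) (c := 0) (a := w) (b := u) (by simp) wuy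
            hleA hc hc'⟩
        · rw [hπ a ha ha'.1 ha'.2] at hne
          exact absurd ⟨Or.inr haZ, by simp⟩ hne
    · refine h.full.sub hsubA ?_
      intro q hq hq'
      rcases casesT q hq with rfl | rfl | rfl | hqZ
      · simp
      · simp
      · linarith [hull_area_le hleA hq']
      · exact Or.inr hqZ
  -- move `y`
  have hloc1 : LocalSpine (tri w x y) w [u] (x :: post) π₁ := by
    refine ⟨by simpa using huT, ?_, ?_⟩
    · simp [hwx, huw.symm, hux]
    · intro v hv hv'
      simp at hv' ⊢
      rcases casesT v hv with rfl | rfl | rfl | hvZ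
      · simp at hv'
      · simp at hv'
      · rw [hπ₁' v hyZ, hπy]; simp
      · simp [hπ₁Z v hvZ]
  have hcode1 := hctx1.isCode hloc1
  set π₂ : S → S := fun v => if v = y then u else π₁ v with hπ₂
  have hπ₂y : π₂ y = u := by simp [hπ₂]
  have hπ₂' : ∀ v, v ≠ y → π₂ v = π₁ v := fun v hv => by simp only [hπ₂]; rw [if_neg hv]
  have hπ₂Z : ∀ v ∈ Z, π₂ v = u := fun v hv => by
    rw [hπ₂' v fun e => hyZ (e ▸ hv), hπ₁Z v hv]
  have hgeB : ∀ q ∈ ({w, u, y} : Set S), 0 ≤ area σ w u q := by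
    rintro q (rfl | rfl | rfl)
    exacts [by simp, by simp, wuy.le]
  have hsubB : ({w, u, y} : Set S) ⊆ tri w x y :=
    triple_subset (left_mem_tri _ _ _) huT (right_mem_tri _ _ _)
  have hfullB : Full ({w, u, y} : Set S) := by
    refine h.full.sub hsubB ?_
    intro q hq hq'
    rcases casesT q hq with rfl | rfl | rfl | hqZ
    · simp
    · linarith [hull_area_ge hgeB hq']
    · simp
    · by_contra hne
      have hqu : q ≠ u := by rintro rfl; simp at hne
      linarith [hull_area_ge hgeB hq', hlast' q hqZ hqu]
  have hxB : (x : Plane) ∉ hull {w, u, y} := fun hx => by linarith [hull_area_ge hgeB hx]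
  have connB : Conn (catG (pre ++ w :: u :: x :: post) π₁) (catG (pre ++ w :: u :: x :: post) π₂) := by
    refine conn_leaf_move hS hcode1 (hcode1.adj_of_consec ?_) (by simp) (by simp) (y := y)
      (w := w) (x := u) ?_ (by rw [hπ₁' y hyZ, hπy]) hπ₂y hπ₂' connA.plane_right hfullB ?_
    · rw [consec_spine]; simp
    · simp only [List.mem_append, List.mem_cons, not_or] at hyl ⊢
      simp [hyl, huy.symm]
    · refine hctx1.clean_sub (mid := [u]) hsubB ?_ ?_
      · rintro o (rfl | rfl) ho
        exacts [by simp, absurd ho hxB]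
      · rintro a b (hab | ⟨ha, ha', rfl⟩) hne c hc hc'
        · simp at hab
          rcases hab with ⟨rfl, rfl⟩ | ⟨rfl, rfl⟩
          · simp at hne
          · exact ⟨a, by simp, segment_meet_of_ge (by simp) wux hgeB hc hc'⟩
        · simp at ha'
          rcases casesT a ha with rfl | rfl | rfl | haZ
          · simp at ha'
          · simp at ha'
          · rw [hπ₁' a hyZ, hπy] at hne
            simp at hne
          · rw [hπ₁Z a haZ, Set.pair_comm] at hc
            exact ⟨u, by simp, segment_meet_of_ge (by simp) (hlast' a haZ ha'.2.1) hgeB hc hc'⟩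
  -- insert `y` between `u` and `x`
  have hctx2 : Ctx {w, x} (tri w x y) pre w (x :: post) π₂ :=
    hctx1.congr fun v hv _ _ => hπ₂' v fun h => hv (h ▸ right_mem_tri _ _ _)
  have hloc2 : LocalSpine (tri w x y) w [u] (x :: post) π₂ := by
    refine ⟨by simpa using huT, hloc1.nodup, ?_⟩
    intro v hv hv'
    simp at hv' ⊢
    rcases casesT v hv with rfl | rfl | rfl | hvZ
    · simp at hv'
    · simp at hv'
    · simp [hπ₂y]
    · simp [hπ₂Z v hvZ]
  have hsubC : tri u x y ⊆ tri w x y :=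
    tri_subset (full_tri _ _ _) huT (mid_mem_tri _ _ _) (right_mem_tri _ _ _)
  have hwC : (w : Plane) ∉ hull {u, x, y} := fun hw => by
    have : area σ x y w ≤ area σ x y u := by
      refine hull_area_le (Q := {u, x, y}) ?_ hw
      rintro q (rfl | rfl | rfl)
      exacts [le_rfl, by simpa using xyu'.le, by simpa using xyu'.le]
    linarith
  have uxy : 0 < area σ u x y := by rw [← area_rotate]; exact xyu'
  -- If `z` were not strictly beyond the line `ux`, then, lying outside of the triangle `uxy`, it
  -- would be beyond the line `uy`. The signs then contradict the Plücker relation at `u`. So the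
  -- edge `uz` leaves the triangle at `u`.
  have hux_neg : ∀ z ∈ Z, z ≠ u → (z : Plane) ∉ hull {u, x, y} → area σ u x z < 0 := by
    intro z hz hzu hzC
    by_contra! hge
    have hyu : area σ y u z < 0 := by
      by_contra! hge'
      exact hzC (mem_hull_triple uxy hge (hpos z hz).2.1.le hge')
    have key := area_pluecker σ (u : Plane) x w z y
    have e1 : area σ u w y < 0 := by rw [area_swap_left]; linarith
    have e2 : area σ u x w < 0 := by rw [area_rotate σ w u x]; exact wux
    have e3 : area σ u z y < 0 := by rw [area_rotate σ y u z]; exact hyu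
    have e4 : 0 < area σ u w z := by rw [area_swap_left]; linarith [hlast' z hz hzu]
    linarith [mul_pos_of_neg_of_neg e2 e3, mul_pos uxy e4, mul_nonpos_iff.2 (Or.inl ⟨hge, e1.le⟩)]
  -- The smaller triangle has lost at least `w`, which makes the induction hypothesis applicable.
  have hCcard : (tri u x y).ncard < (tri w x y).ncard :=
    Set.ncard_lt_ncard ⟨hsubC, fun h' => hwC (h' (left_mem_tri _ _ _))⟩
  have connC : Conn (catG (pre ++ w :: u :: x :: post) π₂)
      (catG (pre ++ w :: u :: y :: x :: post) π₂) := by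
    have e : (pre ++ [w]) ++ u :: ([] ++ x :: post) = pre ++ w :: ([u] ++ x :: post) := by simp
    have := ihF u x y hCcard (pre ++ [w]) post π₂ huy hxy ?_ ?_
    · simpa using this
    · refine Ctx.of_clean (mid := []) (e ▸ hctx2.isCode hloc2) (e ▸ connB.plane_right) ?_
        (full_tri _ _ _) (left_mem_tri _ _ _) (by simpa using mid_mem_tri _ _ _) ?_
        (fun v hv => h.disj_tail v (hsubC hv)) (by simp) (by simp)
      · rw [e]
        refine hctx2.clean_sub hsubC ?_ ?_
        · rintro o (rfl | rfl) ho
          · rw [hull_tri] at ho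
            exact absurd ho hwC
          · simp
        · rintro a b (hab | ⟨ha, ha', rfl⟩) hne c hc hc'
          · rw [hull_tri] at hc'
            simp at hab
            rcases hab with ⟨rfl, rfl⟩ | ⟨rfl, rfl⟩
            · rw [Set.pair_comm] at hc
              refine ⟨b, by simp, segment_meet_of_le (σ := σ) (c := area σ x y b) (a := x) (b := y)
                le_rfl xyu ?_ hc hc'⟩
              rintro q (rfl | rfl | rfl)
              exacts [le_rfl, by simpa using xyu'.le, by simpa using xyu'.le]
            · exact absurd ⟨left_mem_tri _ _ _, mid_mem_tri _ _ _⟩ hne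
          · simp at ha'
            rcases casesT a ha with rfl | rfl | rfl | haZ
            · simp at ha'
            · simp at ha'
            · rw [hπ₂y] at hne
              exact absurd ⟨right_mem_tri _ _ _, left_mem_tri _ _ _⟩ hne
            · rw [hπ₂Z a haZ, Set.pair_comm] at hc
              rw [hπ₂Z a haZ] at hne
              rw [hull_tri] at hc'
              refine ⟨u, by simp, segment_meet_of_ge (σ := σ) (c := 0) (a := u) (b := x) (by simp)
                (hux_neg a haZ ha'.2.1 fun h => hne ⟨h, left_mem_tri _ _ _⟩) ?_ hc hc'⟩
              rintro q (rfl | rfl | rfl)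
              exacts [by simp, by simp, uxy.le]
      · intro v hv
        simp only [List.mem_append, List.mem_singleton, not_or]
        refine ⟨h.disj_pre v (hsubC hv), ?_⟩
        rintro rfl
        exact hwC hv
    · intro v hv h1 h2
      rcases casesT v (hsubC hv) with rfl | rfl | rfl | hvZ
      · exact absurd hv hwC
      · exact absurd rfl h2
      · exact hπ₂y
      · exact hπ₂Z v hvZ
  -- move the other points back
  have hsubD : ({w, u} : Set S) ∪ (Z \ {u}) ⊆ tri w x y := by
    rintro q ((rfl | rfl) | hq)
    exacts [left_mem_tri _ _ _, huT, hZT q hq.1]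
  have hposD : ∀ q ∈ ({w, u} : Set S) ∪ (Z \ {u}), 0 < area σ x y q := by
    rintro q ((rfl | rfl) | hq)
    exacts [by linarith, xyu', (hpos q hq.1).2.1]
  have hleD : ∀ q ∈ ({w, u} : Set S) ∪ (Z \ {u}), area σ w u q ≤ 0 := by
    rintro q ((rfl | rfl) | hq)
    exacts [by simp, by simp, (hlast' q hq.1 hq.2).le]
  have hxD : (x : Plane) ∉ hull (({w, u} : Set S) ∪ (Z \ {u})) := fun hx => by
    simpa using hull_area_gt hposD hx
  have hyD : (y : Plane) ∉ hull (({w, u} : Set S) ∪ (Z \ {u})) := fun hx => by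
    simpa using hull_area_gt hposD hx
  have hloc3 : ∀ π₃ : S → S, (∀ v ∈ Z, v ≠ u → π₃ v = u ∨ π₃ v = w) →
      LocalSpine (tri w x y) w [u, y] (x :: post) π₃ := by
    intro π₃ hπ₃
    refine ⟨?_, ?_, ?_⟩
    · intro v hv
      simp at hv
      rcases hv with rfl | rfl
      exacts [huT, right_mem_tri _ _ _]
    · simp [hwx, huw.symm, hux, hwy, huy, hxy.symm]
    · intro v hv hv'
      simp at hv' ⊢
      rcases casesT v hv with rfl | rfl | rfl | hvZ
      · simp at hv'
      · simp at hv'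
      · simp at hv'
      · have := hπ₃ v hvZ hv'.2.1
        tauto
  have connD : Conn (catG (pre ++ w :: u :: y :: x :: post) π)
      (catG (pre ++ w :: u :: y :: x :: post) π₂) := by
    refine starShift_of_starSplit hS (ih (Z \ {u})
      (by have := Set.ncard_le_ncard (s := Z \ {u}) (t := Z) Set.sdiff_subset; omega)) (-σ) pre w u (y :: x :: post) π π₂
      (neg_ne_zero.2 hσ) (fun z hz => hlast z hz.1 hz.2) ?_
      (fun z hz => hπ z (hZT z hz.1) ((memZ z).1 hz.1).2.1 ((memZ z).1 hz.1).2.2.1) ?_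
      (fun z hz => hπ₂Z z hz.1)
    · refine Ctx.congr (π := π₂) (Ctx.of_clean (mid := [])
        (hctx2.isCode (hloc3 π₂ fun v hv _ => Or.inl (hπ₂Z v hv))) connC.plane_right ?_ ?_ (by simp)
        (by simp) (fun v hv => h.disj_pre v (hsubD hv)) ?_ (by simp) (by simp)) ?_
      · refine hctx2.clean_sub (mid := [u, y]) hsubD ?_ ?_
        · rintro o (rfl | rfl) ho
          exacts [by simp, absurd ho hxD]
        · rintro a b (hab | ⟨ha, ha', rfl⟩) hne c hc hc'
          · simp at hab
            rcases hab with ⟨rfl, rfl⟩ | ⟨rfl, rfl⟩ | ⟨rfl, rfl⟩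
            · simp at hne
            · exact ⟨a, by simp, segment_meet_of_le (σ := σ) (c := 0) (a := w) (b := a) (by simp)
                wuy hleD hc hc'⟩
            · have h1 := hull_area_gt hposD hc'
              have h2 : area σ b a c ≤ 0 := by
                refine hull_area_le ?_ hc
                rintro q (rfl | rfl) <;> simp
              linarith
          · simp at ha'
            rcases casesT a ha with rfl | rfl | rfl | haZ
            · simp at ha'
            · simp at ha'
            · simp at ha'
            · rw [hπ₂Z a haZ] at hne
              exact absurd ⟨Or.inr ⟨haZ, ha'.2.1⟩, by simp⟩ hne
      · refine h.full.sub hsubD ?_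
        intro q hq hq'
        rcases casesT q hq with rfl | rfl | rfl | hqZ
        · simp
        · exact absurd hq' hxD
        · exact absurd hq' hyD
        · by_cases e : q = u
          · simp [e]
          · exact Or.inr ⟨hqZ, e⟩
      · intro v hv
        simp only [List.drop_succ_cons, List.drop_zero, List.mem_cons, not_or]
        refine ⟨?_, ?_, h.disj_tail v (hsubD hv)⟩
        · rintro rfl; exact hyD (mem_hull hv)
        · rintro rfl; exact hxD (mem_hull hv)
      · intro v hv _ h2
        simp at h2
        rw [hπ₂' v h2.2.1, hπ₁' v]
        exact fun hvZ => hv (Or.inr ⟨hvZ, h2.1⟩)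
    · intro v hv _ h2
      simp at h2
      rw [hπ₂' v h2.2.1, hπ₁' v]
      exact fun hvZ => hv (Or.inr ⟨hvZ, h2.1⟩)
  -- remove `u` from the spine
  have hloc4 := hloc3 π fun v hv _ =>
    Or.inr (hπ v (hZT v hv) ((memZ v).1 hv).2.1 ((memZ v).1 hv).2.2.1)
  have hcode4 := h.isCode hloc4
  have connE : Conn (catG (pre ++ w :: u :: y :: x :: post) π)
      (catG (pre ++ w :: y :: x :: post) π) := by
    have e : ({w, y, u} : Set S) = {w, u, y} := by ext; simp; tauto
    refine conn_remove hS hcode4 (hπ u huT huw hux) ?_ connD.plane_left (e ▸ hfullB) ?_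
    · intro v hv e
      simp only [List.mem_append, List.mem_cons, not_or] at hv
      by_cases hvT : v ∈ tri w x y
      · rw [hπ v hvT hv.2.1 hv.2.2.2.2.1] at e
        exact huw e.symm
      · have := h.out v hvT hv.1 (by simp [hv])
        rw [e] at this
        simp [hupre, hupost, huw, hux] at this
    · rw [e]
      refine h.clean_sub (mid := [u, y]) hsubB ?_ ?_
      · rintro o (rfl | rfl) ho
        exacts [by simp, absurd ho hxB]
      · rintro a b (hab | ⟨ha, ha', rfl⟩) hne c hc hc'
        · simp at hab
          rcases hab with ⟨rfl, rfl⟩ | ⟨rfl, rfl⟩ | ⟨rfl, rfl⟩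
          · simp at hne
          · simp at hne
          · refine ⟨a, by simp, hull_face (σ := σ) (c := 0) (a := b) (b := a) (by simp) ?_ hc' ?_⟩
            · rintro q (rfl | rfl | rfl) hq
              exacts [by linarith, xyu', absurd rfl hq]
            · refine hull_area_le ?_ hc
              rintro q (rfl | rfl) <;> simp
        · simp at ha'
          rcases casesT a ha with rfl | rfl | rfl | haZ
          · simp at ha'
          · simp at ha'
          · simp at ha'
          · rw [hπ a ha ha'.1 ha'.2.2.2, Set.pair_comm] at hc
            exact ⟨w, by simp, segment_meet_of_ge (σ := σ) (c := 0) (a := w) (b := u) (by simp)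
              (hlast' a haZ ha'.2.1) hgeB hc hc'⟩
  exact connA.trans (connB.trans (connC.trans (connD.symm.trans connE)))

/-- A split of `Z` uses triangles with at most |Z| + 1 points, and a triangle with t points uses
splits of sets with at most t - 2 points. With the bounds n and n + 2 the split is advanced first
and the triangle second. For n = 0 nothing is claimed, since `w` and `y` are two points of the
triangle. -/
lemma starSplit_and_triInsert (hS : GeneralPosition S) (n : ℕ) :
    (∀ Z : Set S, Z.ncard < n → StarSplit Z) ∧
      ∀ w x y : S, (tri w x y).ncard < n + 2 → TriInsert w x y := by
  induction n with
  | zero =>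
    refine ⟨by simp, fun w x y hc pre post π hwy hxy h _ => ?_⟩
    have hsub : ({w, y} : Set S) ⊆ tri w x y := by
      rintro v (rfl | rfl)
      exacts [left_mem_tri _ _ _, right_mem_tri _ _ _]
    have := Set.ncard_le_ncard hsub
    rw [Set.ncard_pair hwy] at this
    omega
  | succ n ih =>
    have h1 : ∀ Z : Set S, Z.ncard < n + 1 → StarSplit Z := fun Z hZ =>
      starSplit_of_lt hS (fun Z' hZ' => ih.1 Z' (by omega)) fun w x y hc => ih.2 w x y (by omega)
    refine ⟨h1, fun w x y hc => ?_⟩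
    refine triInsert_of_lt hS (fun Z hZ => h1 Z (by omega)) fun w' x' y' hc' => ih.2 w' x' y' (by omega)

theorem starSplit (hS : GeneralPosition S) (Z : Set S) : StarSplit Z :=
  (starSplit_and_triInsert hS _).1 Z (Nat.lt_succ_self _)

theorem starShift (hS : GeneralPosition S) (Z : Set S) : StarShift Z :=
  starShift_of_starSplit hS (starSplit hS Z)

theorem triInsert (hS : GeneralPosition S) (w x y : S) : TriInsert w x y :=
  (starSplit_and_triInsert hS (tri w x y).ncard).2 w x y (by omega)

/-! ### Leaves at the end of the spine. -/

/-- Provides a second exit `p`, as the moves across a spine edge require. A tail with a single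
vertex contains no consecutive pair, so no outer edge is added. -/
lemma Ctx.append {O Q : Set S} {pre : List S} {w p : S} {π : S → S} (h : Ctx O Q pre w [] π)
    (hp : p ∈ Q) (hpw : p ≠ w) (O' : Set S) (hO : O ⊆ O') : Ctx O' Q pre w [p] π := by
  have e : ∀ u v, OuterEdge Q pre w [p] π u v → OuterEdge Q pre w [] π u v := by
    rintro u v (h1 | h1 | ⟨h1, h2, h3, rfl⟩)
    · exact Or.inl h1
    · exact h1.elim
    · exact Or.inr (Or.inr ⟨h1, h2, by simp, rfl⟩)
  refine ⟨?_, h.mem, by simpa using hp, h.disj_pre, by simp, ?_, h.full, ?_, ?_⟩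
  · have h1 := h.nodup
    have h2 := h.disj_pre p hp
    rw [show pre ++ [w, p] = (pre ++ [w]) ++ [p] by simp]
    refine List.nodup_append.2 ⟨h1, by simp, ?_⟩
    intro a ha b hb
    simp at ha hb
    subst hb
    rintro rfl
    exact ha.elim h2 hpw
  · intro v h1 h2 h3
    have := h.out v h1 h2 (by simp)
    simp only [List.mem_append, List.mem_cons] at this ⊢
    tauto
  · intro u v huv x hx hx'
    obtain ⟨o, ho, hxo⟩ := h.clean u v (e u v huv) x hx hx'
    exact ⟨o, hO ho, hxo⟩
  · exact fun a b c d h1 h2 => h.plane a b c d (e _ _ h1) (e _ _ h2)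

/-- At the end of the spine, the leaves of the last vertex `x` can be moved to one of them. -/
theorem conn_star_end (hS : GeneralPosition S) {σ : ℝ} (hσ : σ ≠ 0) {Q : Set S} {pre : List S}
    {x q : S} {r : Plane} {π π' : S → S} (h : Ctx {x} Q pre x [] π)
    (hr : ∀ z ∈ Q, z ≠ x → 0 < area σ x r z) (hπ : ∀ z ∈ Q, z ≠ x → π z = x) (hq : q ∈ Q)
    (hqx : q ≠ x) (hagree : ∀ v, v ∉ Q → v ∉ pre → π' v = π v)
    (hπ' : ∀ z ∈ Q, z ≠ x → z ≠ q → π' z = q) :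
    Conn (catG (pre ++ [x]) π) (catG (pre ++ [x, q]) π') := by
  classical
  obtain ⟨p, hp, hfirst⟩ := exists_first hS hσ (w := x) (r := r)
    (Z := (Q \ {x}).toFinite.toFinset) ⟨q, by simpa using ⟨hq, hqx⟩⟩
    (fun z hz => by simp at hz; exact hr z hz.1 hz.2)
  simp only [Set.Finite.mem_toFinset, Set.mem_sdiff, Set.mem_singleton_iff, and_imp] at hp hfirst
  have hQ : ({x, p} : Set S) ∪ (Q \ {x, p}) = Q := by
    rw [Set.union_sdiff_cancel]
    rintro v (rfl | rfl)
    exacts [h.mem, hp.1]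
  have h1 : Ctx {x, p} ({x, p} ∪ (Q \ {x, p})) pre x [p] π := by
    rw [hQ]; exact h.append hp.1 hp.2 _ (by simp)
  -- The first leaf `p` in the angular order counts as the last spine vertex without changing the
  -- graph. All other leaves then lie on one side of the edge `xp`.
  have e1 : catG (pre ++ [x, p]) π = catG (pre ++ [x]) π := by
    refine catG_append ?_ (hπ p hp.1 hp.2)
    simpa using ⟨h.disj_pre p hp.1, hp.2⟩
  rw [← e1]
  have hside : ∀ z ∈ Q \ {x, p}, 0 < area σ x p z := by
    rintro z ⟨hz, hz'⟩
    simp at hz'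
    exact hfirst z hz hz'.1 hz'.2
  have hπ1 : ∀ z ∈ Q \ {x, p}, π z = x := by
    rintro z ⟨hz, hz'⟩
    simp at hz'
    exact hπ z hz hz'.1
  have hag : ∀ v, v ∉ ({x, p} : Set S) ∪ (Q \ {x, p}) → v ∉ pre → v ∉ [p] → π' v = π v := by
    intro v hv h1 _
    rw [hQ] at hv
    exact hagree v hv h1
  by_cases hqp : q = p
  · subst hqp
    refine starShift hS _ σ pre x q [] π π' hσ hside h1 hπ1 hag ?_
    rintro z ⟨hz, hz'⟩
    simp at hz'
    exact hπ' z hz hz'.1 hz'.2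
  · have := starSplit hS (Q \ {x, p}) σ pre x p [] π π' q hσ hside h1 hπ1 (by simp [hq, hqx, hqp])
      hag (by
        rintro z ⟨hz, hz'⟩ hzq
        simp at hz'
        exact hπ' z hz hz'.1 hzq)
    -- After the split `p` is a leaf of `q`, so it may be dropped from the end of the spine.
    rwa [show pre ++ x :: q :: [p] = (pre ++ [x]) ++ [q, p] by simp,
      catG_append (l := pre ++ [x]) (x := q) (y := p),
      show pre ++ [x] ++ [q] = pre ++ [x, q] by simp] at this
    · simp only [List.mem_append, List.mem_singleton, not_or]
      exact ⟨⟨h.disj_pre p hp.1, hp.2⟩, fun e => hqp e.symm⟩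
    · exact hπ' p hp.1 hp.2 fun e => hqp e.symm

/-! ### Fans: sweeping the last star around its predecessor. -/

/-- A caterpillar which ends in `w, x`, such that the points of `Z` outside of `A` are leaves of `w`
and the other points of `A` are leaves of `x`. -/
structure Fan (σ : ℝ) (r : Plane) (pre : List S) (w : S) (Z A : Set S) (x : S) (π : S → S) :
    Prop where
  ne_zero : σ ≠ 0
  pos : ∀ z ∈ Z, 0 < area σ w r z
  ctx : Ctx {w} ({w} ∪ Z) pre w [] π
  sub : A ⊆ Z
  mem : x ∈ A
  leaf_x : ∀ v ∈ A, v ≠ x → π v = x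
  leaf_w : ∀ v ∈ Z, v ∉ A → π v = w
  miss : ∀ y ∈ Z, y ∉ A → ∀ p ∈ hull {w, y}, p ∉ hull A
  plane : IsPlaneGraph (catG (pre ++ [w, x]) π)

namespace Fan
variable {σ : ℝ} {r : Plane} {pre : List S} {w x : S} {Z A : Set S} {π π' : S → S}

lemma not_mem (h : Fan σ r pre w Z A x π) : w ∉ Z := fun hw => by simpa using h.pos w hw

lemma ne (h : Fan σ r pre w Z A x π) {z : S} (hz : z ∈ Z) : z ≠ w := fun e => h.not_mem (e ▸ hz)

lemma not_mem_hull (h : Fan σ r pre w Z A x π) : (w : Plane) ∉ hull A := fun hw => by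
  simpa using hull_area_gt (fun q hq => h.pos q (h.sub hq)) hw

lemma full (h : Fan σ r pre w Z A x π) : Full A := by
  intro v hv
  by_contra hvA
  rcases h.ctx.full v (hull_mono (h.sub.trans Set.subset_union_right) hv) with rfl | hvZ
  · exact h.not_mem_hull hv
  · exact h.miss v hvZ hvA v (mem_hull (by simp)) hv

lemma localSpine (h : Fan σ r pre w Z A x π) : LocalSpine ({w} ∪ Z) w [x] [] π := by
  have hx := h.ne (h.sub h.mem)
  refine ⟨by simpa using Or.inr (h.sub h.mem), by simpa using hx.symm, ?_⟩
  intro v hv hv'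
  simp at hv' ⊢
  have hvZ : v ∈ Z := hv.resolve_left hv'.1
  by_cases hvA : v ∈ A
  · exact Or.inr (h.leaf_x v hvA hv'.2)
  · exact Or.inl (h.leaf_w v hvZ hvA)

lemma isCode (h : Fan σ r pre w Z A x π) : IsCode (pre ++ [w, x]) π := h.ctx.isCode h.localSpine

/-- The part of `A` on one side of the line `wx` is an independent part of the caterpillar. -/
lemma ctx_part (h : Fan σ r pre w Z A x π) {τ : ℝ} {B : Set S}
    (hB : B ⊆ A) (hx : x ∈ B) (hpos : ∀ z ∈ B, z ≠ x → 0 < area τ w x z)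
    (hneg : ∀ z ∈ A, z ∉ B → area τ w x z < 0) : Ctx {x} B (pre ++ [w]) x [] π := by
  have e : pre ++ [w] ++ x :: ([] ++ []) = pre ++ w :: ([x] ++ []) := by simp
  have hge : ∀ z ∈ B, 0 ≤ area τ w x z := fun z hz => by
    rcases eq_or_ne z x with rfl | hzx
    exacts [by simp, (hpos z hz hzx).le]
  refine Ctx.of_clean (mid := []) (e ▸ h.isCode) (e ▸ h.plane) ?_ ?_ hx (by simp) ?_ (by simp)
    (by simp) (by simp)
  · rw [e]
    refine h.ctx.clean_sub ((hB.trans h.sub).trans Set.subset_union_right) ?_ ?_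
    · rintro o rfl ho
      exact absurd (hull_mono hB ho) h.not_mem_hull
    · rintro u v (huv | ⟨hu, hu', rfl⟩) hne c hc hc'
      · simp at huv
        obtain ⟨rfl, rfl⟩ := huv
        refine ⟨v, by simp, hull_face (σ := τ) (c := 0) (a := u) (b := v) (by simp) ?_ hc' ?_⟩
        · exact fun q hq hq' => hpos q hq fun e => hq' (e ▸ rfl)
        · refine hull_area_le ?_ hc
          rintro q (rfl | rfl) <;> simp
      · simp at hu'
        have huZ : u ∈ Z := hu.resolve_left hu'.1
        by_cases huA : u ∈ A
        · rw [h.leaf_x u huA hu'.2] at hc hne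
          rw [Set.pair_comm] at hc
          exact ⟨x, by simp, segment_meet_of_ge (σ := τ) (c := 0) (a := w) (b := x) (by simp)
            (hneg u huA fun h => hne ⟨h, hx⟩) hge hc hc'⟩
        · rw [h.leaf_w u huZ huA, Set.pair_comm] at hc
          exact absurd (hull_mono hB hc') (h.miss u huZ huA c hc)
  · refine h.full.sub hB fun q hq hq' => ?_
    by_contra hqB
    linarith [hull_area_ge hge hq', hneg q hq hqB]
  · intro v hv
    have hvZ := h.sub (hB hv)
    simp only [List.mem_append, List.mem_singleton, not_or]
    exact ⟨h.ctx.disj_pre v (Or.inr hvZ), h.ne hvZ⟩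

/-- The first point around `w` is irrelevant if it is a leaf of `w`. -/
lemma drop (h : Fan σ r pre w Z A x π) {p : S} (hp : p ∈ Z) (hpA : p ∉ A)
    (hfirst : ∀ z ∈ Z, z ≠ p → 0 < area σ w p z) : Fan σ r pre w (Z \ {p}) A x π := by
  have hsub : ({w} : Set S) ∪ (Z \ {p}) ⊆ {w} ∪ Z :=
    Set.union_subset_union_right _ Set.sdiff_subset
  have hge : ∀ q ∈ ({w} : Set S) ∪ (Z \ {p}), 0 ≤ area σ w p q := by
    rintro q (rfl | hq)
    exacts [by simp, (hfirst q hq.1 hq.2).le]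
  have hpw := h.ne hp
  have hmeet : ∀ c ∈ hull {w, p}, c ∈ hull (({w} : Set S) ∪ (Z \ {p})) → c = w := by
    intro c hc hc'
    refine hull_face (σ := σ) (c := 0) (a := w) (b := p) (by simp) ?_ hc' ?_
    · rintro q (rfl | hq) hq'
      exacts [absurd rfl hq', hfirst q hq.1 hq.2]
    · refine hull_area_le ?_ hc
      rintro q (rfl | rfl) <;> simp
  have hxp : x ≠ p := fun e => hpA (e ▸ h.mem)
  refine ⟨h.ne_zero, fun z hz => h.pos z hz.1, ?_, fun a ha => ⟨h.sub ha, fun e => hpA (e ▸ ha)⟩,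
    h.mem, h.leaf_x, fun v hv => h.leaf_w v hv.1, fun y hy => h.miss y hy.1, h.plane⟩
  refine Ctx.of_clean (mid := [x]) h.isCode h.plane ?_ ?_ (by simp) (by simp)
    (fun v hv => h.ctx.disj_pre v (hsub hv)) (by simp) ?_ ?_
  · refine h.ctx.clean_sub (mid := [x]) hsub (fun o ho _ => ho) ?_
    rintro u v (huv | ⟨hu, hu', rfl⟩) hne c hc hc'
    · simp at huv
      obtain ⟨rfl, rfl⟩ := huv
      exact absurd ⟨by simp, Or.inr ⟨h.sub h.mem, hxp⟩⟩ hne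
    · simp at hu'
      have huZ : u ∈ Z := hu.resolve_left hu'.1
      by_cases hup : u = p
      · subst hup
        rw [h.leaf_w u huZ hpA, Set.pair_comm] at hc
        exact ⟨w, by simp, hmeet c hc hc'⟩
      · exfalso
        by_cases huA : u ∈ A
        · rw [h.leaf_x u huA hu'.2] at hne
          exact hne ⟨Or.inr ⟨huZ, hup⟩, Or.inr ⟨h.sub h.mem, hxp⟩⟩
        · rw [h.leaf_w u huZ huA] at hne
          exact hne ⟨Or.inr ⟨huZ, hup⟩, by simp⟩
  · refine h.ctx.full.sub hsub ?_
    rintro q (rfl | hq) hq'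
    · simp
    · by_cases hqp : q = p
      · subst hqp
        exact absurd (Subtype.ext (hmeet q (mem_hull (by simp)) hq')) hpw
      · exact Or.inr ⟨hq, hqp⟩
  · simpa using Or.inr ⟨h.sub h.mem, hxp⟩
  · intro v hv h2 _ hvx
    simp at hvx
    by_cases hvp : v = p
    · subst hvp
      rw [h.leaf_w v hp hpA] at hvx
      exact h.ne (h.sub h.mem) hvx.symm
    · have := h.ctx.out v (by
        rintro (rfl | hvZ)
        exacts [hv (by simp), hv (Or.inr ⟨hvZ, hvp⟩)]) h2 (by simp)
      rw [hvx] at this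
      simp [h.ne (h.sub h.mem), h.ctx.disj_pre x (Or.inr (h.sub h.mem))] at this

end Fan

lemma hull_face_le {σ c : ℝ} {a b x : Plane} {u : S} {Q : Set S} (hu : area σ a b u ≤ c)
    (h : ∀ q ∈ Q, q ≠ u → area σ a b q < c) (hx : x ∈ hull Q) (hc : c ≤ area σ a b x) : x = u := by
  refine hull_face (σ := -σ) (c := -c) (a := a) (b := b) ?_ ?_ hx ?_
  · rw [area_neg]; linarith
  · intro q hq hne
    rw [area_neg]; linarith [h q hq fun e => hne (e ▸ rfl)]
  · rw [area_neg]; linarith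

namespace Fan

/-- The part `B` of a fan can be transferred from `x` to the neighbour `a` in the angular order
around `w`. -/
structure Split (τ : ℝ) (w x a : S) (A B : Set S) : Prop where
  ne_zero : τ ≠ 0
  sub : B ⊆ A
  memx : x ∈ B
  mema : a ∈ B
  ne : a ≠ x
  pos : ∀ z ∈ B, z ≠ x → 0 < area τ w x z
  neg : ∀ z ∈ A, z ∉ B → area τ w x z < 0
  first : ∀ z ∈ B, z ≠ x → z ≠ a → 0 < area τ w a z
  neg' : ∀ z ∈ A, z ∉ B → area τ w a z < 0

/-- The leaves of `x` in `B` become leaves of `a`. -/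
structure Moved (x a : S) (B : Set S) (π π₁ : S → S) : Prop where
  moved : ∀ z ∈ B, z ≠ x → z ≠ a → π₁ z = a
  rest : ∀ z, z ∉ B → π₁ z = π z

namespace Split
variable {σ τ : ℝ} {r : Plane} {pre : List S} {w x a : S} {Z A B : Set S} {π π₁ π₂ : S → S}

lemma tri_pos (s : Split τ w x a A B) : 0 < area τ w x a := s.pos a s.mema s.ne

lemma tri_sub (h : Fan σ r pre w Z A x π) (s : Split τ w x a A B) : tri w x a ⊆ {w} ∪ Z :=
  tri_subset h.ctx.full (by simp) (Or.inr (h.sub h.mem)) (Or.inr (h.sub (s.sub s.mema)))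

/-- Around `w` the point `a` is next to `x` among the points of `B`, and `A \ B` lies on the other
side of the line `wx`. So the open angle from `x` to `a` contains no point of `A`, and the points
inside the triangle are leaves of `w`. -/
lemma inner (hS : GeneralPosition S) (h : Fan σ r pre w Z A x π) (s : Split τ w x a A B) {z : S}
    (hz : z ∈ tri w x a) (h1 : z ≠ w) (h2 : z ≠ x) (h3 : z ≠ a) : z ∈ Z ∧ z ∉ A := by
  have hp := area_pos_of_mem_hull_triple hS s.tri_pos hz h1 h2 h3
  refine ⟨(s.tri_sub h hz).resolve_left h1, fun hA => ?_⟩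
  by_cases hB : z ∈ B
  · linarith [s.first z hB h2 h3, hp.2.2, area_swap_left τ (a : Plane) w z]
  · linarith [s.neg z hA hB]

lemma leaf_cases (h : Fan σ r pre w Z A x π) (_s : Split τ w x a A B) (m : Moved x a B π π₁) {u : S}
    (hu : u ∈ Z) (hux : u ≠ x) (hua : u ≠ a) :
    (u ∈ B ∧ π₁ u = a) ∨ (u ∈ A ∧ u ∉ B ∧ π₁ u = x) ∨ (u ∉ A ∧ π₁ u = w) := by
  by_cases hB : u ∈ B
  · exact Or.inl ⟨hB, m.moved u hB hux hua⟩
  · by_cases hA : u ∈ A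
    · exact Or.inr (Or.inl ⟨hA, hB, by rw [m.rest u hB, h.leaf_x u hA hux]⟩)
    · exact Or.inr (Or.inr ⟨hA, by rw [m.rest u hB, h.leaf_w u hu hA]⟩)

lemma leaf_inner (hS : GeneralPosition S) (h : Fan σ r pre w Z A x π) (s : Split τ w x a A B)
    (m : Moved x a B π π₁) {u : S} (hu : u ∈ tri w x a) (huw : u ≠ w) (hux : u ≠ x) (hua : u ≠ a) :
    π₁ u = w := by
  have := s.inner hS h hu huw hux hua
  rw [m.rest u fun h' => this.2 (s.sub h'), h.leaf_w u this.1 this.2]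

lemma ctx_moved (h : Fan σ r pre w Z A x π) (s : Split τ w x a A B) (m : Moved x a B π π₁) :
    Ctx {w} ({w} ∪ Z) pre w [] π₁ :=
  h.ctx.congr fun v hv _ _ => m.rest v fun h' => hv (Or.inr (h.sub (s.sub h')))

lemma localSpine (h : Fan σ r pre w Z A x π) (s : Split τ w x a A B) (m : Moved x a B π π₁)
    {mid : List S} (hmid : ∀ v ∈ mid, v ∈ Z) (hnd : mid.Nodup) (hx : x ∈ mid) (ha : a ∈ mid) :
    LocalSpine ({w} ∪ Z) w mid [] π₁ := by
  refine ⟨fun v hv => Or.inr (hmid v hv), ?_, ?_⟩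
  · simpa using ⟨fun hw => h.not_mem (hmid w hw), hnd⟩
  · intro v hv hv'
    simp at hv' ⊢
    have hvZ : v ∈ Z := hv.resolve_left hv'.1
    rcases s.leaf_cases h m hvZ (fun e => hv'.2 (e ▸ hx)) (fun e => hv'.2 (e ▸ ha)) with h | h | h
    · exact Or.inr (h.2 ▸ ha)
    · exact Or.inr (h.2.2 ▸ hx)
    · exact Or.inl h.2

/-- Leaves of `a` and of `x` are separated from the triangle by the lines `wa` and `wx`. A leaf of
`w` outside of the triangle cannot reach it past the side `xa`, because its edge misses the hull of
`A`. -/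
lemma meet (h : Fan σ r pre w Z A x π) (s : Split τ w x a A B) (m : Moved x a B π π₁) {u : S}
    (hu : u ∈ Z) (hux : u ≠ x) (hua : u ≠ a) (huT : u ∉ tri w x a) {c : Plane}
    (hc : c ∈ hull {u, π₁ u}) (hc' : c ∈ hull {w, x, a}) :
    c = w ∨ c = a ∨ (c = x ∧ ∃ z ∈ A, z ∉ B) := by
  rw [Set.pair_comm] at hc
  rcases s.leaf_cases h m hu hux hua with ⟨hB, e⟩ | ⟨hA, hB, e⟩ | ⟨hA, e⟩
  · rw [e] at hc
    refine Or.inr (Or.inl (segment_meet_of_le (σ := τ) (c := 0) (a := w) (b := a) (by simp)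
      (s.first u hB hux hua) ?_ hc hc'))
    rintro q (rfl | rfl | rfl)
    · simp
    · rw [area_swap_right]; linarith [s.tri_pos]
    · simp
  · rw [e] at hc
    refine Or.inr (Or.inr ⟨segment_meet_of_ge (σ := τ) (c := 0) (a := w) (b := x) (by simp)
      (s.neg u hA hB) ?_ hc hc', u, hA, hB⟩)
    rintro q (rfl | rfl | rfl)
    exacts [by simp, by simp, s.tri_pos.le]
  · rw [e] at hc
    refine Or.inl (segment_inter_hull (y := u) (by simp) ?_ huT ⟨hc, hc'⟩)
    intro p hp hp'
    refine h.miss u hu hA p hp (hull_mono ?_ hp')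
    rintro v (rfl | rfl)
    exacts [h.mem, s.sub s.mema]

/-- The leaves in `B` move from `x` to `a`. -/
lemma conn_left (hS : GeneralPosition S) (h : Fan σ r pre w Z A x π) (s : Split τ w x a A B)
    (m : Moved x a B π π₁) : Conn (catG (pre ++ [w, x]) π) (catG (pre ++ [w, x, a]) π₁) := by
  have := conn_star_end hS (neg_ne_zero.2 s.ne_zero) (r := w) (π' := π₁) (q := a)
    (h.ctx_part s.sub s.memx s.pos s.neg)
    (fun z hz hzx => by rw [area_neg, ← area_swap_left]; exact s.pos z hz hzx)
    (fun z hz hzx => h.leaf_x z (s.sub hz) hzx) s.mema s.ne (fun v hv _ => m.rest v hv) m.moved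
  simpa using this

/-- The leaves in `A \ B` move from `x` to `a`. -/
lemma conn_right (hS : GeneralPosition S) (h : Fan σ r pre w Z A x π) (s : Split τ w x a A B)
    (m : Moved x a B π π₁) (hA : ∀ z ∈ A, z ≠ a → π₂ z = a) (hrest : ∀ z, z ∉ A → π₂ z = π z)
    (hG : IsPlaneGraph (catG (pre ++ [w, a, x]) π₁)) :
    Conn (catG (pre ++ [w, a]) π₂) (catG (pre ++ [w, a, x]) π₁) := by
  have haA := s.sub s.mema
  set Q : Set S := {a, x} ∪ (A \ B) with hQ
  have hQA : Q ⊆ A := by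
    rintro q ((rfl | rfl) | hq)
    exacts [haA, h.mem, hq.1]
  have hneg : ∀ q ∈ Q, q ≠ a → area τ w a q < 0 := by
    rintro q ((rfl | rfl) | hq) hqa
    exacts [absurd rfl hqa, by rw [area_swap_right]; linarith [s.tri_pos], s.neg' q hq.1 hq.2]
  have hle : ∀ q ∈ Q, area τ w a q ≤ 0 := fun q hq => by
    rcases eq_or_ne q a with rfl | hqa
    exacts [by simp, (hneg q hq hqa).le]
  have e : pre ++ [w] ++ a :: ([x] ++ []) = pre ++ w :: ([a, x] ++ []) := by simp
  have hax : ([a, x] : List S).Nodup := by simpa using s.ne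
  have hctx : Ctx {a} Q (pre ++ [w]) a [] π₁ := by
    refine Ctx.of_clean (mid := [x]) (e ▸ (s.ctx_moved h m).isCode (s.localSpine h m ?_ hax
      (by simp) (by simp))) (e ▸ hG) ?_ ?_ (by simp [hQ]) (by simp) ?_ (by simp) (by simp [hQ]) ?_
    · intro v hv
      simp at hv
      rcases hv with rfl | rfl
      exacts [h.sub haA, h.sub h.mem]
    · rw [e]
      refine (s.ctx_moved h m).clean_sub ((hQA.trans h.sub).trans Set.subset_union_right) ?_ ?_
      · rintro o rfl ho
        exact absurd (hull_mono hQA ho) h.not_mem_hull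
      · rintro u v (huv | ⟨hu, hu', rfl⟩) hne c hc hc'
        · simp at huv
          rcases huv with ⟨rfl, rfl⟩ | ⟨rfl, rfl⟩
          · refine ⟨v, by simp, hull_face_le (σ := τ) (c := 0) (a := u) (b := v) (by simp) hneg hc' ?_⟩
            refine hull_area_ge ?_ hc
            rintro q (rfl | rfl) <;> simp
          · exact absurd ⟨by simp [hQ], by simp [hQ]⟩ hne
        · simp at hu'
          have huZ : u ∈ Z := hu.resolve_left hu'.1
          rcases s.leaf_cases h m huZ hu'.2.2 hu'.2.1 with ⟨hB, e⟩ | ⟨hA, hB, e⟩ | ⟨hA, e⟩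
          · rw [e, Set.pair_comm] at hc
            exact ⟨a, by simp, segment_meet_of_le (σ := τ) (c := 0) (a := w) (b := a) (by simp)
              (s.first u hB hu'.2.2 hu'.2.1) hle hc hc'⟩
          · rw [e] at hne
            exact absurd ⟨Or.inr ⟨hA, hB⟩, by simp [hQ]⟩ hne
          · rw [e, Set.pair_comm] at hc
            exact absurd (hull_mono hQA hc') (h.miss u huZ hA c hc)
    · refine h.full.sub hQA fun q hq hq' => ?_
      by_contra hqQ
      simp [hQ] at hqQ
      by_cases hB : q ∈ B
      · linarith [hull_area_le hle hq', s.first q hB hqQ.1.2 hqQ.1.1]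
      · exact hB (hqQ.2 hq)
    · intro v hv
      have hvZ := h.sub (hQA hv)
      simp only [List.mem_append, List.mem_singleton, not_or]
      exact ⟨h.ctx.disj_pre v (Or.inr hvZ), h.ne hvZ⟩
    · intro v hv h2 _ hvx
      simp at h2 hvx
      by_cases hvZ : v ∈ Z
      · simp [hQ] at hv
        rcases s.leaf_cases h m hvZ hv.1.2 hv.1.1 with ⟨hB, e⟩ | ⟨hA, hB, e⟩ | ⟨hA, e⟩
        · exact s.ne (e.symm.trans hvx)
        · exact hB (hv.2 hA)
        · exact h.ne (h.sub h.mem) (hvx.symm.trans e)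
      · have := (s.ctx_moved h m).out v (by simp [hvZ, h2.2]) h2.1 (by simp)
        rw [hvx] at this
        simp [h.ne (h.sub h.mem), h.ctx.disj_pre x (Or.inr (h.sub h.mem))] at this
  have hout : ∀ v, v ∉ Q → π₁ v = π₂ v := by
    intro v hv
    simp [hQ] at hv
    by_cases hvA : v ∈ A
    · rw [m.moved v (hv.2 hvA) hv.1.2 hv.1.1, hA v hvA hv.1.1]
    · rw [hrest v hvA, m.rest v fun h => hvA (s.sub h)]
  have := conn_star_end hS s.ne_zero (r := w) (π' := π₁) (q := x)
    (hctx.congr (π' := π₂) fun v hv _ _ => (hout v hv).symm)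
    (fun z hz hza => by rw [area_swap_left]; linarith [hneg z hz hza])
    (fun z hz hza => hA z (hQA hz) hza) (by simp [hQ]) s.ne.symm (fun v hv _ => hout v hv) (by
      rintro z ((rfl | rfl) | hz) h1 h2
      · exact absurd rfl h1
      · exact absurd rfl h2
      · rw [m.rest z hz.2, h.leaf_x z hz.1 h2])
  simpa using this

/-- The last two vertices of the spine are exchanged. -/
lemma conn_swap (hS : GeneralPosition S) (h : Fan σ r pre w Z A x π) (s : Split τ w x a A B)
    (m : Moved x a B π π₁) (hG : IsPlaneGraph (catG (pre ++ [w, x, a]) π₁)) :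
    Conn (catG (pre ++ [w, x, a]) π₁) (catG (pre ++ [w, a, x]) π₁) := by
  have hT := s.tri_sub h
  have hctx := s.ctx_moved h m
  have hxZ := h.sub h.mem
  have haZ := h.sub (s.sub s.mema)
  have hxw := h.ne hxZ
  have haw := h.ne haZ
  have htpos := s.tri_pos
  have hleaf : ∀ {u}, u ∈ ({w} : Set S) ∪ Z → u ≠ w → u ≠ x → u ≠ a → ∀ c ∈ hull {u, π₁ u},
      c ∈ hull (tri w x a) → (u ∈ tri w x a ∧ π₁ u = w) ∨ c = w ∨ c = x ∨ c = a := by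
    intro u hu h1 h2 h3 c hc hc'
    rw [hull_tri] at hc'
    by_cases huT : u ∈ tri w x a
    · exact Or.inl ⟨huT, s.leaf_inner hS h m huT h1 h2 h3⟩
    · have := s.meet h m (hu.resolve_left h1) h2 h3 huT hc hc'
      tauto
  have hlxa : LocalSpine ({w} ∪ Z) w [x, a] [] π₁ :=
    s.localSpine h m (by simpa using ⟨hxZ, haZ⟩) (by simpa using s.ne.symm) (by simp) (by simp)
  -- If the triangle is empty, one slide suffices.
  by_cases hex : ∃ y ∈ tri w x a, y ≠ w ∧ y ≠ x ∧ y ≠ a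
  swap
  · push Not at hex
    have hsub : ({w, x, a} : Set S) ⊆ tri w x a :=
      triple_subset (left_mem_tri _ _ _) (mid_mem_tri _ _ _) (right_mem_tri _ _ _)
    refine _root_.conn_swap hS (hctx.isCode hlxa) hG ?_ ?_
    · intro v hv
      by_contra hv'
      simp at hv'
      exact hv'.2.2 (hex v hv hv'.1 hv'.2.1)
    · refine hctx.clean_sub (mid := [x, a]) (hsub.trans hT) ?_ ?_
      · rintro o rfl -
        simp
      · rintro u v (huv | ⟨hu, hu', rfl⟩) hne c hc hc'
        · simp at huv
          rcases huv with ⟨rfl, rfl⟩ | ⟨rfl, rfl⟩ <;> simp at hne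
        · simp at hu'
          rcases hleaf hu hu'.1 hu'.2.1 hu'.2.2 c hc (by rwa [hull_tri]) with h1 | h1 | h1 | h1
          · exact absurd (hex u h1.1 hu'.1 hu'.2.1) hu'.2.2
          · exact ⟨w, by simp, h1⟩
          · exact ⟨x, by simp, h1⟩
          · exact ⟨a, by simp, h1⟩
  -- the point `y` of the triangle closest to the line `xa`
  obtain ⟨y, ⟨hyT, hyw, hyx, hya⟩, hmin⟩ := Set.exists_min_image
    {y | y ∈ tri w x a ∧ y ≠ w ∧ y ≠ x ∧ y ≠ a} (fun y => area τ x a y) (Set.toFinite _) hex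
  have hyp := area_pos_of_mem_hull_triple hS htpos hyT hyw hyx hya
  set d := area τ x a y with hd
  have hwd : d < area τ x a w := by
    have := area_add τ (w : Plane) x a y
    have := area_rotate τ (w : Plane) x a
    linarith [hyp.1, hyp.2.2]
  have hyZ : y ∈ Z := (s.inner hS h hyT hyw hyx hya).1
  have wya : 0 < area τ w y a := by rw [area_rotate τ a w y]; exact hyp.2.2
  have wyx : area τ w y x < 0 := by rw [area_swap_right]; linarith [hyp.1]
  have ha1 : (a : Plane) ∉ hull {w, x, y} := fun h' => by
    have : area τ w y a ≤ 0 := by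
      refine hull_area_le ?_ h'
      rintro q (rfl | rfl | rfl)
      exacts [by simp, wyx.le, by simp]
    linarith
  have hx1 : (x : Plane) ∉ hull {w, a, y} := fun h' => by
    have : 0 ≤ area τ w y x := by
      refine hull_area_ge ?_ h'
      rintro q (rfl | rfl | rfl)
      exacts [by simp, wya.le, by simp]
    linarith
  -- By the choice of `y` the segment `wb` stays at level at least `d` over the line `xa`. The
  -- points `y`, `x`, `a` have level at most `d`, attained only by `y`, and `y` is not on the
  -- segment.
  have hlevel : ∀ b ∈ tri w x a, b ≠ w → b ≠ x → b ≠ a → b ≠ y → ∀ Q : Set S,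
      (∀ q ∈ Q, q = y ∨ q = x ∨ q = a) → ∀ c ∈ hull {w, b}, c ∉ hull Q := by
    intro b hb h1 h2 h3 h4 Q hQ c hc hc'
    have hge : d ≤ area τ x a c := by
      refine hull_area_ge ?_ hc
      rintro q (rfl | rfl)
      exacts [hwd.le, hmin _ ⟨hb, h1, h2, h3⟩]
    have := hull_face_le (u := y) hd.ge (fun q hq hqy => by
      rcases hQ q hq with rfl | rfl | rfl
      exacts [absurd rfl hqy, by simpa using hyp.2.1, by simpa using hyp.2.1]) hc' hge
    subst this
    rcases mem_hull_pair hS hc with e | e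
    exacts [hyw e, h4 e.symm]
  have hspine : ∀ mid : List S, (∀ v ∈ mid, v = x ∨ v = a ∨ v = y) → mid.Nodup → x ∈ mid → a ∈ mid →
      LocalSpine ({w} ∪ Z) w mid [] π₁ := fun mid h1 h2 h3 h4 => s.localSpine h m (fun v hv => by
        rcases h1 v hv with rfl | rfl | rfl <;> assumption) h2 h3 h4
  have hsub1 : tri w x y ⊆ tri w x a :=
    tri_subset (full_tri _ _ _) (left_mem_tri _ _ _) (mid_mem_tri _ _ _) hyT
  have hsub2 : tri w a y ⊆ tri w x a :=
    tri_subset (full_tri _ _ _) (left_mem_tri _ _ _) (right_mem_tri _ _ _) hyT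
  have hsub3 : ({y, x, a} : Set S) ⊆ tri w x a :=
    triple_subset hyT (mid_mem_tri _ _ _) (right_mem_tri _ _ _)
  have hpre : ∀ v ∈ tri w x a, v ∉ pre := fun v hv => h.ctx.disj_pre v (hT hv)
  -- The point `y` enters the spine before `x`. Then `x` and `a` are exchanged across the empty
  -- triangle `yxa`, and `y` leaves the spine, now as a leaf inserted between `w` and `a` in
  -- reverse.
  have conn1 : Conn (catG (pre ++ w :: x :: [a]) π₁) (catG (pre ++ w :: y :: x :: [a]) π₁) := by
    refine triInsert hS w x y pre [a] π₁ hyw.symm hyx.symm ?_ ?_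
    · refine Ctx.of_clean (mid := []) (hctx.isCode hlxa) hG ?_ (full_tri _ _ _)
        (left_mem_tri _ _ _) (by simpa using mid_mem_tri _ _ _) (fun v hv => hpre v (hsub1 hv)) ?_
        (by simp) (by simp)
      · refine hctx.clean_sub (mid := [x, a]) (hsub1.trans hT) ?_ ?_
        · rintro o rfl -
          simp
        · rintro u v (huv | ⟨hu, hu', rfl⟩) hne c hc hc'
          · simp at huv
            rw [hull_tri] at hc'
            rcases huv with ⟨rfl, rfl⟩ | ⟨rfl, rfl⟩
            · exact absurd ⟨left_mem_tri _ _ _, mid_mem_tri _ _ _⟩ hne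
            · refine ⟨u, by simp, hull_face (σ := τ) (c := 0) (a := u) (b := v) (by simp) ?_ hc' ?_⟩
              · rintro q (rfl | rfl | rfl) hq
                exacts [by linarith [hyp.2.1], absurd rfl hq, hyp.2.1]
              · refine hull_area_le ?_ hc
                rintro q (rfl | rfl) <;> simp
          · simp at hu'
            rcases hleaf hu hu'.1 hu'.2.1 hu'.2.2 c hc (hull_mono hsub1 hc') with
              ⟨h1, h2⟩ | rfl | rfl | rfl
            · rw [h2] at hc hne
              have huT : u ∉ tri w x y := fun h => hne ⟨h, left_mem_tri _ _ _⟩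
              rw [hull_tri] at hc'
              rw [Set.pair_comm] at hc
              refine ⟨w, by simp, segment_inter_hull (y := u) (by simp) ?_ huT ⟨hc, hc'⟩⟩
              refine hlevel u h1 hu'.1 hu'.2.1 hu'.2.2 ?_ _ ?_
              · rintro rfl; exact huT (right_mem_tri _ _ _)
              · rintro q (rfl | rfl) <;> simp
            · exact ⟨w, by simp, rfl⟩
            · exact ⟨x, by simp, rfl⟩
            · rw [hull_tri] at hc'
              exact absurd hc' ha1
      · intro v hv
        simp
        rintro rfl
        exact ha1 hv
    · intro v hv h1 h2
      exact s.leaf_inner hS h m (hsub1 hv) h1 h2 fun e => ha1 (e ▸ hv)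
  have e : pre ++ [w] ++ [y, x, a] = pre ++ w :: y :: x :: [a] := by simp
  have conn2 : Conn (catG (pre ++ [w] ++ [y, x, a]) π₁) (catG (pre ++ [w] ++ [y, a, x]) π₁) := by
    have hlq : ∀ q ∈ ({y, x, a} : Set S), area τ x a q ≤ d := by
      rintro q (rfl | rfl | rfl)
      exacts [le_rfl, by simpa using hyp.2.1.le, by simpa using hyp.2.1.le]
    have hw1 : (w : Plane) ∉ hull {y, x, a} := fun h' => by linarith [hull_area_le hlq h']
    refine _root_.conn_swap hS (e ▸ hctx.isCode (hspine [y, x, a] (by simp) ?_ (by simp) (by simp)))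
      (e ▸ conn1.plane_right) ?_ ?_
    · simp [hyx, hya, s.ne.symm]
    · intro v hv
      have hvT := full_tri _ _ _ v (hull_mono hsub3 hv)
      by_contra hv'
      simp at hv'
      have hvw : v ≠ w := fun e => hw1 (e ▸ hv)
      have := hull_face_le (σ := τ) (c := d) (a := x) (b := a) (u := y) hd.ge (fun q hq hqy => by
        rcases hq with rfl | rfl | rfl
        exacts [absurd rfl hqy, by simpa using hyp.2.1, by simpa using hyp.2.1]) hv
        (hmin v ⟨hvT, hvw, hv'.2.1, hv'.2.2⟩)
      exact hv'.1 (Subtype.ext this)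
    · rw [e]
      refine hctx.clean_sub (mid := [y, x, a]) (hsub3.trans hT) ?_ ?_
      · rintro o rfl ho
        exact absurd ho hw1
      · rintro u v (huv | ⟨hu, hu', rfl⟩) hne c hc hc'
        · simp at huv
          rcases huv with ⟨rfl, rfl⟩ | ⟨rfl, rfl⟩ | ⟨rfl, rfl⟩
          · rw [Set.pair_comm] at hc
            exact ⟨v, by simp, segment_meet_of_le (σ := τ) (c := d) (a := x) (b := a) le_rfl hwd hlq
              hc hc'⟩
          · simp at hne
          · simp at hne
        · simp at hu'
          rcases hleaf hu hu'.1 hu'.2.2.1 hu'.2.2.2 c hc (hull_mono hsub3 hc') with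
            ⟨h1, h2⟩ | rfl | rfl | rfl
          · rw [h2, Set.pair_comm] at hc
            exact absurd hc' (hlevel u h1 hu'.1 hu'.2.2.1 hu'.2.2.2 hu'.2.1 _ (by simp) c hc)
          · exact absurd hc' hw1
          · exact ⟨x, by simp, rfl⟩
          · exact ⟨a, by simp, rfl⟩
  have e' : pre ++ [w] ++ [y, a, x] = pre ++ w :: y :: a :: [x] := by simp
  have conn3 : Conn (catG (pre ++ w :: a :: [x]) π₁) (catG (pre ++ w :: y :: a :: [x]) π₁) := by
    refine triInsert hS w a y pre [x] π₁ hyw.symm hya.symm ?_ ?_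
    · refine Ctx.of_clean (mid := [y]) (hctx.isCode (hspine [y, a, x] (by simp) ?_ (by simp)
        (by simp))) (e' ▸ conn2.plane_right) ?_ (full_tri _ _ _)
        (left_mem_tri _ _ _) (by simpa using mid_mem_tri _ _ _) (fun v hv => hpre v (hsub2 hv)) ?_
        (by simpa using right_mem_tri _ _ _) ?_
      · simp [hyx, hya, s.ne]
      · refine hctx.clean_sub (mid := [y, a, x]) (hsub2.trans hT) ?_ ?_
        · rintro o rfl -
          simp
        · rintro u v (huv | ⟨hu, hu', rfl⟩) hne c hc hc'
          · simp at huv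
            rw [hull_tri] at hc'
            rcases huv with ⟨rfl, rfl⟩ | ⟨rfl, rfl⟩ | ⟨rfl, rfl⟩
            · exact absurd ⟨left_mem_tri _ _ _, right_mem_tri _ _ _⟩ hne
            · exact absurd ⟨right_mem_tri _ _ _, mid_mem_tri _ _ _⟩ hne
            · refine ⟨u, by simp, hull_face (σ := τ) (c := 0) (a := v) (b := u) (by simp) ?_ hc' ?_⟩
              · rintro q (rfl | rfl | rfl) hq
                exacts [by linarith [hyp.2.1], absurd rfl hq, hyp.2.1]
              · refine hull_area_le ?_ hc
                rintro q (rfl | rfl) <;> simp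
          · simp at hu'
            rcases hleaf hu hu'.1 hu'.2.2.2 hu'.2.2.1 c hc (hull_mono hsub2 hc') with
              ⟨h1, h2⟩ | rfl | rfl | rfl
            · rw [h2] at hc hne
              have huT : u ∉ tri w a y := fun h => hne ⟨h, left_mem_tri _ _ _⟩
              rw [hull_tri] at hc'
              rw [Set.pair_comm] at hc
              refine ⟨w, by simp, segment_inter_hull (y := u) (by simp) ?_ huT ⟨hc, hc'⟩⟩
              refine hlevel u h1 hu'.1 hu'.2.2.2 hu'.2.2.1 hu'.2.1 _ ?_
              rintro q (rfl | rfl) <;> simp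
            · exact ⟨w, by simp, rfl⟩
            · rw [hull_tri] at hc'
              exact absurd hc' hx1
            · exact ⟨a, by simp, rfl⟩
      · intro v hv
        simp
        rintro rfl
        exact hx1 hv
      · intro v hv h2 h3 hvy
        simp at h3 hvy
        by_cases hvZ : v ∈ Z
        · rcases s.leaf_cases h m hvZ h3.2 h3.1 with ⟨-, e⟩ | ⟨-, -, e⟩ | ⟨-, e⟩
          · exact hya (hvy.symm.trans e)
          · exact hyx (hvy.symm.trans e)
          · exact hyw (hvy.symm.trans e)
        · have hvw : v ≠ w := by rintro rfl; exact hv (left_mem_tri _ _ _)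
          have := hctx.out v (by simp [hvZ, hvw]) h2 (by simp)
          rw [hvy] at this
          simp [hyw, hpre y hyT] at this
    · intro v hv h1 h2
      exact s.leaf_inner hS h m (hsub2 hv) h1 (fun e => hx1 (e ▸ hv)) h2
  rw [e, e'] at conn2
  exact conn1.trans (conn2.trans conn3.symm)

end Split
end Fan

namespace Fan
variable {σ : ℝ} {r : Plane} {pre : List S} {w x : S} {Z A : Set S} {π π' : S → S}

/-- The first point `x` of a fan becomes a leaf of `w`. -/
lemma exists_advance (hS : GeneralPosition S) (h : Fan σ r pre w Z A x π) {a : S} (ha : a ∈ A)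
    (hax : a ≠ x) (hx : ∀ z ∈ A, z ≠ x → 0 < area σ w x z)
    (hfirst : ∀ z ∈ A, z ≠ x → z ≠ a → 0 < area σ w a z) :
    ∃ π', (∀ v, v ∉ Z → π' v = π v) ∧ Fan σ r pre w Z (A \ {x}) a π' ∧
      Conn (catG (pre ++ [w, x]) π) (catG (pre ++ [w, a]) π') := by
  classical
  -- No point of `A` precedes `x`, so the whole of `A` may be transferred to `a` at once.
  have s : Split σ w x a A A := ⟨h.ne_zero, subset_rfl, h.mem, ha, hax, hx,
    fun z h1 h2 => absurd h1 h2, hfirst, fun z h1 h2 => absurd h1 h2⟩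
  set π₁ : S → S := fun v => if v ∈ A then a else π v with hπ₁
  have m : Moved x a A π π₁ := ⟨fun z hz _ _ => by simp only [hπ₁]; rw [if_pos hz],
    fun z hz => by simp only [hπ₁]; rw [if_neg hz]⟩
  set π₂ : S → S := fun v => if v = x then w else π₁ v with hπ₂
  have hπ₂x : π₂ x = w := by simp [hπ₂]
  have hπ₂' : ∀ v, v ≠ x → π₂ v = π₁ v := fun v hv => by simp only [hπ₂]; rw [if_neg hv]
  have conn1 := s.conn_left hS h m
  have hctx := s.ctx_moved h m
  have hxZ := h.sub h.mem
  have haZ := h.sub ha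
  have hT := s.tri_sub h
  have hleaf : ∀ v ∈ tri w x a, v ≠ w → v ≠ x → v ≠ a → π₁ v = w := fun v h1 h2 h3 h4 =>
    s.leaf_inner hS h m h1 h2 h3 h4
  -- Read backwards, `x` is taken out of the spine between `w` and `a` and becomes a leaf of `w`.
  have conn2 : Conn (catG (pre ++ w :: a :: []) π₂) (catG (pre ++ w :: x :: a :: []) π₂) := by
    refine triInsert hS w a x pre [] π₂ (h.ne hxZ).symm hax ?_ ?_
    · rw [tri_swap]
      refine (Ctx.of_clean (mid := [x]) (π := π₁) (hctx.isCode (mid := [x, a]) (s.localSpine h m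
        (by simpa using ⟨hxZ, haZ⟩) (by simpa using hax.symm) (by simp) (by simp)))
        conn1.plane_right ?_ (full_tri _ _ _) (left_mem_tri _ _ _)
        (by simpa using right_mem_tri _ _ _) (fun v hv => h.ctx.disj_pre v (hT hv)) (by simp)
        (by simpa using mid_mem_tri _ _ _) ?_).congr ?_
      · refine hctx.clean_sub (mid := [x, a]) hT ?_ ?_
        · rintro o rfl -
          simp
        · rintro u v (huv | ⟨hu, hu', rfl⟩) hne c hc hc'
          · simp at huv
            rcases huv with ⟨rfl, rfl⟩ | ⟨rfl, rfl⟩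
            · exact absurd ⟨left_mem_tri _ _ _, mid_mem_tri _ _ _⟩ hne
            · exact absurd ⟨mid_mem_tri _ _ _, right_mem_tri _ _ _⟩ hne
          · simp at hu'
            by_cases huT : u ∈ tri w x a
            · rw [hleaf u huT hu'.1 hu'.2.1 hu'.2.2] at hne
              exact absurd ⟨huT, left_mem_tri _ _ _⟩ hne
            · rw [hull_tri] at hc'
              rcases s.meet h m (hu.resolve_left hu'.1) hu'.2.1 hu'.2.2 huT hc hc' with
                rfl | rfl | ⟨-, z, hz, hz'⟩
              exacts [⟨w, by simp, rfl⟩, ⟨a, by simp, rfl⟩, absurd hz hz']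
      · intro v hv h2 h3 hvx
        simp at h3 hvx
        have hvx' : v ≠ x := by rintro rfl; exact hv (mid_mem_tri _ _ _)
        by_cases hvZ : v ∈ Z
        · rcases s.leaf_cases h m hvZ hvx' h3 with ⟨-, e⟩ | ⟨h1, h2, -⟩ | ⟨-, e⟩
          · exact hax (e.symm.trans hvx)
          · exact h2 h1
          · exact h.ne hxZ (hvx.symm.trans e)
        · have hvw : v ≠ w := by rintro rfl; exact hv (left_mem_tri _ _ _)
          have := hctx.out v (by simp [hvZ, hvw]) h2 (by simp)
          rw [hvx] at this
          simp [h.ne hxZ, h.ctx.disj_pre x (Or.inr hxZ)] at this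
      · exact fun v hv _ _ => hπ₂' v (by rintro rfl; exact hv (mid_mem_tri _ _ _))
    · intro v hv h1 h2
      rw [tri_swap] at hv
      by_cases hvx : v = x
      · rw [hvx, hπ₂x]
      · rw [hπ₂' v hvx]
        exact hleaf v hv h1 hvx h2
  have e : catG (pre ++ [w, x, a]) π₁ = catG (pre ++ [w, x, a]) π₂ := by
    refine catG_congr fun v hv => (hπ₂' v ?_).symm
    rintro rfl
    simp at hv
  refine ⟨π₂, ?_, ?_, conn1.trans (e ▸ conn2.symm)⟩
  · intro v hv
    rw [hπ₂' v (by rintro rfl; exact hv hxZ), m.rest v fun h' => hv (h.sub h')]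
  · refine ⟨h.ne_zero, h.pos, hctx.congr fun v hv _ _ => hπ₂' v ?_,
      fun v hv => h.sub hv.1, ⟨ha, hax⟩, ?_, ?_, ?_, conn2.plane_left⟩
    · rintro rfl; exact hv (Or.inr hxZ)
    · intro v hv hva
      rw [hπ₂' v hv.2]
      exact m.moved v hv.1 hv.2 hva
    · intro v hv hvA
      by_cases hvx : v = x
      · rw [hvx, hπ₂x]
      · have : v ∉ A := fun h => hvA ⟨h, hvx⟩
        rw [hπ₂' v hvx, m.rest v this, h.leaf_w v hv this]
    · intro v hv hvA p hp hp'
      by_cases hvx : v = x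
      · subst hvx
        have h1 : 0 < area σ w v p := hull_area_gt (Q := A \ {v}) (fun q hq => hx q hq.1 hq.2) hp'
        have h2 : area σ w v p ≤ 0 := by
          refine hull_area_le ?_ hp
          rintro q (rfl | rfl) <;> simp
        linarith
      · exact h.miss v hv (fun h => hvA ⟨h, hvx⟩) p hp (hull_mono Set.sdiff_subset hp')

/-- The star at `x` becomes a star at the previous point `a` in the angular order. -/
lemma exists_cross (hS : GeneralPosition S) (h : Fan σ r pre w Z A x π) {a : S} (ha : a ∈ A)
    (hax : area σ w x a < 0) (hlast : ∀ z ∈ A, area σ w x z < 0 → z ≠ a → area σ w a z < 0) :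
    ∃ π', (∀ v, v ∉ Z → π' v = π v) ∧ Fan σ r pre w Z A a π' ∧
      Conn (catG (pre ++ [w, x]) π) (catG (pre ++ [w, a]) π') := by
  classical
  have hax' : a ≠ x := by rintro rfl; simp at hax
  have hwax : 0 < area σ w a x := by rw [area_swap_right]; linarith
  -- `B` consists of `x` and the points of `A` before it. With the opposite orientation `a` comes
  -- immediately after `x` in `B`. The points of `B` move first, then `x` and `a` change places,
  -- then the rest of `A` follows.
  set B : Set S := {z | z ∈ A ∧ (z = x ∨ area σ w x z < 0)} with hB
  have hnB : ∀ z ∈ A, z ∉ B → 0 < area σ w x z := by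
    intro z hz hzB
    simp [hB] at hzB
    have := And.intro (hzB.1 hz) (hzB.2 hz)
    refine lt_of_le_of_ne this.2 (area_ne_zero hS (h.ne (h.sub h.mem)).symm (h.ne (h.sub hz)).symm
      (Ne.symm this.1) h.ne_zero).symm
  have s : Split (-σ) w x a A B := by
    refine ⟨neg_ne_zero.2 h.ne_zero, fun z hz => hz.1, ⟨h.mem, Or.inl rfl⟩, ⟨ha, Or.inr hax⟩, hax',
      ?_, ?_, ?_, ?_⟩
    · intro z hz hzx
      rw [area_neg]; linarith [hz.2.resolve_left hzx]
    · intro z hz hzB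
      rw [area_neg]; linarith [hnB z hz hzB]
    · intro z hz hzx hza
      rw [area_neg]; linarith [hlast z hz.1 (hz.2.resolve_left hzx) hza]
    · intro z hz hzB
      rw [area_neg, neg_lt_zero]
      exact area_trans (h.pos a (h.sub ha)) (h.pos x (h.sub h.mem)) (h.pos z (h.sub hz)) hwax
        (hnB z hz hzB)
  set π₁ : S → S := fun v => if v ∈ B then a else π v with hπ₁
  have m : Moved x a B π π₁ := ⟨fun z hz _ _ => by simp only [hπ₁]; rw [if_pos hz],
    fun z hz => by simp only [hπ₁]; rw [if_neg hz]⟩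
  set π₂ : S → S := fun v => if v ∈ A then a else π v with hπ₂
  have hπ₂A : ∀ v ∈ A, π₂ v = a := fun v hv => by simp only [hπ₂]; rw [if_pos hv]
  have hπ₂' : ∀ v, v ∉ A → π₂ v = π v := fun v hv => by simp only [hπ₂]; rw [if_neg hv]
  have conn1 := s.conn_left hS h m
  have conn2 := s.conn_swap hS h m conn1.plane_right
  have conn3 := s.conn_right hS h m (fun z hz _ => hπ₂A z hz) hπ₂' conn2.plane_right
  refine ⟨π₂, fun v hv => hπ₂' v fun h' => hv (h.sub h'), ?_,
    conn1.trans (conn2.trans conn3.symm)⟩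
  exact ⟨h.ne_zero, h.pos, h.ctx.congr fun v hv _ _ => hπ₂' v fun h' => hv (Or.inr (h.sub h')),
    h.sub, ha, fun v hv _ => hπ₂A v hv, fun v hv hvA => by rw [hπ₂' v hvA, h.leaf_w v hv hvA],
    h.miss, conn3.plane_left⟩

lemma conn_singleton (h : Fan σ r pre w Z {x} x π)
    (hZ : ∀ v ∈ Z, π' v = w) (hrest : ∀ v, v ∉ Z → v ∉ pre → v ≠ w → π' v = π v) :
    Conn (catG (pre ++ [w, x]) π) (catG (pre ++ [w]) π') := by
  have hxZ := h.sub h.mem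
  have e : catG (pre ++ [w, x]) π = catG (pre ++ [w]) π' := by
    rw [← catG_append (x := w) (y := x) (π := π') ?_ (hZ x hxZ)]
    · refine catG_congr fun v hv => ?_
      simp at hv
      by_cases hvZ : v ∈ Z
      · rw [h.leaf_w v hvZ (by simpa using hv.2.2), hZ v hvZ]
      · exact (hrest v hvZ hv.1 hv.2.1).symm
    · simpa using ⟨h.ctx.disj_pre x (Or.inr hxZ), h.ne hxZ⟩
  rw [← e]
  exact .refl h.plane h.isCode.isCaterpillar

/-- All leaves of a fan can be moved to `w`. -/
theorem conn_star (hS : GeneralPosition S) (h : Fan σ r pre w Z A x π)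
    (hZ : ∀ v ∈ Z, π' v = w) (hrest : ∀ v, v ∉ Z → v ∉ pre → v ≠ w → π' v = π v) :
    Conn (catG (pre ++ [w, x]) π) (catG (pre ++ [w]) π') := by
  -- The outer induction removes the first point `p` around `w` as soon as it is a leaf of `w`.
  induction hn : Z.ncard using Nat.strong_induction_on generalizing Z A x π with | _ n ih => ?_
  have hdrop : ∀ {A x π} (h : Fan σ r pre w Z A x π) {p : S}, p ∈ Z → p ∉ A →
      (∀ v, v ∉ Z → v ∉ pre → v ≠ w → π' v = π v) →
      (∀ z ∈ Z, z ≠ p → 0 < area σ w p z) →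
      Conn (catG (pre ++ [w, x]) π) (catG (pre ++ [w]) π') := by
    intro A x π h p hp hpA hrest hfirst
    refine ih (Z \ {p}).ncard ?_ (h.drop hp hpA hfirst) (fun v hv => hZ v hv.1) ?_ rfl
    · rw [← hn]; exact Set.ncard_sdiff_singleton_lt_of_mem hp
    · intro v hv h1 h2
      by_cases hvp : v = p
      · rw [hvp, hZ p hp, h.leaf_w p hp hpA]
      · exact hrest v (fun h => hv ⟨h, hvp⟩) h1 h2
  obtain ⟨p, hp, hfirst⟩ := exists_first hS h.ne_zero (w := w) (r := r)
    (Z := Z.toFinite.toFinset) ⟨x, by simpa using h.sub h.mem⟩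
    (fun z hz => h.pos z (by simpa using hz))
  simp only [Set.Finite.mem_toFinset] at hp hfirst
  -- The inner induction counts the points of `A` before `x`; crossing to the preceding point `a`
  -- lowers this number.
  induction hk : {z | z ∈ A ∧ area σ w x z < 0}.ncard using Nat.strong_induction_on
    generalizing A x π with | _ k ihk => ?_
  by_cases hpA : p ∉ A
  · exact hdrop h hp hpA hrest hfirst
  rw [not_not] at hpA
  -- When the star has reached `p`, it either advances to the next point of `A`, which makes `p` a
  -- leaf of `w`, or consists of `p` alone, and then `p` already is a leaf of `w`.
  by_cases hpx : p = x
  · subst hpx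
    by_cases hA : (A \ {p}).Nonempty
    · obtain ⟨a, ha, hfirst'⟩ := exists_first hS h.ne_zero (w := w) (r := r)
        (Z := (A \ {p}).toFinite.toFinset) (by simpa using hA)
        (fun z hz => h.pos z (h.sub (by simp at hz; exact hz.1)))
      simp only [Set.Finite.mem_toFinset, Set.mem_sdiff, Set.mem_singleton_iff] at ha hfirst'
      obtain ⟨π₁, h1, h2, h3⟩ := h.exists_advance hS ha.1 ha.2
        (fun z hz => hfirst z (h.sub hz)) (fun z hz hz' => hfirst' z ⟨hz, hz'⟩)
      exact h3.trans (hdrop h2 hp (by simp)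
        (fun v hv hv' hv'' => by rw [h1 v hv, hrest v hv hv' hv'']) hfirst)
    · have : A = {p} := by
        rw [Set.not_nonempty_iff_eq_empty, Set.sdiff_eq_empty] at hA
        exact Set.Subset.antisymm hA (by simpa using h.mem)
      subst this
      exact h.conn_singleton hZ hrest
  · have hpx' : area σ w x p < 0 := by
      rw [area_swap_right]
      linarith [hfirst x (h.sub h.mem) fun e => hpx e.symm]
    obtain ⟨a, ha, hlast⟩ := exists_first hS (neg_ne_zero.2 h.ne_zero) (w := w) (r := x)
      (Z := {z | z ∈ A ∧ area σ w x z < 0}.toFinite.toFinset) ⟨p, by simpa using ⟨hpA, hpx'⟩⟩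
      (fun z hz => by
        rw [area_neg]
        have : z ∈ A ∧ area σ w x z < 0 := by simpa using hz
        linarith [this.2])
    simp only [Set.Finite.mem_toFinset, Set.mem_ofPred_eq] at ha hlast
    obtain ⟨π₁, h1, h2, h3⟩ := h.exists_cross hS ha.1 ha.2 (fun z hz hz' hza => by
      have := hlast z ⟨hz, hz'⟩ hza
      rw [area_neg] at this; linarith)
    refine h3.trans (ihk _ ?_ h2 (fun v hv hv' hv'' => by rw [h1 v hv, hrest v hv hv' hv'']) rfl)
    rw [← hk]
    refine Set.ncard_lt_ncard ⟨?_, fun hsub => ?_⟩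
    · rintro z ⟨hz, hz'⟩
      refine ⟨hz, ?_⟩
      have hza : 0 < area σ w z a := by rw [area_swap_right]; linarith
      have hax : 0 < area σ w a x := by rw [area_swap_right]; linarith [ha.2]
      have := area_trans (h.pos z (h.sub hz)) (h.pos a (h.sub ha.1)) (h.pos x (h.sub h.mem)) hza hax
      rw [area_swap_right]; linarith
    · have := (hsub ha).2
      simp at this

end Fan

/-! ### Edges beside a star, and the connection of any two stars. -/

lemma exists_scale (hS : GeneralPosition S) {a b c : S} (hab : a ≠ b) (hac : a ≠ c) (hbc : b ≠ c) :
    ∃ σ : ℝ, σ ≠ 0 ∧ 0 < area σ a b c := by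
  have := area_ne_zero hS hab hac hbc one_ne_zero
  exact ⟨area 1 a b c, this, area_scale _ _ _ this⟩

/-- A point of the line `cd` is an affine combination of `c` and `d`. -/
lemma exists_lineMap_of_area_eq_zero {σ : ℝ} (hσ : σ ≠ 0) {c d q : Plane} (hcd : c ≠ d)
    (h : area σ c d q = 0) : ∃ t : ℝ, q = AffineMap.lineMap c d t := by
  have h' : (d 0 - c 0) * (q 1 - c 1) - (d 1 - c 1) * (q 0 - c 0) = 0 := by
    unfold area at h
    exact (mul_eq_zero.1 h).resolve_left hσ
  by_cases h0 : d 0 - c 0 = 0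
  · have h1 : d 1 - c 1 ≠ 0 := fun h1 => hcd (by
      ext i
      fin_cases i
      · simp only [Fin.zero_eta]; linarith
      · simp only [Fin.mk_one]; linarith)
    have h2 : q 0 - c 0 = 0 := by
      rw [h0] at h'
      have : (d 1 - c 1) * (q 0 - c 0) = 0 := by linarith
      exact (mul_eq_zero.1 this).resolve_left h1
    refine ⟨(q 1 - c 1) / (d 1 - c 1), ?_⟩
    ext i
    fin_cases i
    · simp [AffineMap.lineMap_apply, h0]; linarith
    · simp [AffineMap.lineMap_apply]; field_simp; ring
  · refine ⟨(q 0 - c 0) / (d 0 - c 0), ?_⟩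
    ext i
    fin_cases i
    · simp [AffineMap.lineMap_apply]; field_simp; ring
    · simp [AffineMap.lineMap_apply]; field_simp; linarith

/-- An edge cannot cross the hull of a star unless one of its ends lies in the hull. -/
lemma star_miss (hS : GeneralPosition S) {G : SimpleGraph S} (hG : IsPlaneGraph G) {x : S}
    {P : Set S} (hx : x ∈ P) (hP : ∀ v ∈ P, v ≠ x → G.Adj x v) {c d : S} (hcd : G.Adj c d)
    (hc : (c : Plane) ∉ hull P) (hd : (d : Plane) ∉ hull P) : ∀ p ∈ hull {c, d}, p ∉ hull P := by
  intro p hp hp'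
  have hne : ∀ v ∈ P, c ≠ v ∧ d ≠ v := fun v hv =>
    ⟨by rintro rfl; exact hc (mem_hull hv), by rintro rfl; exact hd (mem_hull hv)⟩
  obtain ⟨σ, hσ, hpos⟩ := exists_scale hS hcd.ne (hne x hx).1 (hne x hx).2
  have hp0 : area σ c d p ≤ 0 := by
    refine hull_area_le ?_ hp
    rintro q (rfl | rfl) <;> simp
  -- The hull meets the line `cd` in `p`, so its points cannot all lie strictly on the side of `x`.
  -- A star edge `xv` therefore crosses the line, in the point `q` below.
  obtain ⟨v, hv, hneg⟩ : ∃ v ∈ P, area σ c d v < 0 := by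
    by_contra! hge
    have := hull_area_gt (σ := σ) (c := 0) (a := c) (b := d) (Q := P) (fun q hq =>
      lt_of_le_of_ne (hge q hq) (area_ne_zero hS hcd.ne (hne q hq).1 (hne q hq).2 hσ).symm) hp'
    linarith
  have hvx : v ≠ x := by rintro rfl; linarith
  have hden : 0 < area σ c d x - area σ c d v := by linarith
  set t := area σ c d x / (area σ c d x - area σ c d v) with ht
  have ht0 : 0 ≤ t := by positivity
  have ht1 : t ≤ 1 := by rw [ht, div_le_one hden]; linarith
  set q : Plane := (1 - t) • (x : Plane) + t • (v : Plane) with hq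
  have hqx : q ∈ hull {x, v} := by
    rw [hull_pair]
    exact ⟨1 - t, t, by linarith, ht0, by ring, rfl⟩
  have hq0 : area σ c d q = 0 := by
    rw [hq, area_combo _ _ _ _ _ (by ring), ht]
    field_simp
    ring
  have hqP : q ∈ hull P := hull_mono (by
    rintro u (rfl | rfl)
    exacts [hx, hv]) hqx
  have hcd' : (c : Plane) ≠ d := fun e => hcd.ne (Subtype.ext e)
  obtain ⟨α, hα⟩ := exists_lineMap_of_area_eq_zero hσ hcd' hq0
  rw [hull_pair, segment_eq_image_lineMap] at hp
  obtain ⟨β, ⟨hβ0, hβ1⟩, hβ⟩ := hp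
  have hconv : Convex ℝ (hull P) := convex_convexHull ..
  -- The line `cd` meets the hull in a convex set, which contains `q` and `p` but neither `c` nor
  -- `d`. As `p` lies between `c` and `d`, so does `q`, and the edges `xv` and `cd` cross.
  have hmem : ∀ s : ℝ, (α ≤ s ∧ s ≤ β) ∨ (β ≤ s ∧ s ≤ α) →
      AffineMap.lineMap (c : Plane) (d : Plane) s ∈ hull P := by
    intro s hs
    have hsub := hconv.segment_subset hqP hp'
    apply hsub
    rw [hα, ← hβ, ← image_segment]
    refine ⟨s, ?_, rfl⟩
    rw [segment_eq_uIcc, Set.mem_uIcc]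
    exact hs
  have hα0 : 0 ≤ α := by
    by_contra! h
    exact hc (by simpa using hmem 0 (Or.inl ⟨h.le, hβ0⟩))
  have hα1 : α ≤ 1 := by
    by_contra! h
    exact hd (by simpa using hmem 1 (Or.inr ⟨hβ1, h.le⟩))
  have hqcd : q ∈ hull {c, d} := by
    rw [hull_pair, segment_eq_image_lineMap]
    exact ⟨α, ⟨hα0, hα1⟩, hα.symm⟩
  have := ((plane_iff G).1 hG x v c d (hP v hv hvx) hcd (by
    rw [ne_eq, Sym2.eq_iff]
    have h1 := hne x hx
    rintro (⟨e, -⟩ | ⟨e, -⟩)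
    exacts [h1.1 e.symm, h1.2 e.symm]) q hqx hqcd).2
  rcases this with e | e
  · exact hc (e ▸ hqP)
  · exact hd (e ▸ hqP)

/-- A point outside of a hull sees the hull in an angle of less than `π`. -/
lemma exists_pos_of_not_mem_hull {w : S} {A : Set S} (hw : (w : Plane) ∉ hull A) :
    ∃ r : Plane, ∀ z ∈ A, 0 < area 1 w r z := by
  have hclosed : IsClosed (hull A) := by
    have : ((↑) '' A : Set Plane).Finite := A.toFinite.image _
    exact this.isClosed_convexHull ℝ
  obtain ⟨f, u, h1, h2⟩ := geometric_hahn_banach_point_closed (convex_convexHull ..) hclosed hw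
  set e : Fin 2 → Plane := fun i => EuclideanSpace.single i 1 with he
  have hf : ∀ z : Plane, f z = z 0 * f (e 0) + z 1 * f (e 1) := by
    intro z
    have : z = z 0 • e 0 + z 1 • e 1 := by
      ext i
      fin_cases i <;> simp [he]
    conv_lhs => rw [this]
    simp
  -- The vector from `w` to `r` spans the kernel of the separating functional, so the area becomes
  -- `f z - f w`.
  refine ⟨w + (f (e 1) • e 0 - f (e 0) • e 1), fun z hz => ?_⟩
  have h3 := h2 z (mem_hull hz)
  rw [hf] at h1 h3
  have : area 1 w (w + (f (e 1) • e 0 - f (e 0) • e 1)) z =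
      (z : Plane) 0 * f (e 0) + (z : Plane) 1 * f (e 1) -
        ((w : Plane) 0 * f (e 0) + (w : Plane) 1 * f (e 1)) := by
    simp [area, he]
    ring
  rw [this]
  linarith

/-- Any two stars are connected. -/
theorem conn_star_star (hS : GeneralPosition S) {x p : S} (hxp : x ≠ p) :
    Conn (catG [x] fun _ => x) (catG [p] fun _ => p) := by
  classical
  -- one side of the line after the other
  set Z : Set S := {z | 0 < area 1 x p z} with hZ
  set Z' : Set S := {z | 0 < area (-1) x p z} with hZ'
  have hZZ' : ∀ z, z ≠ x → z ≠ p → z ∈ Z ∨ z ∈ Z' := by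
    intro z h1 h2
    have := area_ne_zero hS hxp h1.symm h2.symm one_ne_zero
    simp only [hZ, hZ', Set.mem_ofPred_eq, area_neg]
    rcases lt_or_gt_of_ne this with h | h
    · exact Or.inr (by linarith)
    · exact Or.inl h
  have hdisj : ∀ z ∈ Z, z ∉ Z' := by
    intro z h1 h2
    simp only [hZ, hZ', Set.mem_ofPred_eq, area_neg] at h1 h2
    linarith
  -- When the leaves on one side of the line `xp` move, each edge on the other side hangs on `x` or
  -- `p` and can touch the moving part only there.
  have key : ∀ (τ : ℝ) (Z₁ Z₂ : Set S), τ ≠ 0 → (∀ z ∈ Z₁, 0 < area τ x p z) →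
      (∀ z ∈ Z₂, area τ x p z < 0) → (∀ z, z ≠ x → z ≠ p → z ∈ Z₁ ∨ z ∈ Z₂) →
      ∀ (π : S → S), (∀ z, π z = x ∨ π z = p) → IsPlaneGraph (catG [x, p] π) →
      Ctx {x, p} ({x, p} ∪ Z₁) [] x [p] π := by
    intro τ Z₁ Z₂ hτ h1 h2 h12 π hπ hG
    have hge : ∀ q ∈ ({x, p} : Set S) ∪ Z₁, 0 ≤ area τ x p q := by
      rintro q ((rfl | rfl) | hq)
      exacts [by simp, by simp, (h1 q hq).le]
    have hc : IsCode ([] ++ x :: ([] ++ [p])) π :=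
      ⟨by simp, by simpa using hxp, fun v _ => by simpa using hπ v⟩
    have hZ2 : ∀ u, u ∉ ({x, p} : Set S) ∪ Z₁ → u ∈ Z₂ := by
      intro u hu
      simp at hu
      exact (h12 u hu.1.1 hu.1.2).resolve_left hu.2
    refine Ctx.of_clean (mid := []) hc hG ?_ ?_ (by simp) (by simp) (by simp) (by simp) (by simp)
      (by simp)
    · have key2 : ∀ u, u ∉ ({x, p} : Set S) ∪ Z₁ → ∀ c ∈ hull {u, π u},
          c ∈ hull (({x, p} : Set S) ∪ Z₁) → ∃ o ∈ ({x, p} : Set S), c = (o : Plane) := by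
        intro u hu c hc hc'
        rw [Set.pair_comm] at hc
        have h0 : area τ x p (π u) = 0 := by rcases hπ u with e | e <;> simp [e]
        exact ⟨π u, by simpa using hπ u, segment_meet_of_ge h0.le (h2 u (hZ2 u hu)) hge hc hc'⟩
      intro u v huv hne c hc hc'
      have hx := hπ u
      have hp := hπ v
      rcases (catG_adj.1 huv).2 with (h | ⟨h, rfl⟩) | (h | ⟨h, rfl⟩)
      · simp at h
        exact absurd (by rw [h.1, h.2]; simp) hne
      · refine key2 u (fun h' => hne ⟨h', ?_⟩) c hc hc'
        rcases hx with e | e <;> simp [e]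
      · simp at h
        exact absurd (by rw [h.1, h.2]; simp) hne
      · rw [Set.pair_comm] at hc
        refine key2 v (fun h' => hne ⟨?_, h'⟩) c hc hc'
        rcases hp with e | e <;> simp [e]
    · intro v hv
      by_contra hv'
      linarith [hull_area_ge hge hv, h2 v (hZ2 v hv')]
  set π₁ : S → S := fun v => if v ∈ Z then p else x with hπ₁
  have hstar : ∀ a b : S, a ≠ b → catG [a, b] (fun _ => a) = catG [a] fun _ => a := fun a b hab =>
    catG_append (l := []) (by simpa using hab.symm) rfl
  have hplane : IsPlaneGraph (catG [x] fun _ => x) := by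
    have hctx : Ctx {x} Set.univ [] x [] (fun _ => x) :=
      ⟨by simp, trivial, by simp, by simp, by simp, by simp, fun _ _ => trivial, by
        rintro u v (h | h | ⟨h, -⟩)
        exacts [h.elim, h.elim, absurd trivial h], by
        rintro a b c d (h | h | ⟨h, -⟩)
        exacts [h.elim, h.elim, absurd trivial h]⟩
    exact hctx.plane_star hS fun _ _ _ _ => rfl
  have h1 := key 1 Z Z' one_ne_zero (fun z hz => hz) (fun z hz => by
    simp only [hZ', Set.mem_ofPred_eq, area_neg] at hz; linarith) hZZ' (fun _ => x) (by simp)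
    (by rw [hstar x p hxp]; exact hplane)
  have c1 := starShift hS Z 1 [] x p [] (fun _ => x) π₁ one_ne_zero (fun z hz => hz) h1
    (fun _ _ => rfl) (fun v hv _ _ => by
      simp only [hπ₁]; rw [if_neg fun h => hv (Or.inr h)])
    (fun z hz => by simp only [hπ₁]; rw [if_pos hz])
  have h2 := key (-1) Z' Z (by simp) (fun z hz => hz) (fun z hz => by
    rw [area_neg, neg_lt_zero]; exact hz) (fun z h1 h2 => (hZZ' z h1 h2).symm) π₁
    (fun z => by simp only [hπ₁]; split_ifs <;> simp) c1.plane_right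
  have c2 := starShift hS Z' (-1) [] x p [] π₁ (fun _ => p) (by simp) (fun z hz => hz) h2
    (fun z hz => by simp only [hπ₁]; rw [if_neg fun h => hdisj z h hz]) (fun v hv _ hvp => by
      simp at hv hvp
      simp only [hπ₁]
      rw [if_pos ((hZZ' v hv.1.1 hvp).resolve_right hv.2)])
    (fun z hz => rfl)
  have e : catG ([] ++ x :: [p]) (fun _ => p) = catG [p] fun _ => p := by
    rw [← hstar p x hxp.symm, ← catG_reverse]
    simp
  rw [e] at c2
  have e1 : catG ([] ++ x :: [p]) (fun _ => x) = catG [x] fun _ => x := hstar x p hxp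
  rw [e1] at c1
  exact c1.trans c2

/-! ### From well-separated caterpillars to stars. -/

section
variable {V : Type*}

/-- Two adjacent leaves form a whole component. -/
lemma eq_or_eq_of_isLeaf {T : SimpleGraph V} (hT : T.Connected) {v w : V} (hv : IsLeaf T v)
    (hw : IsLeaf T w) (hvw : T.Adj v w) (u : V) : u = v ∨ u = w := by
  have h := (SimpleGraph.reachable_iff_reflTransGen v u).1 (hT.preconnected v u)
  induction h with
  | refl => exact Or.inl rfl
  | tail _ hab ih =>
    rcases ih with rfl | rfl
    · exact Or.inr (hv.unique hab hvw)
    · exact Or.inl (hw.unique hab hvw.symm)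

/-- A tree is a minimal connected graph, so the inclusion of edges in one direction is enough. -/
lemma eq_catG_of_le {T : SimpleGraph V} (hT : T.IsTree) {l : List V} {π : V → V} (hc : IsCode l π)
    (hle : catG l π ≤ T) : T = catG l π :=
  le_antisymm ((SimpleGraph.isTree_iff_minimal_connected.1 hT).2 hc.connected hle) hle

/-- A caterpillar is given by its spine and the neighbours of its leaves. -/
lemma exists_code {T : SimpleGraph V} (hT : T.IsTree) {l : List V} (hl : IsSpine T l)
    (hne : l ≠ []) : ∃ π, IsCode l π ∧ T = catG l π := by
  have h : ∀ v, ∃ w, v ∉ l → T.Adj v w ∧ w ∈ l := by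
    intro v
    by_cases hv : v ∈ l
    · exact ⟨v, fun h => absurd hv h⟩
    have hv' : IsLeaf T v := by
      by_contra h
      exact hv ((hl.2.1 v).2 h)
    obtain ⟨w, hw, -⟩ := id hv'
    refine ⟨w, fun _ => ⟨hw, ?_⟩⟩
    by_contra hwl
    have hw' : IsLeaf T w := by
      by_contra h
      exact hwl ((hl.2.1 w).2 h)
    obtain ⟨x, hx⟩ := List.exists_mem_of_ne_nil l hne
    rcases eq_or_eq_of_isLeaf hT.connected hv' hw' hw x with rfl | rfl
    exacts [hv hx, hwl hx]
  choose π hπ using h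
  have hc : IsCode l π := ⟨hne, hl.1, fun v hv => (hπ v hv).2⟩
  refine ⟨π, hc, eq_catG_of_le hT hc fun u v huv => ?_⟩
  have hchain := (isChain_iff_consec _).1 hl.2.2
  rcases (catG_adj.1 huv).2 with (h | ⟨h, rfl⟩) | (h | ⟨h, rfl⟩)
  exacts [hchain _ _ h, (hπ u h).1, (hchain _ _ h).symm, (hπ v h).1.symm]

/-- A tree in which all vertices are leaves is an edge. -/
lemma eq_star_of_spine_nil {T : SimpleGraph V} (hT : T.IsTree) (hl : IsSpine T []) :
    ∃ x, T = catG [x] fun _ => x := by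
  have hleaf : ∀ v, IsLeaf T v := fun v => by
    by_contra h
    simpa using (hl.2.1 v).2 h
  obtain ⟨v⟩ := hT.connected.nonempty
  obtain ⟨w, hw, -⟩ := hleaf v
  have hcases := eq_or_eq_of_isLeaf hT.connected (hleaf v) (hleaf w) hw
  refine ⟨v, eq_catG_of_le hT ⟨by simp, by simp, by simp⟩ fun a b hab => ?_⟩
  have := (catG_adj.1 hab).1
  have ha := hcases a
  have hb := hcases b
  rcases (catG_adj.1 hab).2 with (h | ⟨h, rfl⟩) | (h | ⟨h, rfl⟩)
  · exact h.elim
  · rcases ha with rfl | rfl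
    exacts [absurd rfl this, hw.symm]
  · exact h.elim
  · rcases hb with rfl | rfl
    exacts [absurd rfl this, hw]

/-- The vertices of `s` and the leaves attached to them, in a caterpillar with spine `l`. -/
def block (l s : List V) (π : V → V) : Set V := {v | v ∈ s ∨ (v ∉ l ∧ π v ∈ s)}

end

lemma block_aux {a b c d e f : Prop} (h : ¬ (c ∨ b) → ¬ f) :
    (a ∨ b) ∨ ¬ (c ∨ b) ∧ (d ∨ e) ↔ (a ∨ b) ∨ ¬ (c ∨ b) ∧ (d ∨ e ∨ f) := by tauto

/-- The spine is shortened from its end `w, x`. The hull of the star `A` at `x` contains no further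
points, so `w` sees it inside an open half-plane, and the points in the join of `w` and `A` form a
fan. After they have become leaves of `w`, the remaining final blocks are the same sets as before,
so the hypothesis persists. -/
theorem conn_star_of_full (hS : GeneralPosition S) {l : List S} {x : S} {π : S → S}
    (hc : IsCode (l ++ [x]) π) (hG : IsPlaneGraph (catG (l ++ [x]) π))
    (hfull : ∀ p s, l = p ++ s → Full (block (l ++ [x]) (s ++ [x]) π)) :
    ∃ y, Conn (catG (l ++ [x]) π) (catG [y] fun _ => y) := by
  classical
  induction l using List.reverseRecOn generalizing x π with
  | nil =>
    have : catG ([] ++ [x]) π = catG [x] fun _ => x :=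
      catG_congr fun v hv => by simpa using hc.mem v hv
    exact ⟨x, this ▸ .refl hG hc.isCaterpillar⟩
  | append_singleton pre w ih =>
    have hfullA := hfull (pre ++ [w]) [] (by simp)
    have hfullD := hfull pre [w] rfl
    simp only [List.append_assoc, List.singleton_append, List.nil_append] at hc hG hfullA hfullD ⊢
    have hnd := hc.nodup
    simp only [List.nodup_append, List.nodup_cons, List.mem_cons, List.not_mem_nil, or_false,
      not_false_eq_true, List.nodup_nil, and_true] at hnd
    obtain ⟨-, hwx, hpre⟩ := hnd
    have hwpre : w ∉ pre := fun h => hpre w h w (Or.inl rfl) rfl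
    have hxpre : x ∉ pre := fun h => hpre x h x (Or.inr rfl) rfl
    set A := block (pre ++ [w, x]) [x] π with hA
    set D := block (pre ++ [w, x]) [w, x] π with hD
    have memA : ∀ v, v ∈ A ↔ v = x ∨ (v ∉ pre ++ [w, x] ∧ π v = x) := fun v => by
      simp [hA, block]
    have memD : ∀ v, v ∈ D ↔ (v = w ∨ v = x) ∨ (v ∉ pre ++ [w, x] ∧ (π v = w ∨ π v = x)) :=
      fun v => by simp [hD, block]
    have hxA : x ∈ A := (memA x).2 (Or.inl rfl)
    have hwA : w ∉ A := by rw [memA]; simp [hwx]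
    have hwA' : (w : Plane) ∉ hull A := fun h => hwA (hfullA w h)
    have hAD : insert w A ⊆ D := by
      rintro v (rfl | hv)
      · rw [memD]; tauto
      · rw [memA] at hv; rw [memD]; tauto
    -- The join of `w` and the star may contain leaves of `w` besides `A`. Fullness of the last two
    -- blocks `D` excludes all other points.
    set Z : Set S := {z | z ≠ w ∧ (z : Plane) ∈ hull (insert w A)} with hZ
    have hAZ : A ⊆ Z := fun v hv => ⟨by rintro rfl; exact hwA hv,
      mem_hull (Set.mem_insert_of_mem _ hv)⟩
    have hZD : Z ⊆ D := fun v hv => hfullD v (hull_mono hAD hv.2)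
    have hQ : hull ({w} ∪ Z) = hull (insert w A) := by
      refine Set.Subset.antisymm (hull_le ?_) (hull_mono ?_)
      · rintro v (rfl | hv)
        exacts [mem_hull (by simp), hv.2]
      · rintro v (rfl | hv)
        exacts [by simp, Or.inr (hAZ hv)]
    have hQ' : ∀ v : S, (v : Plane) ∈ hull (insert w A) → v ∈ ({w} : Set S) ∪ Z := by
      intro v hv
      by_cases hvw : v = w
      exacts [Or.inl hvw, Or.inr ⟨hvw, hv⟩]
    have hZpre : ∀ v ∈ Z, v ∉ pre := by
      intro v hv hvp
      rcases (memD v).1 (hZD hv) with (rfl | rfl) | h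
      exacts [hwpre hvp, hxpre hvp, h.1 (by simp [hvp])]
    have hleafY : ∀ v ∈ Z, v ∉ A → v ∉ pre ++ [w, x] ∧ π v = w := by
      intro v hv hvA
      rcases (memD v).1 (hZD hv) with (rfl | rfl) | ⟨h1, h2⟩
      · exact absurd rfl hv.1
      · exact absurd hxA hvA
      · exact ⟨h1, h2.resolve_right fun h => hvA ((memA v).2 (Or.inr ⟨h1, h⟩))⟩
    have hadjA : ∀ v ∈ A, v ≠ x → (catG (pre ++ [w, x]) π).Adj x v := by
      intro v hv hvx
      rcases (memA v).1 hv with rfl | ⟨h1, h2⟩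
      · exact absurd rfl hvx
      · have := (hc.adj_leaf h1).symm
        rwa [h2] at this
    have hadjw : (catG (pre ++ [w, x]) π).Adj w x :=
      hc.adj_of_consec (by rw [consec_append_cons]; simp)
    have hmiss : ∀ y, (catG (pre ++ [w, x]) π).Adj w y → y ∉ A → ∀ p ∈ hull {w, y}, p ∉ hull A :=
      fun y hy hyA => star_miss hS hG hxA hadjA hy hwA' fun h => hyA (hfullA y h)
    have hmiss' : ∀ u v, (catG (pre ++ [w, x]) π).Adj u v → u ∉ ({w} : Set S) ∪ Z →
        v ∉ ({w} : Set S) ∪ Z → ∀ p ∈ hull {u, v}, p ∉ hull (insert w A) := by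
      intro u v huv hu hv
      refine star_miss hS hG (x := x) (Or.inr hxA) ?_ huv (fun h => hu (hQ' u h))
        fun h => hv (hQ' v h)
      rintro a (rfl | ha) hax
      exacts [hadjw.symm, hadjA a ha hax]
    obtain ⟨r, hr⟩ := exists_pos_of_not_mem_hull hwA'
    have hloc : LocalSpine ({w} ∪ Z) w [x] [] π := by
      refine ⟨by simpa using Or.inr (hAZ hxA), by simpa using hwx, fun v hv hv' => ?_⟩
      simp at hv' ⊢
      rcases (memD v).1 (hZD (hv.resolve_left hv'.1)) with h | h
      · tauto
      · exact h.2
    have hfan : Fan 1 r pre w Z A x π := by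
      refine ⟨one_ne_zero, ?_, ?_, hAZ, hxA, ?_, fun v hv hvA => (hleafY v hv hvA).2, ?_, hG⟩
      · intro z hz
        by_contra! hle
        have := hull_face (σ := 1) (c := 0) (a := w) (b := r) (u := w) (by simp) (by
          rintro q (rfl | hq) hqw
          exacts [absurd rfl hqw, hr q hq]) hz.2 hle
        exact hz.1 (Subtype.ext this)
      · refine Ctx.of_clean (mid := [x]) hc hG ?_ (fun v hv => hQ' v (hQ ▸ hv)) (by simp) (by simp)
          ?_ (by simp) (by simpa using Or.inr (hAZ hxA)) ?_
        · have key : ∀ u v, OuterEdge ({w} ∪ Z) pre w [] π u v →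
              (catG (pre ++ [w, x]) π).Adj u v → ∀ c ∈ hull {u, v}, c ∈ hull ({w} ∪ Z) →
              ∃ o ∈ ({w} : Set S), c = (o : Plane) := by
            intro u v ho huv c hc1 hc2
            have hw : ∀ a, (catG (pre ++ [w, x]) π).Adj w a → a ∉ ({w} : Set S) ∪ Z →
                c ∈ hull {w, a} → c = w := by
              intro a hwa ha hca
              rw [hQ] at hc2
              exact segment_inter_hull ⟨x, hxA⟩
                (hmiss a hwa fun h => ha (Or.inr (hAZ h))) (fun h => ha (hQ' a h)) ⟨hca, hc2⟩
            have hends : ∀ a ∈ pre ++ [w], a = w ∨ a ∉ ({w} : Set S) ∪ Z := by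
              intro a ha
              simp at ha
              rcases ha with ha | rfl
              · right
                rintro (rfl | h)
                exacts [hwpre ha, hZpre a h ha]
              · exact Or.inl rfl
            have huv' : (u = w ∨ u ∉ ({w} : Set S) ∪ Z) ∧ (v = w ∨ v ∉ ({w} : Set S) ∪ Z) := by
              rcases ho with h | h | ⟨h1, h2, -, rfl⟩
              · exact ⟨hends u h.mem.1, hends v h.mem.2⟩
              · exact h.elim
              · refine ⟨Or.inr h1, hends _ ?_⟩
                have hul : u ∉ pre ++ [w, x] := by
                  simp only [List.mem_append, List.mem_cons, List.not_mem_nil, or_false, not_or]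
                  refine ⟨h2, ?_, ?_⟩
                  · rintro rfl; exact h1 (by simp)
                  · rintro rfl; exact h1 (Or.inr (hAZ hxA))
                have := hc.mem u hul
                simp only [List.mem_append, List.mem_cons, List.not_mem_nil, or_false] at this ⊢
                rcases this with h | h | h
                · exact Or.inl h
                · exact Or.inr h
                · exact absurd (Or.inr (hAZ ((memA u).2 (Or.inr ⟨hul, h⟩)))) h1
            rcases huv' with ⟨rfl | hu, rfl | hv⟩
            · exact absurd rfl huv.ne
            · exact ⟨u, rfl, hw v huv hv hc1⟩
            · exact ⟨v, rfl, hw u huv.symm hu (by rwa [Set.pair_comm])⟩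
            · exact absurd (hQ ▸ hc2) (hmiss' u v huv hu hv c hc1)
          intro u v huv hne c hc1 hc2
          have hin : ∀ a b, InnerEdge ({w} ∪ Z) w [x] [] π a b →
              a ∈ ({w} : Set S) ∪ Z ∧ b ∈ ({w} : Set S) ∪ Z := by
            have hx' : x ∈ ({w} : Set S) ∪ Z := Or.inr (hAZ hxA)
            rintro a b (h | ⟨h1, h2, rfl⟩)
            · simp at h
              rw [h.1, h.2]
              exact ⟨by simp, hx'⟩
            · refine ⟨h1, ?_⟩
              have := hloc.mem a h1 h2
              simp at this
              rcases this with e | e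
              · rw [e]; simp
              · rw [e]; exact hx'
          rcases edge_cases (Q := {w} ∪ Z) (mid := [x]) (tail := []) huv with (h | h) | (h | h)
          · exact key u v h huv c hc1 hc2
          · exact key v u h huv.symm c (by rwa [Set.pair_comm]) hc2
          · exact absurd (hin _ _ h) hne
          · exact absurd (hin _ _ h).symm hne
        · rintro v (rfl | hv)
          exacts [hwpre, hZpre v hv]
        · intro v hv hvp _ hvx
          simp only [List.mem_singleton] at hvx
          refine hv (Or.inr (hAZ ((memA v).2 (Or.inr ⟨?_, hvx⟩))))
          simp only [List.mem_append, List.mem_cons, List.not_mem_nil, or_false, not_or]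
          refine ⟨hvp, ?_, ?_⟩
          · rintro rfl; exact hv (by simp)
          · rintro rfl; exact hv (Or.inr (hAZ hxA))
      · intro v hv hvx
        exact ((memA v).1 hv).resolve_left hvx |>.2
      · intro y hy hyA
        have h := hleafY y hy hyA
        have := (hc.adj_leaf h.1).symm
        rw [h.2] at this
        exact hmiss y this hyA
    set π' : S → S := fun v => if v ∈ Z then w else π v with hπ'
    have hπ'Z : ∀ v ∈ Z, π' v = w := fun v hv => by simp only [hπ']; rw [if_pos hv]
    have hπ'' : ∀ v, v ∉ Z → π' v = π v := fun v hv => by simp only [hπ']; rw [if_neg hv]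
    have conn := hfan.conn_star hS hπ'Z fun v hv _ _ => hπ'' v hv
    have hout : ∀ v, v ∉ Z → v ≠ x ∧ (v ∉ pre ++ [w, x] → π v ≠ x) := fun v hv =>
      ⟨by rintro rfl; exact hv (hAZ hxA), fun h1 h2 => hv (hAZ ((memA v).2 (Or.inr ⟨h1, h2⟩)))⟩
    suffices h : ∃ y, Conn (catG (pre ++ [w]) π') (catG [y] fun _ => y) by
      obtain ⟨y, hy⟩ := h
      exact ⟨y, conn.trans hy⟩
    refine ih (x := w) (π := π') ?_ conn.plane_right ?_
    · refine ⟨by simp, by simpa using hc.nodup.sublist (List.Sublist.append_left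
        (l₁ := [w]) (l₂ := [w, x]) (by simp) pre), fun v hv => ?_⟩
      by_cases hvZ : v ∈ Z
      · rw [hπ'Z v hvZ]; simp
      · rw [hπ'' v hvZ]
        have hv' : v ∉ pre ++ [w, x] := by
          simp at hv ⊢
          exact ⟨hv.1, hv.2, (hout v hvZ).1⟩
        have := hc.mem v hv'
        simp at this ⊢
        rcases this with h | h | h
        exacts [Or.inl h, Or.inr h, absurd h ((hout v hvZ).2 hv')]
    · intro p s hps
      have := hfull p (s ++ [w]) (by rw [hps]; simp)
      -- The points of `Z` only change their neighbour within `D`, and every block in question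
      -- contains `D`.
      convert this using 1
      ext v
      simp only [block, Set.mem_ofPred_eq, List.append_assoc, List.singleton_append]
      by_cases hvZ : v ∈ Z
      · rw [hπ'Z v hvZ]
        have hvD := (memD v).1 (hZD hvZ)
        have hvp := hZpre v hvZ
        have hvw := hvZ.1
        have hsp : v ∉ s := fun h => hvp (by rw [hps]; simp [h])
        simp only [List.mem_append, List.mem_cons, List.not_mem_nil, or_false, or_true, and_true, hvp, hvw, hsp, false_or, or_self, not_false_eq_true, true_iff] at hvD ⊢
        have aux : ∀ a b c d : Prop, a ∨ ¬ a ∧ (b ∨ c) → a ∨ ¬ a ∧ (d ∨ b ∨ c) := by tauto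
        exact aux _ _ _ _ hvD
      · rw [hπ'' v hvZ]
        have h1 := (hout v hvZ).1
        have h2 := (hout v hvZ).2
        simp only [List.mem_append, List.mem_cons, List.not_mem_nil, h1, or_false] at h2 ⊢
        exact block_aux h2

/-- Initial blocks are separated by assumption. The spine is read backwards, so that they become the
final blocks required by `conn_star_of_full`. An empty spine means that the tree is a single edge.
-/
theorem conn_star_of_isWellSeparated (hS : GeneralPosition S) {T : SimpleGraph S}
    (hG : IsPlaneGraph T) (hT : IsCaterpillar T) (h : IsWellSeparated T) :
    ∃ y, Conn T (catG [y] fun _ => y) := by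
  obtain ⟨l, hl, hsep⟩ := h
  rcases eq_or_ne l [] with rfl | hne
  · obtain ⟨x, rfl⟩ := eq_star_of_spine_nil hT.1 hl
    exact ⟨x, .refl hG hT⟩
  obtain ⟨π, hc, rfl⟩ := exists_code hT.1 hl hne
  obtain ⟨x, t, rfl⟩ := List.exists_cons_of_ne_nil hne
  have hrev : (x :: t).reverse = t.reverse ++ [x] := by simp
  rw [← catG_reverse, hrev] at hG ⊢
  refine conn_star_of_full hS (hrev ▸ hc.reverse) hG fun p s hps => ?_
  have ht : t = s.reverse ++ p.reverse := by
    rw [← List.reverse_append, ← hps, List.reverse_reverse]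
  have htake : (x :: t).take (s.length + 1) = x :: s.reverse := by
    rw [ht]; simp
  have := hsep (s.length + 1) (by omega) (by rw [ht]; simp)
  have key : ∀ v : S, (v : Plane) ∈ initialPoints (catG (x :: t) π) (x :: t) (s.length + 1) ↔
      v ∈ block (t.reverse ++ [x]) (s ++ [x]) π := by
    intro v
    simp only [initialPoints, block, htake, Set.mem_ofPred_eq]
    constructor
    · rintro ⟨u, hu, hv⟩
      obtain rfl := Subtype.ext hu
      rcases hv with hv | ⟨h1, a, ha, hau⟩
      · left
        simp at hv ⊢; tauto
      · right
        have hul : u ∉ x :: t := fun h => (hl.2.1 u).1 h h1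
        have : a = π u := h1.unique hau.symm (hc.adj_leaf hul)
        subst this
        simp at hul ha ⊢; tauto
    · rintro (hv | ⟨h1, h2⟩)
      · refine ⟨v, rfl, Or.inl ?_⟩
        simp at hv ⊢; tauto
      · have hvl : v ∉ x :: t := by simp at h1 ⊢; tauto
        refine ⟨v, rfl, Or.inr ⟨hc.isLeaf hvl, π v, ?_, (hc.adj_leaf hvl).symm⟩⟩
        simp at h2 ⊢; tauto
  intro v hv
  rw [← key]
  by_contra hv'
  refine Set.disjoint_left.1 this (?_ : (v : Plane) ∈ _) ⟨v.2, hv'⟩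
  refine convexHull_mono ?_ hv
  rintro _ ⟨u, hu, rfl⟩
  exact (key u).2 hu

theorem conn_of_isWellSeparated (hS : GeneralPosition S) {T T' : SimpleGraph S}
    (hG : IsPlaneGraph T) (hT : IsCaterpillar T) (h : IsWellSeparated T)
    (hG' : IsPlaneGraph T') (hT' : IsCaterpillar T') (h' : IsWellSeparated T') : Conn T T' := by
  obtain ⟨y, hy⟩ := conn_star_of_isWellSeparated hS hG hT h
  obtain ⟨z, hz⟩ := conn_star_of_isWellSeparated hS hG' hT' h'
  rcases eq_or_ne y z with rfl | hyz
  · exact hy.trans hz.symm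
  · exact hy.trans ((conn_star_star hS hyz).trans hz.symm)

/-! ### Trees that hang on a root. -/

section
variable {V : Type*}

/-- The tree with spine `v :: t`, such that the other points of `R` are leaves given by `ρ`. -/
def localG (v : V) (t : List V) (ρ : V → V) (R : Set V) : SimpleGraph V :=
  SimpleGraph.fromRel fun a b => Consec (v :: t) a b ∨ (a ∈ R ∧ a ∉ t ∧ b = ρ a)

lemma localG_adj {v : V} {t : List V} {ρ : V → V} {R : Set V} {a b : V} :
    (localG v t ρ R).Adj a b ↔ a ≠ b ∧ ((Consec (v :: t) a b ∨ (a ∈ R ∧ a ∉ t ∧ b = ρ a)) ∨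
      (Consec (v :: t) b a ∨ (b ∈ R ∧ b ∉ t ∧ a = ρ b))) :=
  SimpleGraph.fromRel_adj ..

/-- The star which joins `v` to the points of `R`. -/
def starG (v : V) (R : Set V) : SimpleGraph V := localG v [] (fun _ => v) R

lemma starG_adj {v : V} {R : Set V} {a b : V} :
    (starG v R).Adj a b ↔ a ≠ b ∧ ((a ∈ R ∧ b = v) ∨ (b ∈ R ∧ a = v)) := by
  simp [starG, localG_adj]

/-- The spine `v :: t` and `ρ` describe a tree on `R` and `v`. -/
structure LocalCode (v : V) (R : Set V) (t : List V) (ρ : V → V) : Prop where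
  not_mem : v ∉ R
  sub : ∀ a ∈ t, a ∈ R
  nodup : t.Nodup
  leaf : ∀ z ∈ R, z ∉ t → ρ z ∈ v :: t

namespace LocalCode
variable {v : V} {R : Set V} {t : List V} {ρ : V → V} {a b q : V}

lemma nodup' (h : LocalCode v R t ρ) : (v :: t).Nodup :=
  List.nodup_cons.2 ⟨fun hv => h.not_mem (h.sub v hv), h.nodup⟩

lemma mem (h : LocalCode v R t ρ) (ha : a ∈ v :: t) : a = v ∨ a ∈ R := by
  rcases List.mem_cons.1 ha with h' | h'
  exacts [Or.inl h', Or.inr (h.sub a h')]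

lemma support (h : LocalCode v R t ρ) (hab : (localG v t ρ R).Adj a b) :
    (a = v ∨ a ∈ R) ∧ (b = v ∨ b ∈ R) := by
  rcases (localG_adj.1 hab).2 with (h1 | ⟨h1, h2, rfl⟩) | (h1 | ⟨h1, h2, rfl⟩)
  · exact ⟨h.mem h1.mem.1, h.mem h1.mem.2⟩
  · exact ⟨Or.inr h1, h.mem (h.leaf _ h1 h2)⟩
  · exact ⟨h.mem h1.mem.2, h.mem h1.mem.1⟩
  · exact ⟨h.mem (h.leaf _ h1 h2), Or.inr h1⟩

lemma exists_consec {l : List V} {x z : V} (hz : z ∈ l) : ∃ a, Consec (x :: l) a z := by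
  induction l generalizing x with
  | nil => simp at hz
  | cons y l ih =>
    rcases List.mem_cons.1 hz with rfl | hz
    · exact ⟨x, by simp⟩
    · obtain ⟨a, ha⟩ := ih hz (x := y)
      exact ⟨a, by simp [ha]⟩

lemma exists_adj (h : LocalCode v R t ρ) (ha : a ∈ R) : ∃ u, (localG v t ρ R).Adj a u := by
  by_cases hat : a ∈ t
  · obtain ⟨u, hu⟩ := exists_consec (x := v) hat
    exact ⟨u, localG_adj.2 ⟨(hu.ne h.nodup').symm, Or.inr (Or.inl hu)⟩⟩
  · refine ⟨ρ a, localG_adj.2 ⟨fun e => ?_, Or.inl (Or.inr ⟨ha, hat, rfl⟩)⟩⟩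
    rcases List.mem_cons.1 (h.leaf a ha hat) with e' | h'
    · exact h.not_mem (e' ▸ e ▸ ha)
    · exact hat (e ▸ h')

lemma not_consec_left (h : LocalCode v R t ρ) : ¬ Consec (v :: t) a v := by
  have hn := h.nodup'
  intro hc
  cases t with
  | nil => exact hc.elim
  | cons x t =>
    rw [consec_cons_cons] at hc
    rcases hc with ⟨-, rfl⟩ | hc
    · simp at hn
    · exact (List.nodup_cons.1 hn).1 hc.mem.2

/-- At most one neighbour of `v` has further neighbours, namely the first vertex of `t`. -/
lemma eq_head (h : LocalCode v R t ρ) (hq : (localG v t ρ R).Adj v q)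
    (hu : ∃ u, u ≠ v ∧ (localG v t ρ R).Adj q u) : ∃ t', t = q :: t' := by
  by_cases hqt : q ∈ t
  · rcases (localG_adj.1 hq).2 with (h1 | ⟨h1, -⟩) | (h1 | ⟨-, h2, -⟩)
    · cases t with
      | nil => exact h1.elim
      | cons x t =>
        rw [consec_cons_cons] at h1
        rcases h1 with ⟨-, rfl⟩ | h1
        · exact ⟨t, rfl⟩
        · exact absurd (h.sub v h1.mem.1) h.not_mem
    · exact absurd h1 h.not_mem
    · exact absurd h1 h.not_consec_left
    · exact absurd hqt h2
  · obtain ⟨u, huv, hqu⟩ := hu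
    have hqv : q ≠ v := hq.ne.symm
    have key : ∀ w, (localG v t ρ R).Adj q w → w = ρ q := by
      intro w hw
      rcases (localG_adj.1 hw).2 with (h1 | ⟨-, -, h1⟩) | (h1 | ⟨h1, h2, h3⟩)
      · exact absurd h1.mem.1 (by simp [hqv, hqt])
      · exact h1
      · exact absurd h1.mem.2 (by simp [hqv, hqt])
      · have := h.leaf w h1 h2
        rw [← h3] at this
        exact absurd this (by simp [hqv, hqt])
    exact absurd ((key u hqu).trans (key v hq.symm).symm) huv

/-- If the spine is empty, or if its first vertex has no neighbour but `v`, then every edge ends in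
`v`. Excluding the star thus forces a branch, which by `eq_head` is unique. -/
lemma exists_branch (h : LocalCode v R t ρ) (hne : localG v t ρ R ≠ starG v R) :
    ∃ q ∈ R, (localG v t ρ R).Adj v q ∧ ∃ u, u ≠ v ∧ (localG v t ρ R).Adj q u := by
  cases t with
  | nil =>
    refine absurd ?_ hne
    ext a b
    rw [localG_adj, starG_adj]
    have h1 : ∀ z ∈ R, ρ z = v := fun z hz => by simpa using h.leaf z hz (by simp)
    simp only [consec_singleton, List.not_mem_nil, not_false_eq_true, true_and, false_or]
    refine and_congr_right fun _ => or_congr (and_congr_right fun ha => by rw [h1 a ha])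
      (and_congr_right fun ha => by rw [h1 b ha])
  | cons q t =>
    have hqR := h.sub q (by simp)
    have hqv : q ≠ v := fun e => h.not_mem (e ▸ hqR)
    have hvq : (localG v (q :: t) ρ R).Adj v q := localG_adj.2 ⟨hqv.symm, Or.inl (Or.inl (by simp))⟩
    refine ⟨q, hqR, hvq, ?_⟩
    by_contra! hno
    cases t with
    | cons x t =>
      have hn := h.nodup'
      simp at hn
      refine hno x (fun e => ?_) (localG_adj.2 ⟨?_, Or.inl (Or.inl (by simp))⟩)
      · exact hn.1.2.1 e.symm
      · exact fun e => hn.2.1.1 e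
    | nil =>
      have h1 : ∀ z ∈ R, z ≠ q → ρ z = v := fun z hz hzq => by
        have := h.leaf z hz (by simpa using hzq)
        simp only [List.mem_cons, List.not_mem_nil, or_false] at this
        refine this.resolve_right fun e => hno z (fun e' => h.not_mem (e' ▸ hz)) ?_
        exact localG_adj.2 ⟨hzq.symm, Or.inr (Or.inr ⟨hz, by simpa using hzq, e.symm⟩)⟩
      refine hne ?_
      ext a b
      rw [localG_adj, starG_adj]
      simp only [consec_cons_cons, consec_singleton, or_false, List.mem_singleton]
      refine and_congr_right fun hab => ?_
      constructor
      · rintro ((⟨rfl, rfl⟩ | ⟨h2, h3, rfl⟩) | (⟨rfl, rfl⟩ | ⟨h2, h3, rfl⟩))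
        exacts [Or.inr ⟨hqR, rfl⟩, Or.inl ⟨h2, h1 _ h2 h3⟩, Or.inl ⟨hqR, rfl⟩,
          Or.inr ⟨h2, h1 _ h2 h3⟩]
      · rintro (⟨h2, rfl⟩ | ⟨h2, rfl⟩)
        · by_cases e : a = q
          · exact Or.inr (Or.inl ⟨rfl, e⟩)
          · exact Or.inl (Or.inr ⟨h2, e, (h1 a h2 e).symm⟩)
        · by_cases e : b = q
          · exact Or.inl (Or.inl ⟨rfl, e⟩)
          · exact Or.inr (Or.inr ⟨h2, e, (h1 b h2 e).symm⟩)

end LocalCode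

lemma sup_aux {N X Y P P' M M' : Prop} (h1 : N → (X ↔ P ∨ M)) (h2 : N → (Y ↔ P' ∨ M')) :
    N ∧ (X ∨ Y) ↔ (N ∧ (P ∨ P')) ∨ (N ∧ (M ∨ M')) := by tauto

lemma localG_leaf {v p : V} {t : List V} {ρ ρ' : V → V} {R : Set V} (hp : p ∈ R) (hpt : p ∉ t)
    (h : ∀ z ∈ R, z ≠ p → ρ' z = ρ z) (hρ : ρ' p = v) :
    localG v t ρ' R = localG v t ρ (R \ {p}) ⊔ starG v {p} := by
  have key : ∀ a b, (a ∈ R ∧ a ∉ t ∧ b = ρ' a) ↔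
      ((a ∈ R \ {p} ∧ a ∉ t ∧ b = ρ a) ∨ (a ∈ ({p} : Set V) ∧ b = v)) := by
    intro a b
    by_cases e : a = p
    · subst e
      simp [hp, hpt, hρ]
    · simp only [Set.mem_sdiff, Set.mem_singleton_iff, e, not_false_eq_true, and_true, false_and,
        or_false]
      refine and_congr_right fun ha => ?_
      rw [h a ha e]
  ext a b
  rw [SimpleGraph.sup_adj, localG_adj, localG_adj, starG_adj]
  exact sup_aux (fun _ => by rw [key, or_assoc]) fun _ => by rw [key, or_assoc]

lemma localG_cons {v q : V} {t : List V} {ρ ρ' : V → V} {R B : Set V} (hv : v ∉ R) (hq : q ∈ R)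
    (hB : B ⊆ R) (hqB : q ∉ B) (ht : ∀ a ∈ t, a ∈ B) (h : ∀ z ∈ B, ρ' z = ρ z)
    (h' : ∀ z ∈ R, z ∉ B → ρ' z = q) :
    localG v (q :: t) ρ' R = localG q t ρ B ⊔ starG q (insert v (R \ B) \ {q}) := by
  have hvq : v ≠ q := fun e => hv (e ▸ hq)
  have key : ∀ a b, a ≠ b → ((Consec (v :: q :: t) a b ∨ (a ∈ R ∧ a ∉ q :: t ∧ b = ρ' a)) ↔
      ((Consec (q :: t) a b ∨ (a ∈ B ∧ a ∉ t ∧ b = ρ a)) ∨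
        (a ∈ insert v (R \ B) \ {q} ∧ b = q))) := by
    intro a b hab
    rw [consec_cons_cons]
    by_cases haB : a ∈ B
    · have h1 : a ≠ q := fun e => hqB (e ▸ haB)
      have h2 : a ≠ v := fun e => hv (e ▸ hB haB)
      simp [haB, hB haB, h1, h2, h a haB]
    · have hat : a ∉ t := fun h => haB (ht a h)
      by_cases hav : a = v
      · subst hav
        simp [hvq, hv, haB, or_comm]
      · by_cases haR : a ∈ R
        · rw [h' a haR haB]
          simp [haB, hav, haR, hat]
        · simp [haB, hav, haR]
  ext a b
  rw [SimpleGraph.sup_adj, localG_adj, localG_adj, starG_adj]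
  exact sup_aux (fun hab => key a b hab) fun hab => key b a hab.symm

/-- `G` has no edge inside `Q`, so the tree is recovered as the part of the union inside `Q`. This
makes the constructions of good trees injective. -/
lemma eq_of_sup_eq {Q : Set V} {T₁ T₂ G : SimpleGraph V} (h1 : ∀ a b, T₁.Adj a b → a ∈ Q ∧ b ∈ Q)
    (h2 : ∀ a b, T₂.Adj a b → a ∈ Q ∧ b ∈ Q) (hG : ∀ a b, G.Adj a b → a ∈ Q → b ∉ Q)
    (h : T₁ ⊔ G = T₂ ⊔ G) : T₁ = T₂ := by
  have key : ∀ a b, T₁.Adj a b ∨ G.Adj a b ↔ T₂.Adj a b ∨ G.Adj a b := fun a b => by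
    rw [← SimpleGraph.sup_adj, ← SimpleGraph.sup_adj, h]
  ext a b
  constructor
  · intro hab
    exact ((key a b).1 (Or.inl hab)).resolve_right fun h' =>
      hG a b h' (h1 a b hab).1 (h1 a b hab).2
  · intro hab
    exact ((key a b).2 (Or.inl hab)).resolve_right fun h' =>
      hG a b h' (h2 a b hab).1 (h2 a b hab).2

end

/-! ### Good trees and their constructions. -/

lemma exists_pos_of_not_mem_hull' {σ : ℝ} (hσ : σ ≠ 0) {w : S} {A : Set S}
    (hw : (w : Plane) ∉ hull A) : ∃ r : Plane, ∀ z ∈ A, 0 < area σ w r z := by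
  obtain ⟨r, hr⟩ := exists_pos_of_not_mem_hull hw
  refine ⟨w + σ⁻¹ • (r - w), fun z hz => ?_⟩
  have : area σ w (w + σ⁻¹ • (r - w)) z = area 1 w r z := by
    simp only [area, PiLp.add_apply, PiLp.smul_apply, PiLp.sub_apply, smul_eq_mul]
    field_simp
    ring
  rw [this]
  exact hr z hz

/-- A tree on `v` and `R` is good if in every caterpillar which ends in it, it can be transformed
into the star at `v`. -/
def Good (v : S) (R : Set S) (T : SimpleGraph S) : Prop :=
  ∃ t ρ, LocalCode v R t ρ ∧ T = localG v t ρ R ∧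
    ∀ (pre : List S) (π π' : S → S), Ctx {v} ({v} ∪ R) pre v [] π → (∀ z ∈ R, π z = ρ z) →
      (∀ z ∈ R, π' z = v) → (∀ z, z ∉ R → π' z = π z) →
      Conn (catG (pre ++ v :: t) π) (catG (pre ++ [v]) π')

namespace Good
variable {v q p : S} {R B : Set S} {T : SimpleGraph S}

lemma support (h : Good v R T) {a b : S} (hab : T.Adj a b) : (a = v ∨ a ∈ R) ∧ (b = v ∨ b ∈ R) := by
  obtain ⟨t, ρ, hc, rfl, -⟩ := h
  exact hc.support hab

lemma exists_adj (h : Good v R T) (hp : p ∈ R) : ∃ u, T.Adj p u := by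
  obtain ⟨t, ρ, hc, rfl, -⟩ := h
  exact hc.exists_adj hp

lemma branch_unique (h : Good v R T) {q' : S} (hq : T.Adj v q) (hu : ∃ u, u ≠ v ∧ T.Adj q u)
    (hq' : T.Adj v q') (hu' : ∃ u, u ≠ v ∧ T.Adj q' u) : q = q' := by
  obtain ⟨t, ρ, hc, rfl, -⟩ := h
  obtain ⟨t₁, h1⟩ := hc.eq_head hq hu
  obtain ⟨t₂, h2⟩ := hc.eq_head hq' hu'
  rw [h1] at h2
  exact (List.cons.inj h2).1

lemma exists_branch (h : Good v R T) (hne : T ≠ starG v R) :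
    ∃ q ∈ R, T.Adj v q ∧ ∃ u, u ≠ v ∧ T.Adj q u := by
  obtain ⟨t, ρ, hc, rfl, -⟩ := h
  exact hc.exists_branch hne

lemma star (hS : GeneralPosition S) (hv : v ∉ R) : Good v R (starG v R) := by
  refine ⟨[], fun _ => v, ⟨hv, by simp, by simp, by simp⟩, rfl, fun pre π π' h hπ hπ' hrest => ?_⟩
  have hst : ∀ z ∈ ({v} : Set S) ∪ R, z ≠ v → z ∉ [] → π z = v := fun z hz hzv _ =>
    hπ z (hz.resolve_left hzv)
  have e : catG (pre ++ [v]) π = catG (pre ++ [v]) π' := by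
    refine catG_congr fun z hz => ?_
    by_cases hzR : z ∈ R
    · rw [hπ z hzR, hπ' z hzR]
    · exact (hrest z hzR).symm
  rw [← e]
  exact .refl (h.plane_star hS hst) (h.isCode_star hst).isCaterpillar

/-- A leaf of `v` is added on the boundary of the angular order. -/
lemma add_leaf (hS : GeneralPosition S) (h : Good v (R \ {p}) T) (hv : v ∉ R) (hp : p ∈ R) {τ : ℝ}
    (hside : ∀ z ∈ R, z ≠ p → 0 < area τ v p z) : Good v R (T ⊔ starG v {p}) := by
  classical
  obtain ⟨t, ρ, hc, rfl, hT⟩ := h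
  have hpt : p ∉ t := fun h => (hc.sub p h).2 rfl
  have hpv : p ≠ v := fun e => hv (e ▸ hp)
  set ρ' : S → S := fun z => if z = p then v else ρ z with hρ'
  have hρ'p : ρ' p = v := by simp [hρ']
  have hρ'' : ∀ z, z ≠ p → ρ' z = ρ z := fun z hz => by simp only [hρ']; rw [if_neg hz]
  refine ⟨t, ρ', ⟨hv, fun a ha => (hc.sub a ha).1, hc.nodup, ?_⟩,
    (localG_leaf hp hpt (fun z _ hz => hρ'' z hz) hρ'p).symm, fun pre π π' h hπ hπ' hrest => ?_⟩
  · intro z hz hzt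
    by_cases hzp : z = p
    · rw [hzp, hρ'p]; simp
    · rw [hρ'' z hzp]; exact hc.leaf z ⟨hz, hzp⟩ hzt
  have h' : Ctx {v} ({v} ∪ R) pre v [] π' := h.congr fun z hz _ _ => hrest z fun h => hz (Or.inr h)
  have hst : ∀ z ∈ ({v} : Set S) ∪ R, z ≠ v → z ∉ [] → π' z = v := fun z hz hzv _ =>
    hπ' z (hz.resolve_left hzv)
  have hsub : ({v} : Set S) ∪ (R \ {p}) ⊆ {v} ∪ R :=
    Set.union_subset_union_right _ Set.sdiff_subset
  have hpp : π p = v := by rw [hπ p hp, hρ'p]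
  have hmeet : ∀ c ∈ hull {v, p}, c ∈ hull (({v} : Set S) ∪ (R \ {p})) → c = v := by
    intro c hc1 hc2
    refine hull_face (σ := τ) (c := 0) (a := v) (b := p) (by simp) ?_ hc2 ?_
    · rintro a (rfl | ha) hav
      exacts [absurd rfl hav, hside a ha.1 ha.2]
    · refine hull_area_le ?_ hc1
      rintro a (rfl | rfl) <;> simp
  refine hT pre π π' ?_ (fun z hz => by rw [hπ z hz.1, hρ'' z hz.2]) (fun z hz => hπ' z hz.1) ?_
  · refine Ctx.congr (π := π') ?_ ?_
    · refine Ctx.of_clean (mid := []) (h'.isCode_star hst) (h'.plane_star hS hst) ?_ ?_ (by simp)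
        (by simp) (fun z hz => h.disj_pre z (hsub hz)) (by simp) (by simp) (by simp)
      · refine h'.clean_sub (mid := []) hsub (fun o ho _ => ho) ?_
        rintro a b (hab | ⟨ha, ha', rfl⟩) hne c hc1 hc2
        · exact hab.elim
        · simp at ha'
          have haR : a ∈ R := ha.resolve_left ha'
          rw [hπ' a haR] at hc1 hne
          rw [Set.pair_comm] at hc1
          by_cases hap : a = p
          · subst hap
            exact ⟨v, rfl, hmeet c hc1 hc2⟩
          · exact absurd ⟨Or.inr ⟨haR, hap⟩, by simp⟩ hne
      · refine h.full.sub hsub ?_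
        rintro z (rfl | hz) hz'
        · simp
        · by_cases hzp : z = p
          · subst hzp
            exact absurd (Subtype.ext (hmeet z (mem_hull (by simp)) hz')) hpv
          · exact Or.inr ⟨hz, hzp⟩
    · intro z hz _ _
      by_cases hzp : z = p
      · rw [hzp, hpp, hπ' p hp]
      · exact (hrest z fun hzR => hz (Or.inr ⟨hzR, hzp⟩)).symm
  · intro z hz
    by_cases hzp : z = p
    · rw [hzp, hpp, hπ' p hp]
    · exact hrest z fun hzR => hz ⟨hzR, hzp⟩

/-- The point `v` is a leaf of `q`, the points on one side are leaves of `q`, and the points on the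
other side form a good tree. -/
lemma add_root (hS : GeneralPosition S) (h : Good q B T) (hv : (v : Plane) ∉ hull R) (hq : q ∈ R)
    (hB : B ⊆ R) {τ : ℝ} (hpos : ∀ z ∈ B, 0 < area τ v q z)
    (hneg : ∀ z ∈ R, z ≠ q → z ∉ B → area τ v q z < 0) :
    Good v R (T ⊔ starG q (insert v (R \ B) \ {q})) := by
  classical
  obtain ⟨t, ρ, hc, rfl, hT⟩ := h
  have hvR : v ∉ R := fun h => hv (mem_hull h)
  have hqv : q ≠ v := fun e => hvR (e ▸ hq)
  set ρ' : S → S := fun z => if z ∈ B then ρ z else q with hρ'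
  have hρB : ∀ z ∈ B, ρ' z = ρ z := fun z hz => by simp only [hρ']; rw [if_pos hz]
  have hρB' : ∀ z, z ∉ B → ρ' z = q := fun z hz => by simp only [hρ']; rw [if_neg hz]
  refine ⟨q :: t, ρ', ⟨hvR, ?_, hc.nodup', ?_⟩, (localG_cons hvR hq hB hc.not_mem hc.sub hρB
    fun z _ => hρB' z).symm, fun pre π π' h hπ hπ' hrest => ?_⟩
  · intro a ha
    rcases List.mem_cons.1 ha with rfl | ha
    exacts [hq, hB (hc.sub a ha)]
  · intro z hz hzt
    by_cases hzB : z ∈ B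
    · rw [hρB z hzB]
      exact List.mem_cons_of_mem _ (hc.leaf z hzB fun h => hzt (List.mem_cons_of_mem _ h))
    · rw [hρB' z hzB]; simp
  set π₁ : S → S := fun z => if z ∈ R then q else π z with hπ₁
  have hπ₁R : ∀ z ∈ R, π₁ z = q := fun z hz => by simp only [hπ₁]; rw [if_pos hz]
  have hπ₁' : ∀ z, z ∉ R → π₁ z = π z := fun z hz => by simp only [hπ₁]; rw [if_neg hz]
  have h' : Ctx {v} ({v} ∪ R) pre v [] π' := h.congr fun z hz _ _ => hrest z fun h => hz (Or.inr h)
  have h₁ : Ctx {v} ({v} ∪ R) pre v [] π₁ := h.congr fun z hz _ _ => hπ₁' z fun h => hz (Or.inr h)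
  obtain ⟨r, hr⟩ := exists_pos_of_not_mem_hull' one_ne_zero hv
  -- The star at `v` is transformed into the star at `q`, with spine end `v, q`. The good tree at
  -- `q` is then unfolded behind the prefix `pre ++ [v]`.
  have conn1 : Conn (catG (pre ++ [v]) π') (catG (pre ++ [v, q]) π₁) := by
    refine conn_star_end hS one_ne_zero h' (r := r) (fun z hz hzv => hr z (hz.resolve_left hzv))
      (fun z hz hzv => hπ' z (hz.resolve_left hzv)) (Or.inr hq) hqv (fun z hz _ => ?_)
      (fun z hz hzv _ => hπ₁R z (hz.resolve_left hzv))
    have hzR : z ∉ R := fun h => hz (Or.inr h)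
    rw [hπ₁' z hzR, hrest z hzR]
  have hsub : ({q} : Set S) ∪ B ⊆ R := by
    rintro z (rfl | hz)
    exacts [hq, hB hz]
  have hge : ∀ z ∈ ({q} : Set S) ∪ B, 0 ≤ area τ v q z := by
    rintro z (rfl | hz)
    exacts [by simp, (hpos z hz).le]
  have hloc : LocalSpine ({v} ∪ R) v [q] [] π₁ := by
    refine ⟨by simpa using Or.inr hq, by simpa using hqv.symm, fun z hz hz' => ?_⟩
    simp at hz' ⊢
    exact Or.inr (hπ₁R z (hz.resolve_left hz'.1))
  have e : pre ++ [v] ++ q :: ([] ++ []) = pre ++ v :: ([q] ++ []) := by simp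
  have hctx : Ctx {q} ({q} ∪ B) (pre ++ [v]) q [] π := by
    refine Ctx.congr (π := π₁) ?_ ?_
    · refine Ctx.of_clean (mid := []) (e ▸ h₁.isCode hloc) (e ▸ conn1.plane_right) ?_ ?_ (by simp)
        (by simp) ?_ (by simp) (by simp) (by simp)
      · rw [e]
        refine h₁.clean_sub (mid := [q]) (hsub.trans Set.subset_union_right) ?_ ?_
        · rintro o rfl ho
          exact absurd (hull_mono hsub ho) hv
        · rintro a b (hab | ⟨ha, ha', rfl⟩) hne c hc1 hc2
          · simp at hab
            obtain ⟨rfl, rfl⟩ := hab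
            refine ⟨b, rfl, hull_face (σ := τ) (c := 0) (a := a) (b := b) (by simp) ?_ hc2 ?_⟩
            · rintro z (rfl | hz) hzb
              exacts [absurd rfl hzb, hpos z hz]
            · refine hull_area_le ?_ hc1
              rintro z (rfl | rfl) <;> simp
          · simp at ha'
            have haR : a ∈ R := ha.resolve_left ha'.1
            rw [hπ₁R a haR] at hc1 hne
            rw [Set.pair_comm] at hc1
            exact ⟨q, rfl, segment_meet_of_ge (σ := τ) (c := 0) (a := v) (b := q) (by simp)
              (hneg a haR ha'.2 fun h => hne ⟨Or.inr h, by simp⟩) hge hc1 hc2⟩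
      · refine h.full.sub (hsub.trans Set.subset_union_right) ?_
        rintro z (rfl | hz) hz'
        · exact absurd (hull_mono hsub hz') hv
        · by_contra hzQ
          have hzq : z ≠ q := fun e => hzQ (by simp [e])
          linarith [hneg z hz hzq fun h => hzQ (Or.inr h), hull_area_ge hge hz']
      · intro z hz
        simp only [List.mem_append, List.mem_singleton, not_or]
        exact ⟨h.disj_pre z (Or.inr (hsub hz)), fun e => hvR (e ▸ hsub hz)⟩
    · intro z hz _ _
      by_cases hzR : z ∈ R
      · rw [hπ₁R z hzR, hπ z hzR, hρB' z fun h => hz (Or.inr h)]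
      · exact (hπ₁' z hzR).symm
  have conn2 := hT (pre ++ [v]) π π₁ hctx (fun z hz => by rw [hπ z (hB hz), hρB z hz])
    (fun z hz => hπ₁R z (hB hz)) (fun z hz => by
      by_cases hzR : z ∈ R
      · rw [hπ₁R z hzR, hπ z hzR, hρB' z hz]
      · exact hπ₁' z hzR)
  simp only [List.append_assoc, List.singleton_append] at conn2
  exact conn2.trans conn1.symm

lemma ctx_univ (hv : ({v} : Set S) ∪ R = Set.univ) (π : S → S) : Ctx {v} ({v} ∪ R) [] v [] π := by
  rw [hv]
  exact ⟨by simp, trivial, by simp, by simp, by simp, by simp, fun _ _ => trivial, by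
    rintro u v (h | h | ⟨h, -⟩)
    exacts [h.elim, h.elim, absurd trivial h], by
    rintro a b c d (h | h | ⟨h, -⟩)
    exacts [h.elim, h.elim, absurd trivial h]⟩

lemma localG_eq_catG {t : List S} {ρ : S → S} (hv : ({v} : Set S) ∪ R = Set.univ) (hvR : v ∉ R) :
    localG v t ρ R = catG (v :: t) ρ := by
  have key : ∀ a b, (a ∈ R ∧ a ∉ t ∧ b = ρ a) ↔ (a ∉ v :: t ∧ b = ρ a) := by
    intro a b
    have : a ∈ R ↔ a ≠ v := by
      constructor
      · rintro h rfl; exact hvR h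
      · intro h
        have : a ∈ ({v} : Set S) ∪ R := hv ▸ Set.mem_univ a
        exact this.resolve_left h
    rw [this, List.mem_cons, not_or, and_assoc]
  ext a b
  rw [localG_adj, catG_adj, key, key]

lemma conn (h : Good v R T) (hv : ({v} : Set S) ∪ R = Set.univ) :
    Conn T (catG [v] fun _ => v) := by
  classical
  obtain ⟨t, ρ, hc, rfl, hT⟩ := h
  rw [localG_eq_catG hv hc.not_mem]
  have e : catG ([] ++ [v]) (fun z => if z ∈ R then v else ρ z) = catG [v] fun _ => v := by
    refine catG_congr fun z hz => ?_
    have : z ∈ ({v} : Set S) ∪ R := hv ▸ Set.mem_univ z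
    rw [if_pos (this.resolve_left (by simpa using hz))]
  have := hT [] ρ (fun z => if z ∈ R then v else ρ z) (ctx_univ hv ρ) (fun _ _ => rfl)
    (fun z hz => if_pos hz) (fun z hz => if_neg hz)
  rwa [e] at this

lemma sup_aux_reverse {N C C' D D' M M' P P' : Prop} :
    N ∧ (((C' ∨ D) ∨ (M ∨ P)) ∨ ((C ∨ D') ∨ (M' ∨ P'))) ↔
      (N ∧ ((C ∨ M) ∨ (C' ∨ M'))) ∨ (N ∧ ((D ∨ P) ∨ (D' ∨ P'))) := by tauto

/-- Two good trees on both sides of a line through `v`. -/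
lemma conn_sup (hS : GeneralPosition S) {L : Set S} {T₁ T₂ : SimpleGraph S} (h1 : Good v L T₁)
    (h2 : Good v R T₂) (hv : ({v} : Set S) ∪ (L ∪ R) = Set.univ) {b : Plane} {σ : ℝ}
    (hL : ∀ z ∈ L, area σ v b z ≤ 0) (hR : ∀ z ∈ R, 0 < area σ v b z) :
    Conn (T₁ ⊔ T₂) (catG [v] fun _ => v) := by
  classical
  obtain ⟨t₁, ρ₁, hc₁, rfl, hT₁⟩ := h1
  obtain ⟨t₂, ρ₂, hc₂, rfl, hT₂⟩ := h2
  have hcov : ∀ z, z ≠ v → z ∉ L → z ∈ R := by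
    intro z h1 h2
    have : z ∈ ({v} : Set S) ∪ (L ∪ R) := hv ▸ Set.mem_univ z
    exact (this.resolve_left h1).resolve_left h2
  have hLR : ∀ z ∈ L, z ∉ R := fun z h1 h2 => by linarith [hL z h1, hR z h2]
  set π₀ : S → S := fun _ => v with hπ₀
  set π₁ : S → S := fun z => if z ∈ L then ρ₁ z else v with hπ₁
  set π₂ : S → S := fun z => if z ∈ R then ρ₂ z else π₁ z with hπ₂
  have hleL : ∀ z ∈ ({v} : Set S) ∪ L, area σ v b z ≤ 0 := by
    rintro z (rfl | hz)
    exacts [by simp, hL z hz]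
  have hposR : ∀ z ∈ ({v} : Set S) ∪ R, z ≠ v → 0 < area σ v b z := by
    rintro z (rfl | hz) hzv
    exacts [absurd rfl hzv, hR z hz]
  have hgeR : ∀ z ∈ ({v} : Set S) ∪ R, 0 ≤ area σ v b z := by
    rintro z (rfl | hz)
    exacts [by simp, (hR z hz).le]
  have hmeet : ∀ c ∈ hull (({v} : Set S) ∪ R), c ∈ hull (({v} : Set S) ∪ L) → c = v := by
    intro c hc1 hc2
    exact hull_face (σ := σ) (c := 0) (a := v) (b := b) (u := v) (by simp)
      (fun q hq hqv => hposR q hq fun e => hqv (e ▸ rfl)) hc1 (hull_area_le hleL hc2)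
  have huniv : ({v} : Set S) ∪ ({v}ᶜ : Set S) = Set.univ := Set.union_compl_self _
  have h0 := ctx_univ huniv π₀
  have hst : ∀ z ∈ ({v} : Set S) ∪ {v}ᶜ, z ≠ v → z ∉ [] → π₀ z = v := fun _ _ _ _ => rfl
  have hsubL : ({v} : Set S) ∪ L ⊆ {v} ∪ {v}ᶜ := by rw [huniv]; exact Set.subset_univ _
  have hctx1 : Ctx {v} ({v} ∪ L) [] v [] π₁ := by
    refine Ctx.congr (π := π₀) ?_ fun z hz _ _ => by
      simp only [hπ₁]; rw [if_neg fun h => hz (Or.inr h)]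
    refine Ctx.of_clean (mid := []) (h0.isCode_star hst) (h0.plane_star hS hst) ?_ ?_ (by simp)
      (by simp) (by simp) (by simp) (by simp) (by simp)
    · refine h0.clean_sub (mid := []) hsubL (fun o ho _ => ho) ?_
      rintro a c (hab | ⟨ha, ha', hcv⟩) hne d hd hd'
      · exact hab.elim
      · simp at ha'
        rw [show c = v from hcv] at hd hne
        rw [Set.pair_comm] at hd
        have haL : a ∉ L := fun h => hne ⟨Or.inr h, Or.inl rfl⟩
        refine ⟨v, rfl, hmeet d (hull_mono ?_ hd) hd'⟩
        intro z hz
        rcases hz with hz | hz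
        · exact Or.inl hz
        · exact Or.inr (hcov z (hz ▸ ha') (hz ▸ haL))
    · intro z hz
      by_contra hz'
      simp at hz'
      linarith [hR z (hcov z hz'.1 hz'.2), hull_area_le hleL hz]
  -- The left tree is folded while the points of `R` are leaves of `v`.
  have conn1 := hT₁ [] π₁ π₀ hctx1 (fun z hz => by simp only [hπ₁]; rw [if_pos hz])
    (fun _ _ => rfl) (fun z hz => by simp only [hπ₁]; rw [if_neg hz])
  have hcode1 : IsCode (v :: t₁) π₁ := by
    refine ⟨by simp, hc₁.nodup', fun z hz => ?_⟩
    simp only [List.mem_cons, not_or] at hz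
    simp only [hπ₁]
    split_ifs with h
    · exact hc₁.leaf z h hz.2
    · simp
  have hrev : (v :: t₁).reverse = t₁.reverse ++ v :: ([] ++ []) := by simp
  have hpl1 : IsPlaneGraph (catG (t₁.reverse ++ v :: ([] ++ [])) π₁) := by
    rw [← hrev, catG_reverse]; exact conn1.plane_left
  -- Read backwards, the left tree serves as a prefix that ends in `v`, so the right tree sits at
  -- the end of a caterpillar, as `Good` demands.
  have hctx2 : Ctx {v} ({v} ∪ R) t₁.reverse v [] π₂ := by
    refine Ctx.congr (π := π₁) ?_ fun z hz _ _ => ?_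
    · refine Ctx.of_clean (mid := []) (hrev ▸ hcode1.reverse) hpl1 ?_ ?_ (by simp)
        (by simp) ?_ (by simp) (by simp) (by simp)
      · rw [← hrev, catG_reverse]
        intro a c hac hne d hd hd'
        refine ⟨v, rfl, hmeet d hd' (hull_mono ?_ hd)⟩
        have key : ∀ a, a ∉ v :: t₁ → a ∈ ({v} : Set S) ∪ L ∧ π₁ a ∈ ({v} : Set S) ∪ L ∨
            a ∈ ({v} : Set S) ∪ R ∧ π₁ a ∈ ({v} : Set S) ∪ R := by
          intro a ha
          simp only [List.mem_cons, not_or] at ha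
          by_cases haL : a ∈ L
          · left
            refine ⟨Or.inr haL, ?_⟩
            simp only [hπ₁]
            rw [if_pos haL]
            exact hc₁.mem (hc₁.leaf a haL ha.2)
          · right
            refine ⟨Or.inr (hcov a ha.1 haL), ?_⟩
            simp only [hπ₁]
            rw [if_neg haL]
            simp
        have hac' : (a ∈ ({v} : Set S) ∪ L) ∧ (c ∈ ({v} : Set S) ∪ L) := by
          rcases (catG_adj.1 hac).2 with (h | ⟨h, rfl⟩) | (h | ⟨h, rfl⟩)
          · exact ⟨hc₁.mem h.mem.1, hc₁.mem h.mem.2⟩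
          · exact (key a h).resolve_right hne
          · exact ⟨hc₁.mem h.mem.2, hc₁.mem h.mem.1⟩
          · exact ((key c h).resolve_right fun h' => hne h'.symm).symm
        rintro z (rfl | rfl)
        exacts [hac'.1, hac'.2]
      · intro z hz
        by_contra hz'
        simp at hz'
        have hzL : z ∈ L := by
          by_contra h
          exact hz'.2 (hcov z hz'.1 h)
        exact hz'.1 (Subtype.ext (hmeet z hz (mem_hull (Or.inr hzL))))
      · intro z hz hzt
        have hzL := hc₁.sub z (by simpa using hzt)
        rcases hz with rfl | hz
        exacts [hc₁.not_mem hzL, hLR z hzL hz]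
    · simp only [hπ₂]
      rw [if_neg fun h => hz (Or.inr h)]
  have conn2 := hT₂ t₁.reverse π₂ π₁ hctx2 (fun z hz => by simp only [hπ₂]; rw [if_pos hz])
    (fun z hz => by simp only [hπ₁]; rw [if_neg fun h => hLR z h hz])
    (fun z hz => by simp only [hπ₂]; rw [if_neg hz])
  have e1 : catG (t₁.reverse ++ [v]) π₁ = catG ([] ++ v :: t₁) π₁ := by
    rw [← catG_reverse]; simp
  have e2 : catG (t₁.reverse ++ v :: t₂) π₂ = localG v t₁ ρ₁ L ⊔ localG v t₂ ρ₂ R := by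
    have k1 : ∀ a c, Consec (t₁.reverse ++ v :: t₂) a c ↔
        Consec (v :: t₁) c a ∨ Consec (v :: t₂) a c := by
      intro a c
      rw [consec_append_cons, ← List.reverse_cons, consec_reverse]
    have k2 : ∀ a c, (a ∉ t₁.reverse ++ v :: t₂ ∧ c = π₂ a) ↔
        (a ∈ L ∧ a ∉ t₁ ∧ c = ρ₁ a) ∨ (a ∈ R ∧ a ∉ t₂ ∧ c = ρ₂ a) := by
      intro a c
      simp only [List.mem_append, List.mem_reverse, List.mem_cons, not_or]
      by_cases haL : a ∈ L
      · have h1 := hLR a haL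
        have h2 : a ∉ t₂ := fun h => h1 (hc₂.sub a h)
        have h3 : a ≠ v := fun e => hc₁.not_mem (e ▸ haL)
        simp [hπ₂, hπ₁, haL, h1, h2, h3]
      · have h2 : a ∉ t₁ := fun h => haL (hc₁.sub a h)
        by_cases hav : a = v
        · subst hav
          simp [hc₁.not_mem, hc₂.not_mem]
        · have h1 := hcov a hav haL
          simp [hπ₂, haL, h1, h2, hav]
    ext a c
    rw [SimpleGraph.sup_adj, localG_adj, localG_adj, catG_adj, k1, k1, k2, k2]
    exact sup_aux_reverse
  rw [e1] at conn2
  rw [e2] at conn2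
  have e3 : catG ([] ++ [v]) π₀ = catG [v] fun _ => v := rfl
  exact conn2.trans (e3 ▸ conn1)

end Good

/-! ### Counting good trees around a root. -/

lemma exists_first_of_not_mem_hull (hS : GeneralPosition S) {σ : ℝ} (hσ : σ ≠ 0) {v : S}
    {R : Set S} (hv : (v : Plane) ∉ hull R) (hR : R.Nonempty) :
    ∃ p ∈ R, ∀ z ∈ R, z ≠ p → 0 < area σ v p z := by
  obtain ⟨r, hr⟩ := exists_pos_of_not_mem_hull' hσ hv
  have := exists_first hS hσ (w := v) (r := r) (Z := R.toFinite.toFinset) (by simpa using hR)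
    (by simpa using hr)
  simpa only [Set.Finite.mem_toFinset] using this

/-- The points of `R` on the left of the line from `v` through `q`. -/
def leftOf (v : S) (R : Set S) (σ : ℝ) (q : S) : Set S := {z ∈ R | 0 < area σ v q z}

lemma ncard_leftOf_add (hS : GeneralPosition S) {v q : S} {R : Set S} (hv : v ∉ R) (hq : q ∈ R) :
    (leftOf v R 1 q).ncard + (leftOf v R (-1) q).ncard + 1 = R.ncard := by
  have hd : Disjoint (leftOf v R 1 q) (leftOf v R (-1) q) := by
    rw [Set.disjoint_left]
    rintro z ⟨-, h1⟩ ⟨-, h2⟩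
    rw [area_neg] at h2
    linarith
  have hq' : q ∉ leftOf v R 1 q ∪ leftOf v R (-1) q := by
    simp [leftOf]
  rw [← Set.ncard_union_eq hd, ← Set.ncard_insert_of_notMem hq']
  congr 1
  ext z
  simp only [leftOf, Set.mem_insert_iff, Set.mem_union, Set.mem_ofPred_eq]
  constructor
  · rintro (rfl | ⟨h, -⟩ | ⟨h, -⟩)
    exacts [hq, h, h]
  · intro hz
    by_cases hzq : z = q
    · exact Or.inl hzq
    right
    rcases lt_or_gt_of_ne (area_ne_zero hS (ne_of_mem_of_not_mem hq hv).symm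
      (ne_of_mem_of_not_mem hz hv).symm (Ne.symm hzq) (one_ne_zero : (1 : ℝ) ≠ 0)) with h | h
    · exact Or.inr ⟨hz, by rw [area_neg]; linarith⟩
    · exact Or.inl ⟨hz, h⟩

/-- In the angular order around `v`, every rank occurs once. -/
lemma sum_ncard_leftOf (hS : GeneralPosition S) {v : S} {R : Set S} (hv : (v : Plane) ∉ hull R)
    (F : ℕ → ℕ) :
    ∑ q ∈ R.toFinite.toFinset, F (leftOf v R 1 q).ncard = ∑ k ∈ Finset.range R.ncard, F k := by
  classical
  have hvR : v ∉ R := fun h => hv (mem_hull h)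
  obtain ⟨r, hr⟩ := exists_pos_of_not_mem_hull hv
  -- The number of points to the left decreases strictly along the angular order. The ranks are thus
  -- distinct, and all of them are smaller than the number of points.
  have hlt : ∀ p ∈ R, ∀ q ∈ R, 0 < area 1 (v : Plane) p q →
      (leftOf v R 1 q).ncard < (leftOf v R 1 p).ncard := by
    intro p hp q hq hpq
    refine Set.ncard_lt_ncard ⟨fun z hz => ⟨hz.1, ?_⟩, fun h => ?_⟩
    · exact area_trans (hr p hp) (hr q hq) (hr z hz.1) hpq hz.2
    · have : q ∈ leftOf v R 1 q := h ⟨hq, hpq⟩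
      simp [leftOf] at this
  have hinj : Set.InjOn (fun q => (leftOf v R 1 q).ncard) (R.toFinite.toFinset : Set S) := by
    intro p hp q hq e
    simp only [Set.Finite.coe_toFinset] at hp hq
    by_contra hpq
    rcases lt_or_gt_of_ne (area_ne_zero hS (ne_of_mem_of_not_mem hp hvR).symm
      (ne_of_mem_of_not_mem hq hvR).symm hpq (one_ne_zero : (1 : ℝ) ≠ 0)) with h | h
    · rw [area_swap_right, neg_lt_zero] at h
      exact (hlt q hq p hp h).ne e
    · exact (hlt p hp q hq h).ne' e
  rw [← Finset.sum_image (f := F) hinj]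
  congr 1
  refine Finset.eq_of_subset_of_card_le ?_ ?_
  · intro k hk
    simp only [Finset.mem_image, Set.Finite.mem_toFinset] at hk
    obtain ⟨q, hq, rfl⟩ := hk
    have := ncard_leftOf_add hS hvR hq
    rw [Finset.mem_range]
    omega
  · rw [Finset.card_range, Finset.card_image_of_injOn hinj, Set.ncard_eq_toFinset_card]

namespace Good
variable {v q p : S} {R B : Set S} {T G : SimpleGraph S}

lemma injOn_sup (hG : ∀ a b, G.Adj a b → (a = v ∨ a ∈ R) → ¬ (b = v ∨ b ∈ R)) :
    Set.InjOn (fun T => T ⊔ G) {T | Good v R T} := by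
  intro T₁ h1 T₂ h2 e
  exact eq_of_sup_eq (Q := {a | a = v ∨ a ∈ R}) (fun a b h => h1.support h)
    (fun a b h => h2.support h) hG e

lemma injOn_sup_leaf (hv : v ∉ R) (hp : p ∈ R) :
    Set.InjOn (fun T => T ⊔ starG v {p}) {T | Good v (R \ {p}) T} := by
  refine injOn_sup fun a b h ha hb => ?_
  have hpv : p ≠ v := fun e => hv (e ▸ hp)
  rcases (starG_adj.1 h).2 with ⟨rfl, rfl⟩ | ⟨rfl, rfl⟩
  · rcases ha with h | h
    exacts [hpv h, h.2 rfl]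
  · rcases hb with h | h
    exacts [hpv h, h.2 rfl]

lemma eq_root_of_adj (h : Good v (R \ {p}) T) (hv : v ∉ R) (hp : p ∈ R) {u : S}
    (hu : (T ⊔ starG v {p}).Adj p u) : u = v := by
  have hpv : p ≠ v := fun e => hv (e ▸ hp)
  rw [SimpleGraph.sup_adj, starG_adj] at hu
  rcases hu with hu | ⟨-, ⟨-, h'⟩ | ⟨-, h'⟩⟩
  · rcases (h.support hu).1 with h' | h'
    exacts [absurd h' hpv, absurd rfl h'.2]
  · exact h'
  · exact absurd h' hpv

/-- The first family is completed by hanging the extreme point `p` on `v`. There `p` has no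
neighbour but `v`, so the families are disjoint. -/
lemma ncard_add_le (hS : GeneralPosition S) (hv : v ∉ R) (hp : p ∈ R) {τ : ℝ}
    (hside : ∀ z ∈ R, z ≠ p → 0 < area τ v p z) :
    {T | Good v (R \ {p}) T}.ncard + {T | Good v R T ∧ ∃ u, u ≠ v ∧ T.Adj p u}.ncard ≤
      {T | Good v R T}.ncard := by
  rw [← (injOn_sup_leaf hv hp).ncard_image, ← Set.ncard_union_eq]
  · refine Set.ncard_le_ncard ?_
    rintro _ (⟨T, hT, rfl⟩ | hT)
    exacts [hT.add_leaf hS hv hp hside, hT.1]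
  · rw [Set.disjoint_left]
    rintro _ ⟨T, hT, rfl⟩ ⟨-, u, huv, hu⟩
    exact huv (eq_root_of_adj hT hv hp hu)

/-- Hanging the extreme point `q` on `v` keeps the further neighbour of `p` and gives `q` no
neighbour but `v`. In the second family every point, including `q`, has another neighbour, so the
families are disjoint. -/
lemma ncard_branch_add_le (hS : GeneralPosition S) (hv : v ∉ R) (hp : p ∈ R) (hq : q ∈ R)
    {τ : ℝ} (hside : ∀ z ∈ R, z ≠ q → 0 < area τ v q z) :
    {T | Good v (R \ {q}) T ∧ ∃ u, u ≠ v ∧ T.Adj p u}.ncard +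
      {T | Good v R T ∧ (∃ q ∈ R, ∀ u, T.Adj v u ↔ u = q) ∧ ∀ z ∈ R, ∃ u, u ≠ v ∧ T.Adj z u}.ncard ≤
      {T | Good v R T ∧ ∃ u, u ≠ v ∧ T.Adj p u}.ncard := by
  rw [← ((injOn_sup_leaf hv hq).mono fun T hT => hT.1).ncard_image,
    ← Set.ncard_union_eq]
  · refine Set.ncard_le_ncard ?_
    rintro _ (⟨T, ⟨hT, u, huv, hu⟩, rfl⟩ | hT)
    exacts [⟨hT.add_leaf hS hv hq hside, u, huv, Or.inl hu⟩, ⟨hT.1, hT.2.2 p hp⟩]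
  · rw [Set.disjoint_left]
    rintro _ ⟨T, ⟨hT, -⟩, rfl⟩ ⟨-, -, h⟩
    obtain ⟨u, huv, hu⟩ := h q hq
    exact huv (eq_root_of_adj hT hv hq hu)

/-- The good trees in which `v` is a leaf of `q`. -/
lemma add_root_leaf (hS : GeneralPosition S) (h : Good q B T) (hv : (v : Plane) ∉ hull R)
    (hq : q ∈ R) (hR : 2 ≤ R.ncard) {τ : ℝ} (hτ : τ ≠ 0) (hB : B = leftOf v R τ q) :
    Good v R (T ⊔ starG q (insert v (R \ B) \ {q})) ∧
      (∀ u, (T ⊔ starG q (insert v (R \ B) \ {q})).Adj v u ↔ u = q) ∧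
      ∀ z ∈ R, ∃ u, u ≠ v ∧ (T ⊔ starG q (insert v (R \ B) \ {q})).Adj z u := by
  have hvR : v ∉ R := fun h => hv (mem_hull h)
  have hvq : v ≠ q := fun e => hvR (e ▸ hq)
  have hBR : B ⊆ R := fun z hz => by rw [hB] at hz; exact hz.1
  have hqB : q ∉ B := by simp [hB, leftOf]
  have hvB : v ∉ B := fun h => hvR (hBR h)
  have hsupp : ∀ {a b}, T.Adj a b → a ≠ v ∧ b ≠ v := by
    intro a b hab
    obtain ⟨h1, h2⟩ := h.support hab
    constructor
    · rintro rfl; exact h1.elim hvq hvB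
    · rintro rfl; exact h2.elim hvq hvB
  refine ⟨h.add_root hS hv hq hBR (τ := τ) (fun z hz => by rw [hB] at hz; exact hz.2) ?_, ?_, ?_⟩
  · intro z hz hzq hzB
    have := area_ne_zero hS hvq (fun e => hvR (e ▸ hz)) (Ne.symm hzq) hτ
    refine lt_of_le_of_ne (not_lt.1 fun h => hzB ?_) this
    rw [hB]; exact ⟨hz, h⟩
  · intro u
    rw [SimpleGraph.sup_adj, starG_adj]
    constructor
    · rintro (hu | ⟨-, ⟨-, hu⟩ | ⟨-, hu⟩⟩)
      exacts [absurd rfl (hsupp hu).1, hu, absurd hu hvq]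
    · rintro rfl
      exact Or.inr ⟨hvq, Or.inl ⟨⟨by simp, hvq⟩, rfl⟩⟩
  · intro z hz
    by_cases hzB : z ∈ B
    · obtain ⟨u, hu⟩ := h.exists_adj hzB
      exact ⟨u, (hsupp hu).2, Or.inl hu⟩
    by_cases hzq : z = q
    · subst hzq
      -- At least two points are needed here: for a single one, the point `q` would have no
      -- neighbour but `v`.
      obtain ⟨y, hy, hyz⟩ := Set.exists_ne_of_one_lt_ncard (s := R) hR z
      have hyv : y ≠ v := fun e => hvR (e ▸ hy)
      by_cases hyB : y ∈ B
      · obtain ⟨x, hx⟩ : ∃ x, T.Adj z x := by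
          obtain ⟨t, ρ, hc, rfl, -⟩ := h
          cases t with
          | nil =>
            have := List.mem_singleton.1 (hc.leaf y hyB (by simp))
            exact ⟨y, localG_adj.2 ⟨hyz.symm, Or.inr (Or.inr ⟨hyB, by simp, this.symm⟩)⟩⟩
          | cons x t =>
            exact ⟨x, localG_adj.2 ⟨fun e => hqB (e ▸ hc.sub x (by simp)), Or.inl (Or.inl (by simp))⟩⟩
        exact ⟨x, (hsupp hx).2, Or.inl hx⟩
      · exact ⟨y, hyv, Or.inr (starG_adj.2 ⟨hyz.symm, Or.inr ⟨⟨Or.inr ⟨hy, hyB⟩, hyz⟩, rfl⟩⟩)⟩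
    · exact ⟨q, hvq.symm, Or.inr (starG_adj.2 ⟨hzq, Or.inl ⟨⟨Or.inr ⟨hz, hzB⟩, hzq⟩, rfl⟩⟩)⟩

lemma injOn_sup_root (hv : v ∉ R) (hB : B ⊆ R) :
    Set.InjOn (fun T => T ⊔ starG q (insert v (R \ B) \ {q})) {T | Good q B T} := by
  have hvB : v ∉ B := fun h => hv (hB h)
  refine injOn_sup fun a b h ha hb => ?_
  rcases starG_adj.1 h with ⟨hab, ⟨⟨h1 | h1, h3⟩, h2⟩ | ⟨⟨h1 | h1, h3⟩, h2⟩⟩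
  · exact hvB (h1 ▸ ha.resolve_left h3)
  · exact h1.2 (ha.resolve_left h3)
  · exact hvB (h1 ▸ hb.resolve_left h3)
  · exact h1.2 (hb.resolve_left h3)

/-- The good tree at `q` may occupy either side of the line `vq`, the other points being leaves of
`q`. Both choices yield the star at `q`, so the star is removed from the second family. Any other
tree there has an edge between two points of its side, which no tree of the first family has. -/
lemma ncard_root_le (hS : GeneralPosition S) (hv : (v : Plane) ∉ hull R) (hq : q ∈ R)
    (hR : 2 ≤ R.ncard) :
    {T | Good q (leftOf v R 1 q) T}.ncard + ({T | Good q (leftOf v R (-1) q) T}.ncard - 1) ≤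
      {T | Good v R T ∧ (∀ u, T.Adj v u ↔ u = q) ∧ ∀ z ∈ R, ∃ u, u ≠ v ∧ T.Adj z u}.ncard := by
  have hvR : v ∉ R := fun h => hv (mem_hull h)
  have hsub : ∀ τ, leftOf v R τ q ⊆ R := fun τ z hz => hz.1
  have hqB : ∀ τ, q ∉ leftOf v R τ q := fun τ => by simp [leftOf]
  have hdisj : ∀ z ∈ leftOf v R 1 q, z ∉ leftOf v R (-1) q := by
    rintro z ⟨-, h1⟩ ⟨-, h2⟩
    rw [area_neg] at h2
    linarith
  have hneg : (-1 : ℝ) ≠ 0 := by norm_num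
  rw [← Set.ncard_sdiff_singleton_of_mem (a := starG q (leftOf v R (-1) q)) (star hS (hqB (-1))),
    ← (injOn_sup_root hvR (hsub 1)).ncard_image,
    ← ((injOn_sup_root hvR (hsub (-1))).mono
      (Set.sdiff_subset (t := {starG q (leftOf v R (-1) q)}))).ncard_image,
    ← Set.ncard_union_eq]
  · refine Set.ncard_le_ncard ?_
    rintro _ (⟨T, hT, rfl⟩ | ⟨T, ⟨hT, -⟩, rfl⟩)
    exacts [hT.add_root_leaf hS hv hq hR one_ne_zero rfl, hT.add_root_leaf hS hv hq hR hneg rfl]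
  · rw [Set.disjoint_left]
    rintro _ ⟨T, hT, rfl⟩ ⟨T', ⟨hT', hne⟩, e⟩
    obtain ⟨b, hb, hqb, u, huq, hu⟩ := hT'.exists_branch hne
    have hbR : b ∈ R := hb.1
    have hbq : b ≠ q := hqb.ne.symm
    have h1 : (T ⊔ starG q (insert v (R \ leftOf v R 1 q) \ {q})).Adj b u := by
      rw [← show T' ⊔ starG q _ = T ⊔ starG q _ from e]
      exact Or.inl hu
    rcases h1 with h1 | h1
    · exact hdisj b ((hT.support h1).1.resolve_left hbq) hb
    · rcases (starG_adj.1 h1).2 with ⟨-, h2⟩ | ⟨-, h2⟩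
      exacts [huq h2, hbq h2]

lemma not_mem_hull_leftOf (τ : ℝ) : (q : Plane) ∉ hull (leftOf v R τ q) := by
  intro h
  have := hull_area_gt (fun z hz => hz.2) h
  simp at this

/-- The families for different `q` are disjoint, as `q` is the only neighbour of `v`. The line `vq`
leaves k points on one side and |R| - 1 - k on the other, and each k occurs for exactly one `q`. -/
lemma sum_le_ncard (hS : GeneralPosition S) (hv : (v : Plane) ∉ hull R) (hR : 2 ≤ R.ncard)
    {h : ℕ → ℕ} (hh : ∀ (q : S) (B : Set S), B.ncard < R.ncard → (q : Plane) ∉ hull B →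
      h B.ncard ≤ {T | Good q B T}.ncard) :
    ∑ k ∈ Finset.range R.ncard, (h k + (h (R.ncard - 1 - k) - 1)) ≤
      {T | Good v R T ∧ (∃ q ∈ R, ∀ u, T.Adj v u ↔ u = q) ∧
        ∀ z ∈ R, ∃ u, u ≠ v ∧ T.Adj z u}.ncard := by
  have hvR : v ∉ R := fun h => hv (mem_hull h)
  rw [← sum_ncard_leftOf hS hv fun k => h k + (h (R.ncard - 1 - k) - 1)]
  set K : S → Set (SimpleGraph S) := fun q =>
    {T | Good v R T ∧ (∀ u, T.Adj v u ↔ u = q) ∧ ∀ z ∈ R, ∃ u, u ≠ v ∧ T.Adj z u} with hK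
  have e : {T | Good v R T ∧ (∃ q ∈ R, ∀ u, T.Adj v u ↔ u = q) ∧
      ∀ z ∈ R, ∃ u, u ≠ v ∧ T.Adj z u} = ⋃ q ∈ R.toFinite.toFinset, K q := by
    ext T
    simp only [hK, Set.mem_iUnion, Set.mem_ofPred_eq, Set.Finite.mem_toFinset]
    constructor
    · rintro ⟨h1, ⟨q, hq, h2⟩, h3⟩
      exact ⟨q, hq, h1, h2, h3⟩
    · rintro ⟨q, hq, h1, h2, h3⟩
      exact ⟨h1, ⟨q, hq, h2⟩, h3⟩
  have hd : (R.toFinite.toFinset : Set S).PairwiseDisjoint K := by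
    intro p _ q _ hpq
    refine Set.disjoint_left.2 fun T h1 h2 => hpq ?_
    exact (h2.2.1 p).1 ((h1.2.1 p).2 rfl)
  rw [e, ← Finset.set_biUnion_coe, Set.Finite.ncard_biUnion (Finset.finite_toSet _)
    (fun _ _ => Set.toFinite _) hd, finsum_mem_coe_finset]
  refine Finset.sum_le_sum fun q hq => ?_
  rw [Set.Finite.mem_toFinset] at hq
  have h1 := ncard_leftOf_add hS hvR hq
  refine le_trans ?_ (ncard_root_le hS hv hq hR)
  rw [show R.ncard - 1 - (leftOf v R 1 q).ncard = (leftOf v R (-1) q).ncard by omega]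
  exact add_le_add (hh _ _ (by omega) (not_mem_hull_leftOf _))
    (Nat.sub_le_sub_right (hh _ _ (by omega) (not_mem_hull_leftOf _)) 1)

end Good

/-! ### The recursion and its growth. -/

/-- The recursion for the numbers of trees on `m` points: good trees, good trees in which the first
point is adjacent to a point besides the root, and the partial sums of the former. -/
def treeCount : ℕ → ℕ × ℕ × ℕ
  | 0 => (1, 0, 1)
  | 1 => (1, 0, 2)
  | m + 2 =>
    let c := treeCount (m + 1)
    let g := c.2.1 + (2 * c.2.2 - (m + 2))
    (c.1 + g, g, c.2.2 + (c.1 + g))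

lemma treeCount_pos (m : ℕ) : 1 ≤ (treeCount m).1 := by
  induction m with
  | zero => simp [treeCount]
  | succ m ih =>
    cases m with
    | zero => simp [treeCount]
    | succ m => simp only [treeCount]; omega

lemma treeCount_sum (m : ℕ) :
    (treeCount m).2.2 = ∑ k ∈ Finset.range (m + 1), (treeCount k).1 := by
  induction m with
  | zero => simp [treeCount]
  | succ m ih =>
    rw [Finset.sum_range_succ, ← ih]
    cases m <;> simp [treeCount]

/-- By reflection of the summation index both halves of the sum agree up to the subtracted ones,
which accounts for the closed form in `treeCount`. All counts are at least 1, so the truncated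
subtractions are exact. -/
lemma treeCount_branch (m : ℕ) : (treeCount (m + 2)).2.1 = (treeCount (m + 1)).2.1 +
    ∑ k ∈ Finset.range (m + 2), ((treeCount k).1 + ((treeCount (m + 2 - 1 - k)).1 - 1)) := by
  have h1 : ∑ k ∈ Finset.range (m + 2), ((treeCount k).1 + ((treeCount (m + 2 - 1 - k)).1 - 1)) +
      (m + 2) = 2 * (treeCount (m + 1)).2.2 := by
    have h2 : ∑ k ∈ Finset.range (m + 2), ((treeCount k).1 - 1) + (m + 2) =
        ∑ k ∈ Finset.range (m + 2), (treeCount k).1 := by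
      have : ∑ _k ∈ Finset.range (m + 2), 1 = m + 2 := by simp
      refine (congrArg _ this).symm.trans ?_
      rw [← Finset.sum_add_distrib]
      exact Finset.sum_congr rfl fun k _ => Nat.sub_add_cancel (treeCount_pos k)
    rw [Finset.sum_add_distrib, Finset.sum_range_reflect (fun k => (treeCount k).1 - 1) (m + 2),
      add_assoc, h2, treeCount_sum]
    ring
  simp only [treeCount]
  omega

/-- A step h(m+1) ≥ 3 h(m) + 1 at least triples 2 h(m) + 1. The induction starts at h(7) = 4202,
where 8405 ≥ 3^8 = 6561; it could not start earlier, because h(6) = 963 and 1927 < 3^7. -/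
lemma three_pow_le_treeCount (m : ℕ) : 3 ^ (m + 8) ≤ 2 * (treeCount (m + 7)).1 + 1 := by
  have key : ∀ m, (treeCount (m + 1)).1 + (m + 2) ≤ (treeCount (m + 2)).1 +
      (treeCount (m + 1)).2.2 ∧ (treeCount (m + 2)).1 = (treeCount (m + 1)).1 +
      (treeCount (m + 2)).2.1 ∧ (treeCount (m + 2)).1 ≤ (treeCount (m + 2)).2.2 := by
    intro m
    have h1 : m + 2 ≤ (treeCount (m + 1)).2.2 := by
      rw [treeCount_sum]
      calc m + 2 = ∑ k ∈ Finset.range (m + 1 + 1), 1 := by simp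
        _ ≤ _ := Finset.sum_le_sum fun k _ => treeCount_pos k
    refine ⟨?_, rfl, ?_⟩
    · simp only [treeCount]; omega
    · simp only [treeCount]; omega
  have step : ∀ m, 3 * (treeCount (m + 7)).1 + 1 ≤ (treeCount (m + 8)).1 := by
    intro m
    have h1 := key (m + 5)
    have h2 : (treeCount (m + 8)).1 = (treeCount (m + 7)).1 + ((treeCount (m + 7)).2.1 +
      (2 * (treeCount (m + 7)).2.2 - (m + 8))) := rfl
    have h3 : (treeCount (m + 7)).2.2 = (treeCount (m + 6)).2.2 + (treeCount (m + 7)).1 := rfl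
    have h4 : m + 7 ≤ (treeCount (m + 6)).2.2 := by
      rw [treeCount_sum]
      calc m + 7 = ∑ k ∈ Finset.range (m + 6 + 1), 1 := by simp
        _ ≤ _ := Finset.sum_le_sum fun k _ => treeCount_pos k
    have h5 := key (m + 4)
    simp only [add_assoc, Nat.reduceAdd] at h1 h5
    have h6 := treeCount_pos (m + 7)
    omega
  induction m with
  | zero => norm_num [treeCount]
  | succ m ih =>
    have := step m
    rw [show m + 1 + 8 = m + 8 + 1 by ring, show m + 1 + 7 = m + 8 by ring, pow_succ]
    omega

/-! ### The lower bound for good trees and the case of seven points. -/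

namespace Good
variable {v q p : S} {R B : Set S} {T G : SimpleGraph S}

/-- Both counts need one strong induction over all roots and point sets. The second one is stated
for either orientation, since it will be applied to an extreme point at either end of the angular
order. -/
lemma treeCount_le_aux (hS : GeneralPosition S) (m : ℕ) : ∀ (v : S) (R : Set S), R.ncard = m →
    (v : Plane) ∉ hull R → (treeCount m).1 ≤ {T | Good v R T}.ncard ∧
      ∀ (τ : ℝ) (p : S), τ ≠ 0 → p ∈ R → (∀ z ∈ R, z ≠ p → 0 < area τ v p z) →
        (treeCount m).2.1 ≤ {T | Good v R T ∧ ∃ u, u ≠ v ∧ T.Adj p u}.ncard := by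
  induction m using Nat.strong_induction_on with
  | _ m ih =>
    intro v R hm hv
    have hvR : v ∉ R := fun h => hv (mem_hull h)
    have h1 : 1 ≤ {T | Good v R T}.ncard :=
      (Set.ncard_pos (Set.toFinite _)).2 ⟨_, star hS hvR⟩
    match m, ih, hm with
    | 0, _, _ => exact ⟨h1, fun _ _ _ _ _ => Nat.zero_le _⟩
    | 1, _, _ => exact ⟨h1, fun _ _ _ _ _ => Nat.zero_le _⟩
    | m + 2, ih, hm =>
      have hsub : ∀ q, (v : Plane) ∉ hull (R \ {q}) := fun q h => hv (hull_mono Set.sdiff_subset h)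
      have hcard : ∀ q ∈ R, (R \ {q}).ncard = m + 1 := fun q hq => by
        rw [Set.ncard_sdiff_singleton_of_mem hq, hm]; rfl
      have hbranch : ∀ (τ : ℝ) (p : S), τ ≠ 0 → p ∈ R →
          (∀ z ∈ R, z ≠ p → 0 < area τ v p z) →
          (treeCount (m + 2)).2.1 ≤ {T | Good v R T ∧ ∃ u, u ≠ v ∧ T.Adj p u}.ncard := by
        intro τ p hτ hp hside
        -- The opposite orientation yields the extreme point at the other end of the angular order;
        -- it differs from `p` as there are at least two points.
        obtain ⟨q, hq, hq'⟩ := exists_first_of_not_mem_hull hS (neg_ne_zero.2 hτ) hv ⟨p, hp⟩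
        have hpq : p ≠ q := by
          rintro rfl
          obtain ⟨z, hz, hzp⟩ := Set.exists_ne_of_one_lt_ncard (s := R) (by omega) p
          have h1 := hside z hz hzp
          have h2 := hq' z hz hzp
          rw [area_neg] at h2
          linarith
        refine le_trans ?_ (ncard_branch_add_le hS hvR hp hq hq')
        rw [treeCount_branch]
        refine add_le_add ((ih (m + 1) (by omega) v _ (hcard q hq) (hsub q)).2 τ p hτ ⟨hp, hpq⟩
          fun z hz hzp => hside z hz.1 hzp) ?_
        have := sum_le_ncard hS hv (by omega) (h := fun k => (treeCount k).1)
          fun q B hB hqB => (ih _ (by omega) q B rfl hqB).1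
        rwa [hm] at this
      refine ⟨?_, hbranch⟩
      obtain ⟨p, hp, hp'⟩ := exists_first_of_not_mem_hull hS (one_ne_zero : (1 : ℝ) ≠ 0) hv
        (Set.nonempty_of_ncard_ne_zero (s := R) (by omega))
      refine le_trans ?_ (ncard_add_le hS hvR hp hp')
      exact add_le_add (ih (m + 1) (by omega) v _ (hcard p hp) (hsub p)).1
        (hbranch 1 p one_ne_zero hp hp')

lemma treeCount_le (hS : GeneralPosition S) (hv : (v : Plane) ∉ hull R) :
    (treeCount R.ncard).1 ≤ {T | Good v R T}.ncard :=
  (treeCount_le_aux hS _ v R rfl hv).1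

lemma treeCount_branch_le (hS : GeneralPosition S) (hv : (v : Plane) ∉ hull R) {τ : ℝ} (hτ : τ ≠ 0)
    (hp : p ∈ R) (hside : ∀ z ∈ R, z ≠ p → 0 < area τ v p z) :
    (treeCount R.ncard).2.1 ≤ {T | Good v R T ∧ ∃ u, u ≠ v ∧ T.Adj p u}.ncard :=
  (treeCount_le_aux hS _ v R rfl hv).2 τ p hτ hp hside

/-- The trees which split at `v` into two good trees with further branches. -/
def splits (v : S) (L : Set S) (p : S) (R : Set S) : Set (SimpleGraph S) :=
  (fun T : SimpleGraph S × SimpleGraph S => T.1 ⊔ T.2) ''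
    ({T | Good v L T ∧ ∃ u, u ≠ v ∧ T.Adj p u} ×ˢ ({T | Good v R T} \ {starG v R}))

lemma eq_of_sup_eq_sup {L : Set S} {T₁ T₁' T₂ T₂' : SimpleGraph S} (h1 : Good v L T₁)
    (h1' : Good v L T₁') (h2 : Good v R T₂) (h2' : Good v R T₂') (hLR : Disjoint L R)
    (e : T₁ ⊔ T₂ = T₁' ⊔ T₂') : T₁ = T₁' := by
  have hmeet : ∀ a, (a = v ∨ a ∈ L) → (a = v ∨ a ∈ R) → a = v := fun a h h' => by
    rcases h with h | h
    · exact h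
    · exact h'.resolve_right fun h' => Set.disjoint_left.1 hLR h h'
  have key : ∀ {T T' U U' : SimpleGraph S}, Good v L T → Good v R U' → T ⊔ U = T' ⊔ U' →
      ∀ a b, T.Adj a b → T'.Adj a b := by
    intro T T' U U' h h' e a b hab
    have : (T' ⊔ U').Adj a b := e ▸ Or.inl hab
    refine this.resolve_right fun hab' => hab.ne ?_
    rw [hmeet a (h.support hab).1 (h'.support hab').1, hmeet b (h.support hab).2 (h'.support hab').2]
  ext a b
  exact ⟨key h1 h2' e a b, key h1' h2 e.symm a b⟩

lemma ncard_splits (hS : GeneralPosition S) {L : Set S} (hR : v ∉ R) (hLR : Disjoint L R) :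
    (splits v L p R).ncard = {T | Good v L T ∧ ∃ u, u ≠ v ∧ T.Adj p u}.ncard *
      ({T | Good v R T}.ncard - 1) := by
  have hinj : Set.InjOn (fun T : SimpleGraph S × SimpleGraph S => T.1 ⊔ T.2)
      ({T | Good v L T ∧ ∃ u, u ≠ v ∧ T.Adj p u} ×ˢ ({T | Good v R T} \ {starG v R})) := by
    rintro ⟨T₁, T₂⟩ ⟨⟨h1, -⟩, ⟨h2, -⟩⟩ ⟨T₁', T₂'⟩ ⟨⟨h1', -⟩, ⟨h2', -⟩⟩ e
    have e' : T₁ ⊔ T₂ = T₁' ⊔ T₂' := e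
    refine Prod.ext (h1.eq_of_sup_eq_sup h1' h2 h2' hLR e') ?_
    rw [sup_comm T₁, sup_comm T₁'] at e'
    exact Good.eq_of_sup_eq_sup h2 h2' h1 h1' hLR.symm e'
  rw [splits, hinj.ncard_image, Set.ncard_prod,
    Set.ncard_sdiff_singleton_of_mem (show starG v R ∈ {T | Good v R T} from star hS hR)]

/-- Here `v` has two neighbours with further neighbours, one on each side. In a good tree there is
at most one. -/
lemma not_good_of_mem_splits {L A : Set S} (hL : v ∉ L) (hp : p ∈ L) (hLR : Disjoint L R)
    (hT : T ∈ splits v L p R) : ¬ Good v A T := by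
  obtain ⟨⟨T₁, T₂⟩, ⟨⟨h1, u, huv, hu⟩, ⟨h2, hne⟩⟩, rfl⟩ := hT
  intro h
  have hne' : T₁ ≠ starG v L := by
    rintro rfl
    rcases (starG_adj.1 hu).2 with ⟨-, e⟩ | ⟨-, e⟩
    exacts [huv e, hL (e ▸ hp)]
  obtain ⟨q, hq, hvq, x, hx, hqx⟩ := h1.exists_branch hne'
  obtain ⟨q', hq', hvq', x', hx', hqx'⟩ := h2.exists_branch hne
  have := h.branch_unique (Or.inl hvq) ⟨x, hx, Or.inl hqx⟩ (Or.inr hvq') ⟨x', hx', Or.inr hqx'⟩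
  exact Set.disjoint_left.1 hLR hq (this ▸ hq')

lemma exists_adj_of_mem_splits {L : Set S} (hT : T ∈ splits v L p R) :
    ∃ u ∈ L, T.Adj p u := by
  obtain ⟨⟨T₁, T₂⟩, ⟨⟨h1, u, huv, hu⟩, -⟩, rfl⟩ := hT
  exact ⟨u, (h1.support hu).2.resolve_left huv, Or.inl hu⟩

lemma mem_of_mem_splits {L : Set S} (hR : v ∉ R) (hLR : Disjoint L R) (hT : T ∈ splits v L p R)
    {z u : S} (hz : z ∈ R) (hu : T.Adj z u) : u = v ∨ u ∈ R := by
  obtain ⟨⟨T₁, T₂⟩, ⟨⟨h1, -⟩, ⟨h2, -⟩⟩, rfl⟩ := hT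
  rcases hu with hu | hu
  · rcases (h1.support hu).1 with h | h
    exacts [absurd (h ▸ hz) hR, absurd hz (Set.disjoint_left.1 hLR h)]
  · exact (h2.support hu).2

lemma conn_of_mem_splits (hS : GeneralPosition S) {L : Set S}
    (hv : ({v} : Set S) ∪ (L ∪ R) = Set.univ) (hL : ∀ z ∈ L, z ≠ p → 0 < area (-1) v p z)
    (hR : ∀ z ∈ R, 0 < area 1 v p z) (hT : T ∈ splits v L p R) :
    Conn T (catG [v] fun _ => v) := by
  obtain ⟨⟨T₁, T₂⟩, ⟨⟨h1, -⟩, ⟨h2, -⟩⟩, rfl⟩ := hT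
  refine conn_sup hS h1 h2 hv (b := p) (σ := 1) (fun z hz => ?_) hR
  by_cases e : z = p
  · simp [e]
  · have := hL z hz e
    rw [area_neg] at this
    linarith

lemma le_ncard_splits (hS : GeneralPosition S) {L : Set S} (hv : (v : Plane) ∉ hull {v}ᶜ)
    (hcov : ({v} : Set S) ∪ (L ∪ R) = Set.univ) (hvL : v ∉ L) (hvR : v ∉ R) (hLR : Disjoint L R)
    (hp : p ∈ L) (hL : ∀ z ∈ L, z ≠ p → 0 < area (-1) v p z) :
    (treeCount L.ncard).2.1 * ((treeCount R.ncard).1 - 1) ≤ (splits v L p R).ncard := by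
  rw [ncard_splits hS hvR hLR]
  have hsub : ∀ A : Set S, v ∉ A → (v : Plane) ∉ hull A := fun A hA h =>
    hv (hull_mono (by rintro z hz rfl; exact hA hz) h)
  exact Nat.mul_le_mul (treeCount_branch_le hS (hsub L hvL) (by norm_num) hp hL)
    (Nat.sub_le_sub_right (treeCount_le hS (hsub R hvR)) 1)

/-- The six points give 963 good trees. Splitting after the second and after the third point in the
angular order adds 2 · 50 and 9 · 11 trees, which makes 1162. -/
lemma le_ncard_conn_of_ncard_eq_six (hS : GeneralPosition S) (hv : (v : Plane) ∉ hull {v}ᶜ)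
    (hcard : ({v}ᶜ : Set S).ncard = 6) :
    1093 ≤ {T | Conn T (catG [v] fun _ => v)}.ncard := by
  obtain ⟨p₁, hp₁, h1⟩ := exists_first_of_not_mem_hull hS (one_ne_zero : (1 : ℝ) ≠ 0) hv
    (Set.nonempty_of_ncard_ne_zero (by omega))
  have hsub : ∀ A : Set S, A ⊆ {v}ᶜ → (v : Plane) ∉ hull A := fun A hA h => hv (hull_mono hA h)
  have c1 : ({v}ᶜ \ {p₁} : Set S).ncard = 5 := by
    rw [Set.ncard_sdiff_singleton_of_mem hp₁, hcard]
  obtain ⟨p₂, hp₂, h2⟩ := exists_first_of_not_mem_hull hS (one_ne_zero : (1 : ℝ) ≠ 0)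
    (hsub _ (Set.sdiff_subset (t := {p₁}))) (Set.nonempty_of_ncard_ne_zero (by omega))
  have c2 : (({v}ᶜ \ {p₁}) \ {p₂} : Set S).ncard = 4 := by
    rw [Set.ncard_sdiff_singleton_of_mem hp₂, c1]
  obtain ⟨p₃, hp₃, h3⟩ := exists_first_of_not_mem_hull hS (one_ne_zero : (1 : ℝ) ≠ 0)
    (hsub _ ((Set.sdiff_subset (t := {p₂})).trans (Set.sdiff_subset (t := {p₁}))))
    (Set.nonempty_of_ncard_ne_zero (by omega))
  have c3 : ((({v}ᶜ \ {p₁}) \ {p₂}) \ {p₃} : Set S).ncard = 3 := by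
    rw [Set.ncard_sdiff_singleton_of_mem hp₃, c2]
  set R₂ : Set S := ({v}ᶜ \ {p₁}) \ {p₂} with hR₂
  set R₃ : Set S := R₂ \ {p₃} with hR₃
  have n21 : p₂ ≠ p₁ := hp₂.2
  have n31 : p₃ ≠ p₁ := hp₃.1.2
  have n32 : p₃ ≠ p₂ := hp₃.2
  have hswap : ∀ {a b : S}, 0 < area 1 (v : Plane) a b → 0 < area (-1) (v : Plane) b a := by
    intro a b h
    rw [area_neg, area_swap_right, neg_neg]
    exact h
  have hR2 : ∀ z ∈ R₂, 0 < area 1 (v : Plane) p₂ z := fun z hz => h2 z hz.1 hz.2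
  have hR3 : ∀ z ∈ R₃, 0 < area 1 (v : Plane) p₃ z := fun z hz => h3 z hz.1 hz.2
  have hL2 : ∀ z ∈ ({p₁, p₂} : Set S), z ≠ p₂ → 0 < area (-1) (v : Plane) p₂ z := by
    rintro z (rfl | rfl) hz
    exacts [hswap (h1 _ hp₂.1 n21), absurd rfl hz]
  have hL3 : ∀ z ∈ ({p₁, p₂, p₃} : Set S), z ≠ p₃ → 0 < area (-1) (v : Plane) p₃ z := by
    rintro z (rfl | rfl | rfl) hz
    exacts [hswap (h1 _ hp₃.1.1 n31), hswap (h2 _ hp₃.1 n32), absurd rfl hz]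
  have v2 : v ∉ R₂ := fun h => h.1.1 rfl
  have v3 : v ∉ R₃ := fun h => v2 h.1
  have w3 : v ∉ ({p₁, p₂, p₃} : Set S) := by
    rintro (h | h | h)
    exacts [hp₁ h.symm, hp₂.1 h.symm, hp₃.1.1 h.symm]
  have w2 : v ∉ ({p₁, p₂} : Set S) := by
    rintro (h | h)
    exacts [hp₁ h.symm, hp₂.1 h.symm]
  have d2 : Disjoint ({p₁, p₂} : Set S) R₂ := by
    rw [Set.disjoint_left]
    rintro z (rfl | rfl) hz
    exacts [hz.1.2 rfl, hz.2 rfl]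
  have d3 : Disjoint ({p₁, p₂, p₃} : Set S) R₃ := by
    rw [Set.disjoint_left]
    rintro z (rfl | rfl | rfl) hz
    exacts [hz.1.1.2 rfl, hz.1.2 rfl, hz.2 rfl]
  have u2 : ({v} : Set S) ∪ ({p₁, p₂} ∪ R₂) = Set.univ := by
    ext z
    simp only [hR₂, Set.mem_union, Set.mem_singleton_iff, Set.mem_insert_iff, Set.mem_sdiff,
      Set.mem_compl_iff, Set.mem_univ, iff_true]
    tauto
  have u3 : ({v} : Set S) ∪ ({p₁, p₂, p₃} ∪ R₃) = Set.univ := by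
    ext z
    simp only [hR₃, hR₂, Set.mem_union, Set.mem_singleton_iff, Set.mem_insert_iff, Set.mem_sdiff,
      Set.mem_compl_iff, Set.mem_univ, iff_true]
    tauto
  have e2 := le_ncard_splits hS hv u2 w2 v2 d2 (by simp) hL2
  have e3 := le_ncard_splits hS hv u3 w3 v3 d3 (by simp) hL3
  have e1 := treeCount_le hS hv
  rw [Set.ncard_pair n21.symm, c2] at e2
  rw [Set.ncard_eq_three.2 ⟨p₁, p₂, p₃, n21.symm, n31.symm, n32.symm, rfl⟩, c3] at e3
  rw [hcard] at e1
  have hd : Disjoint {T | Good v {v}ᶜ T} (splits v {p₁, p₂} p₂ R₂ ∪ splits v {p₁, p₂, p₃} p₃ R₃) := by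
    rw [Set.disjoint_left]
    rintro T hT (hT' | hT')
    exacts [not_good_of_mem_splits w2 (by simp) d2 hT' hT,
      not_good_of_mem_splits w3 (by simp) d3 hT' hT]
  -- In the second family `p₃` is adjacent to `p₁` or `p₂`. In the first it belongs to the right
  -- part, whose points are adjacent only to `v` and to each other.
  have hd' : Disjoint (splits v {p₁, p₂} p₂ R₂) (splits v {p₁, p₂, p₃} p₃ R₃) := by
    rw [Set.disjoint_left]
    intro T h h'
    obtain ⟨u, hu, hpu⟩ := exists_adj_of_mem_splits h'
    rcases mem_of_mem_splits v2 d2 h hp₃ hpu with rfl | hu'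
    · exact w3 hu
    · rcases hu with rfl | rfl | rfl
      exacts [hu'.1.2 rfl, hu'.2 rfl, hpu.ne rfl]
  have hle : ({T | Good v {v}ᶜ T} ∪ (splits v {p₁, p₂} p₂ R₂ ∪ splits v {p₁, p₂, p₃} p₃ R₃)).ncard ≤
      {T | Conn T (catG [v] fun _ => v)}.ncard := by
    refine Set.ncard_le_ncard ?_
    rintro T (hT | hT | hT)
    exacts [hT.conn (Set.union_compl_self _), conn_of_mem_splits hS u2 hL2 hR2 hT,
      conn_of_mem_splits hS u3 hL3 hR3 hT]
  rw [Set.ncard_union_eq hd, Set.ncard_union_eq hd'] at hle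
  simp only [treeCount] at e1 e2 e3
  norm_num at e1 e2 e3
  omega

end Good

/-! ### The bound for the component of a star and the conclusion. -/

lemma three_pow_card_le (hS : GeneralPosition S) {v : S} (hv : (v : Plane) ∉ hull {v}ᶜ)
    (hcard : 7 ≤ S.card) : 3 ^ S.card ≤ 2 * {T | Conn T (catG [v] fun _ => v)}.ncard + 1 := by
  have hc : ({v}ᶜ : Set S).ncard = S.card - 1 := by
    rw [Set.ncard_compl, Set.ncard_singleton, Nat.card_eq_fintype_card, Fintype.card_coe]
  rcases hcard.eq_or_lt with h | h
  · have := Good.le_ncard_conn_of_ncard_eq_six hS hv (by omega)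
    rw [← h]
    omega
  · obtain ⟨m, hm⟩ := Nat.exists_eq_add_of_lt h
    have h1 := Good.treeCount_le hS hv
    have h2 : {T | Good v {v}ᶜ T}.ncard ≤ {T | Conn T (catG [v] fun _ => v)}.ncard :=
      Set.ncard_le_ncard fun T hT => Good.conn hT (Set.union_compl_self _)
    have h3 := three_pow_le_treeCount m
    rw [hc, show S.card - 1 = m + 7 by omega] at h1
    rw [show S.card = m + 8 by omega]
    omega

/-- An extreme point of the convex hull of `S` is taken. The count is rooted there, since all other
points then lie in an open half-plane beside a line through the root. -/
lemma exists_not_mem_hull (h : S.Nonempty) : ∃ v : S, (v : Plane) ∉ hull {v}ᶜ := by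
  have hc : IsCompact (convexHull ℝ (S : Set Plane)) := S.finite_toSet.isCompact_convexHull ℝ
  obtain ⟨x, hx⟩ := hc.extremePoints_nonempty (convexHull_nonempty_iff.2 h)
  have hxS : x ∈ S := extremePoints_convexHull_subset hx
  refine ⟨⟨x, hxS⟩, fun hmem => ?_⟩
  refine ((convex_convexHull ℝ _).mem_extremePoints_iff_mem_sdiff_convexHull_sdiff.1 hx).2
    (convexHull_mono ?_ hmem)
  rintro _ ⟨y, hy, rfl⟩
  exact ⟨subset_convexHull ℝ _ y.2, fun e => hy (Subtype.ext e)⟩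

theorem theorem4 (S : Finset Plane) (hS : GeneralPosition S) :
    (∀ C D : PlaneCaterpillar S, IsWellSeparated C.1 → IsWellSeparated D.1 →
      (slideGraph S).Reachable C D) ∧
    (7 ≤ S.card →
      ∃ K : (slideGraph S).ConnectedComponent,
        (∀ C : PlaneCaterpillar S, IsWellSeparated C.1 → C ∈ K.supp) ∧
        ((3 : ℝ) ^ S.card - 1) / 2 ≤ (K.supp.ncard : ℝ)) := by
  refine ⟨?_, fun hcard => ?_⟩
  · rintro ⟨G, hG⟩ ⟨G', hG'⟩ hC hD
    obtain ⟨_, _, h⟩ := conn_of_isWellSeparated hS hG.1 hG.2 hC hG'.1 hG'.2 hD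
    exact h
  obtain ⟨v, hv⟩ := exists_not_mem_hull (S := S) (Finset.card_pos.1 (by omega))
  have hstar : IsPlaneGraph (catG [v] fun _ : S => v) ∧ IsCaterpillar (catG [v] fun _ : S => v) :=
    ((Good.star hS (R := {v}ᶜ) (by simp)).conn (Set.union_compl_self _)).2.1
  refine ⟨(slideGraph S).connectedComponentMk ⟨_, hstar⟩, fun C hC => ?_, ?_⟩
  · rw [SimpleGraph.ConnectedComponent.mem_supp_iff, SimpleGraph.ConnectedComponent.eq]
    obtain ⟨y, hy⟩ := conn_star_of_isWellSeparated hS C.2.1 C.2.2 hC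
    have : Conn C.1 (catG [v] fun _ => v) := by
      by_cases e : y = v
      · exact e ▸ hy
      · exact hy.trans (conn_star_star hS e)
    exact this.2.2
  · have hle : {T | Conn T (catG [v] fun _ => v)}.ncard ≤
        ((slideGraph S).connectedComponentMk ⟨_, hstar⟩).supp.ncard := by
      -- The graphs counted so far are compared with the vertices of the slide graph, which carry
      -- proofs, by forgetting these proofs.
      rw [← Set.ncard_image_of_injective _ Subtype.val_injective]
      refine Set.ncard_le_ncard ?_
      rintro T ⟨h1, h2, h⟩
      refine ⟨⟨T, h1⟩, ?_, rfl⟩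
      rw [SimpleGraph.ConnectedComponent.mem_supp_iff, SimpleGraph.ConnectedComponent.eq]
      exact h
    have h := (three_pow_card_le hS hv hcard).trans
      (Nat.add_le_add_right (Nat.mul_le_mul_left 2 hle) 1)
    have h' : (3 : ℝ) ^ S.card ≤
        2 * (((slideGraph S).connectedComponentMk ⟨_, hstar⟩).supp.ncard : ℝ) + 1 := by
      exact_mod_cast h
    linarith
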